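/- Let $p,q,N,\sigma$ be real numbers with $q>p-1>0$ and $p<-\sigma<N$ ($N$ need not be an integer), and let $\varepsilon\in\{1,-1\}$. Consider the equation $$-\big(|w'|^{p-2}w'\big)'-\frac{N-1}{r}|w'|^{p-2}w'=\varepsilon r^{\sigma}w^{q},\qquad r>0. \tag{E}$$ A solution on an open interval $I\subset(0,\infty)$ is a function $w>0$ on $I$ such that $w$ and $|w'|^{p-2}w'$ are of class $C^1$ and (E) holds on $I$ (so $w$ is $C^2$ wherever $w'\neq0$). It is global if $I=(0,\infty)$, and nonglobal if it is not the restriction of a solution on $(0,\infty)$. Put $$\gamma=\frac{p+\sigma}{q+1-p}<0,\qquad a^*=\Big(|\gamma|^{p-1}\big(N-p+(p-1)|\gamma|\big)\Big)^{\frac1{q+1-p}}>0,\qquad w^*(r)=a^*r^{-\gamma}.$$ 1. For $\varepsilon=\pm1$, there is no solution $w$ on any interval $(0,\rho)$, $\rho>0$, with $\lim_{r\to0}w=c$ for some $c\in(0,\infty)$. 2. For $\varepsilon=\pm1$, there are nonglobal $C^2$ solutions near $\infty$, i.e. on intervals $(r_0,\infty)$ with $r_0>0$, of two types: for every $C>0$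 there are $D>0$ and such a solution with $$\lim_{r\to\infty}w=C,\qquad \lim_{r\to\infty}r^{-\frac{\sigma+1}{p-1}}w'=-\varepsilon D;$$ and for every $k>0$ there are $c>0$ and such a solution with $$\lim_{r\to\infty}w=0,\qquad \lim_{r\to\infty}r^{\frac{N-p}{p-1}}w=k,\qquad \lim_{r\to\infty}r^{\frac{N-1}{p-1}}w'=-c.$$ 3. Let $\varepsilon=-1$. - $w^*$ is a global $C^2$ solution, with $\lim_{r\to0}w^*=0$; it has a cusp at $0$, that is $\lim_{r\to0}|w^{*\prime}|=\infty$, if and only if $-\sigma<q+1$. - For every $C>0$ there are $D>0$ and a global $C^2$ solution $w$ with $$w\sim w^*\ (r\to0),\qquad \lim_{r\to\infty}w=C,\qquad \lim_{r\to\infty}r^{-\frac{\sigma+1}{p-1}}w'=D.$$ - Every global solution is either $w^*$ or satisfies the conditions displayed in the previous item for some $C,D>0$. - For every $r_0>0$ there are: a $C^2$ solution on $(r_0,\infty)$ with $\lim_{r\to r_0}w=0$ and $w\sim w^*$ as $r\to\infty$; a solution on $(r_0,\infty)$ with $\lim_{r\to r_0}w=\infty$ and $w\sim w^*$ as $r\to\infty$;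 and a nonglobal $C^2$ solution on $(0,r_0)$ with $w\sim w^*$ as $r\to0$ and $\lim_{r\to r_0}w=\infty$. 4. For $\varepsilon=1$ there is no solution on any interval $(0,r_0)$, $r_0>0$. -/

import Mathlib

open Set Filter Topology

noncomputable section

namespace HardyHenon

/-- The odd power `|x|^(p-2) x` of the `p`-Laplacian (its value at `x = 0` is `0`). -/
def flux (p x : ℝ) : ℝ := |x| ^ (p - 2) * x

/-- `w` is a positive solution, on the open set `I ⊆ (0, ∞)`, of
`-(|w'|^(p-2) w')' - ((N-1)/r) |w'|^(p-2) w' = ε r^σ w^q`.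
The function `w` and its flux `|w'|^(p-2) w'` are differentiable and the equation holds at every
point; then both are automatically of class `C^1`, and `w` is `C^2` wherever `w' ≠ 0`. -/
structure IsPosSolution (p q N σ ε : ℝ) (I : Set ℝ) (w : ℝ → ℝ) : Prop where
  pos : ∀ r ∈ I, 0 < w r
  differentiable : ∀ r ∈ I, DifferentiableAt ℝ w r
  flux_differentiable : ∀ r ∈ I, DifferentiableAt ℝ (fun x => flux p (deriv w x)) r
  equation : ∀ r ∈ I,
    -deriv (fun x => flux p (deriv w x)) r - (N - 1) / r * flux p (deriv w r)
      = ε * r ^ σ * w r ^ q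

/-- A function on `I ⊆ (0, ∞)` is nonglobal if it is not the restriction to `I` of any positive
solution on the whole of `(0, ∞)`. -/
def IsNonglobal (p q N σ ε : ℝ) (I : Set ℝ) (w : ℝ → ℝ) : Prop :=
  ∀ W : ℝ → ℝ, IsPosSolution p q N σ ε (Ioi 0) W → ¬ EqOn W w I

/-- The exponent `γ = (p + σ) / (q + 1 - p)`. -/
def gam (p q σ : ℝ) : ℝ := (p + σ) / (q + 1 - p)

/-- The constant `a*`, given by `a*^(q+1-p) = ε |γ|^(p-2) γ (N - p - (p-1) γ)` where the right-hand
side is positive. -/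
def aStar (p q N σ ε : ℝ) : ℝ :=
  (ε * flux p (gam p q σ) * (N - p - (p - 1) * gam p q σ)) ^ (1 / (q + 1 - p))

/-- The particular function `w*(r) = a* r^(-γ)`. -/
def wStar (p q N σ ε : ℝ) (r : ℝ) : ℝ := aStar p q N σ ε * r ^ (-gam p q σ)

end HardyHenon

end

open HardyHenon

namespace HardyHenon

/-! ### Odd powers -/

/-! Put t = log r, β = -γ, m = 1/(p-1) and κ = N - p + β(p-1). Write w = a* r^β v(t), and let Z be
the flux of w divided by that of w*. The equation becomes the autonomous planar system v' = β(Z^m -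
v), Z' = -κ(ε v^q + Z), where Z^m is an odd power; the constant a* belonging to ε = -1 serves for
both signs. The hypotheses give β > 0, qm > 1, β < κm (that is, N > p) and βq < κ (that is, N + σ >
0). Translation in t is the scaling of the equation, so every prescribed C, k or r₀ is reached by
shifting a single orbit.

For ε = -1 the system has the equilibria (0,0) and (1,1) in v ≥ 0, the second one being w*; for ε =
1 only (0,0). The origin is approached as t → +∞ at two rates: v ~ e^{-βt}, where w tends to a
constant, and v ~ e^{-κmt}, where w decays like r^{-(N-p)/(p-1)}. The point (1,1) is a saddle. One
unstable branch runs to the origin and gives the global solutions, the other blows up and gives the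
interior ones; the two stable branches give the exterior solutions.

The powers need not be smooth at 0, and whole branches are needed rather than germs, so no
linearization is used. Each curve is a graph over a suitable coordinate. It solves a scalar slope
equation, singular at the equilibrium in most cases, and is trapped between explicit sub- and
supersolutions (`exists_solution_between`); separation of variables then restores time
(`exists_autonomous_solution`).

Nonexistence near r = 0 comes from following e^{βt} v and e^{κt} Z backwards: their derivatives are
β e^{βt} Z^m and -κ ε e^{κt} v^q, and integrating these forces v to reach 0 in finite backward time
(`not_isOrbit_one_near_neg_infty`, `IsOrbit.not_tendsto_near_neg_infty`).

For the classification with ε = -1, the ratio P = v^{-1/m} Z obeys a Riccati-type equation driven by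
V = v^{q-1/m}. Where v > 1 this system blows up in finite forward or backward time
(`false_of_superlinear`), so a global orbit has v ≤ 1. If it touches 1 it is the equilibrium;
otherwise it decreases from (1,1) to the origin at the slow rate, with Z > v^q throughout
(`IsOrbit.global_classification`). For ε = -1 the local solutions at infinity are nonglobal because
they violate one of these properties; for ε = 1 there is no global solution at all. -/

/-- The odd extension of `x ↦ x ^ a` to the real line. -/
noncomputable def spow (a x : ℝ) : ℝ := (max x 0) ^ a - (max (-x) 0) ^ a

theorem spow_of_nonneg {a x : ℝ} (ha : 0 < a) (hx : 0 ≤ x) : spow a x = x ^ a := by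
  simp [spow, hx, Real.zero_rpow ha.ne']

theorem spow_neg (a x : ℝ) : spow a (-x) = -spow a x := by
  simp [spow]

theorem spow_zero {a : ℝ} (ha : 0 < a) : spow a 0 = 0 := by
  rw [spow_of_nonneg ha le_rfl, Real.zero_rpow ha.ne']

theorem spow_one {a : ℝ} (ha : 0 < a) : spow a 1 = 1 := by
  rw [spow_of_nonneg ha zero_le_one, Real.one_rpow]

theorem continuous_spow {a : ℝ} (ha : 0 < a) : Continuous (spow a) := by
  unfold spow
  exact ((continuous_id.max continuous_const).rpow_const fun _ => Or.inr ha.le).sub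
    ((continuous_neg.max continuous_const).rpow_const fun _ => Or.inr ha.le)

theorem spow_strictMono {a : ℝ} (ha : 0 < a) : StrictMono (spow a) := by
  have h1 : ∀ x y : ℝ, 0 ≤ x → x < y → spow a x < spow a y := fun x y hx hxy => by
    rw [spow_of_nonneg ha hx, spow_of_nonneg ha (hx.trans hxy.le)]
    exact Real.rpow_lt_rpow hx hxy ha
  intro x y hxy
  rcases le_or_gt 0 x with hx | hx
  · exact h1 x y hx hxy
  · rcases le_or_gt y 0 with hy | hy
    · have := h1 (-y) (-x) (by linarith) (by linarith)
      rw [spow_neg, spow_neg] at this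
      linarith
    · have h2 := h1 0 (-x) le_rfl (by linarith)
      have h3 := h1 0 y le_rfl hy
      rw [spow_neg, spow_zero ha] at h2
      rw [spow_zero ha] at h3
      linarith

theorem spow_nonneg {a x : ℝ} (ha : 0 < a) (hx : 0 ≤ x) : 0 ≤ spow a x := by
  rw [spow_of_nonneg ha hx]; positivity

theorem spow_spow {a b : ℝ} (ha : 0 < a) (hb : 0 < b) (x : ℝ) :
    spow a (spow b x) = spow (b * a) x := by
  have h1 : ∀ x : ℝ, 0 ≤ x → spow a (spow b x) = spow (b * a) x := fun x hx => by
    rw [spow_of_nonneg hb hx, spow_of_nonneg ha (by positivity),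
      spow_of_nonneg (by positivity) hx, Real.rpow_mul hx]
  rcases le_total 0 x with hx | hx
  · exact h1 x hx
  · have := h1 (-x) (by linarith)
    rw [spow_neg, spow_neg, spow_neg] at this
    linarith

theorem spow_one_left (x : ℝ) : spow 1 x = x := by
  simp only [spow, Real.rpow_one]
  rcases le_total 0 x with hx | hx
  · simp [hx]
  · simp [hx]

theorem spow_mul {a c : ℝ} (ha : 0 < a) (hc : 0 ≤ c) (x : ℝ) :
    spow a (c * x) = c ^ a * spow a x := by
  have h1 : ∀ x : ℝ, 0 ≤ x → spow a (c * x) = c ^ a * spow a x := fun x hx => by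
    rw [spow_of_nonneg ha (by positivity), spow_of_nonneg ha hx, Real.mul_rpow hc hx]
  rcases le_total 0 x with hx | hx
  · exact h1 x hx
  · have := h1 (-x) (by linarith)
    rw [mul_neg, spow_neg, spow_neg] at this
    linarith

theorem flux_eq_spow {p : ℝ} (hp : 1 < p) (x : ℝ) : flux p x = spow (p - 1) x := by
  have h1 : ∀ x : ℝ, 0 ≤ x → flux p x = spow (p - 1) x := fun x hx => by
    rw [spow_of_nonneg (by linarith) hx, flux, abs_of_nonneg hx]
    rcases hx.eq_or_lt with rfl | hx
    · rw [mul_zero, Real.zero_rpow (by linarith)]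
    · rw [show p - 1 = p - 2 + 1 by ring, Real.rpow_add_one hx.ne']
  rcases le_total 0 x with hx | hx
  · exact h1 x hx
  · have := h1 (-x) (by linarith)
    rw [spow_neg, flux, abs_neg] at this
    rw [flux]; linarith

theorem abs_spow {a : ℝ} (ha : 0 < a) (x : ℝ) : |spow a x| = |x| ^ a := by
  rcases le_total 0 x with hx | hx
  · rw [spow_of_nonneg ha hx, abs_of_nonneg hx, abs_of_nonneg (by positivity)]
  · have := spow_neg a (-x)
    rw [neg_neg, spow_of_nonneg (x := -x) ha (by linarith)] at this
    rw [this, abs_neg, abs_of_nonpos hx, abs_of_nonneg (Real.rpow_nonneg (by linarith) _)]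

theorem contDiffAt_spow {a x : ℝ} (ha : 0 < a) (hx : x ≠ 0) {n : WithTop ℕ∞} :
    ContDiffAt ℝ n (spow a) x := by
  rcases lt_or_gt_of_ne hx with hx | hx
  · have : (fun y => -(-y) ^ a) =ᶠ[𝓝 x] spow a := by
      filter_upwards [Iio_mem_nhds hx] with y hy
      have h := spow_neg a (-y)
      rw [neg_neg, spow_of_nonneg (x := -y) ha (by linarith [mem_Iio.1 hy])] at h
      exact h.symm
    refine ContDiffAt.congr_of_eventuallyEq ?_ this.symm
    exact (contDiffAt_id.neg.rpow_const_of_ne (by simpa using hx.ne)).neg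
  · have : (fun y => y ^ a) =ᶠ[𝓝 x] spow a := by
      filter_upwards [Ioi_mem_nhds hx] with y hy
      exact (spow_of_nonneg ha (le_of_lt hy)).symm
    refine ContDiffAt.congr_of_eventuallyEq ?_ this.symm
    exact contDiffAt_id.rpow_const_of_ne hx.ne'

/-! ### One-variable calculus -/

/-- Comparison principle: after its last nonpositive value h would be nonincreasing, so it never
becomes positive. The sign of the derivative is required only where h > 0, which is what barrier
arguments can supply. -/
theorem nonpos_of_deriv_nonpos_of_pos {h h' : ℝ → ℝ} {a b : ℝ} (hc : ContinuousOn h (Icc a b))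
    (hd : ∀ x ∈ Ioo a b, HasDerivAt h (h' x) x) (ha : h a ≤ 0)
    (hp : ∀ x ∈ Ioo a b, 0 < h x → h' x ≤ 0) : ∀ x ∈ Icc a b, h x ≤ 0 := by
  intro x hx
  by_contra! hpos
  set S := Icc a x ∩ h ⁻¹' Iic 0 with hS
  have hsub : Icc a x ⊆ Icc a b := Icc_subset_Icc_right hx.2
  have hcl : IsClosed S := (hc.mono hsub).preimage_isClosed_of_isClosed isClosed_Icc isClosed_Iic
  have hne : S.Nonempty := ⟨a, ⟨le_rfl, hx.1⟩, ha⟩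
  have hbd : BddAbove S := ⟨x, fun y hy => hy.1.2⟩
  have hmem : sSup S ∈ S := hcl.csSup_mem hne hbd
  set c := sSup S with hcdef
  have hgt : ∀ y ∈ Ioo c x, 0 < h y := fun y hy => by
    by_contra! hle
    have : y ∈ S := ⟨⟨hmem.1.1.trans hy.1.le, hy.2.le⟩, hle⟩
    exact absurd (le_csSup hbd this) (not_le.2 hy.1)
  have hanti : AntitoneOn h (Icc c x) := by
    refine antitoneOn_of_deriv_nonpos (convex_Icc _ _)
      (hc.mono (Icc_subset_Icc hmem.1.1 hx.2)) ?_ ?_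
    · rw [interior_Icc]
      intro y hy
      exact (hd y ⟨hmem.1.1.trans_lt hy.1, hy.2.trans_le hx.2⟩).differentiableAt.differentiableWithinAt
    · rw [interior_Icc]
      intro y hy
      have hy' : y ∈ Ioo a b := ⟨hmem.1.1.trans_lt hy.1, hy.2.trans_le hx.2⟩
      rw [(hd y hy').deriv]
      exact hp y hy' (hgt y hy)
  have h1 := hanti ⟨le_rfl, hmem.1.2⟩ ⟨hmem.1.2, le_rfl⟩ hmem.1.2
  have h2 : h c ≤ 0 := hmem.2
  linarith

theorem add_mul_le_of_le_deriv {f f' : ℝ → ℝ} {s t η : ℝ} (hst : s ≤ t)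
    (hd : ∀ x ∈ Icc s t, HasDerivAt f (f' x) x) (hη : ∀ x ∈ Icc s t, η ≤ f' x) :
    f s + η * (t - s) ≤ f t := by
  have := Convex.mul_sub_le_image_sub_of_le_deriv (convex_Icc s t) (f := f) (C := η)
    (fun x hx => (hd x hx).continuousAt.continuousWithinAt)
    (fun x hx => (hd x (interior_subset hx)).differentiableAt.differentiableWithinAt)
    (fun x hx => by
      have hx := interior_subset hx
      rw [(hd x hx).deriv]; exact hη x hx)
    s ⟨le_rfl, hst⟩ t ⟨hst, le_rfl⟩ hst
  linarith

theorem image_le_image_of_deriv_nonneg {f f' : ℝ → ℝ} {s t : ℝ} (hst : s ≤ t)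
    (hd : ∀ x ∈ Icc s t, HasDerivAt f (f' x) x) (hη : ∀ x ∈ Icc s t, 0 ≤ f' x) :
    f s ≤ f t := by
  have := add_mul_le_of_le_deriv hst hd hη
  linarith

theorem image_le_image_of_deriv_nonpos {f f' : ℝ → ℝ} {s t : ℝ} (hst : s ≤ t)
    (hd : ∀ x ∈ Icc s t, HasDerivAt f (f' x) x) (hη : ∀ x ∈ Icc s t, f' x ≤ 0) :
    f t ≤ f s := by
  have := image_le_image_of_deriv_nonneg (f := fun x => -f x) hst (fun x hx => (hd x hx).neg)
    (fun x hx => by linarith [hη x hx])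
  linarith

theorem exists_ge_of_le_deriv {f f' : ℝ → ℝ} {t₀ η : ℝ} (hη : 0 < η)
    (hd : ∀ x, t₀ ≤ x → HasDerivAt f (f' x) x) (h : ∀ x, t₀ ≤ x → η ≤ f' x) (M : ℝ) :
    ∃ t, t₀ ≤ t ∧ M ≤ f t := by
  refine ⟨t₀ + |M - f t₀| / η, by have := abs_nonneg (M - f t₀); simp; positivity, ?_⟩
  have h0 : t₀ ≤ t₀ + |M - f t₀| / η := by have := abs_nonneg (M - f t₀); simp; positivity
  have := add_mul_le_of_le_deriv h0 (fun x hx => hd x hx.1) (fun x hx => h x hx.1)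
  have h2 : η * (t₀ + |M - f t₀| / η - t₀) = |M - f t₀| := by field_simp; ring
  rw [h2] at this
  linarith [le_abs_self (M - f t₀)]

/-- While negative, h rises at rate at least η, so it reaches 0 in finite time; the comparison
principle applied to -h keeps it nonnegative afterwards. -/
theorem eventually_nonneg_of_pushed {h h' : ℝ → ℝ} {t₀ η : ℝ} (hη : 0 < η)
    (hd : ∀ t, t₀ ≤ t → HasDerivAt h (h' t) t) (hp : ∀ t, t₀ ≤ t → h t ≤ 0 → η ≤ h' t) :
    ∃ t₁, t₀ ≤ t₁ ∧ ∀ t, t₁ ≤ t → 0 ≤ h t := by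
  obtain ⟨t₁, ht₁, h1⟩ : ∃ t₁, t₀ ≤ t₁ ∧ 0 ≤ h t₁ := by
    by_contra! hneg
    obtain ⟨t, ht, hM⟩ := exists_ge_of_le_deriv hη hd (fun x hx => hp x hx (hneg x hx).le) 0
    linarith [hneg t ht]
  refine ⟨t₁, ht₁, fun t ht => ?_⟩
  have := nonpos_of_deriv_nonpos_of_pos (h := fun x => -h x) (h' := fun x => -h' x) (a := t₁)
    (b := t) (fun x hx => ((hd x (ht₁.trans hx.1)).neg).continuousAt.continuousWithinAt)
    (fun x hx => (hd x (ht₁.trans hx.1.le)).neg) (by linarith)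
    (fun x hx hpos => by linarith [hp x (ht₁.trans hx.1.le) (by linarith)]) t ⟨ht, le_rfl⟩
  linarith

/-- Once h is close to L, the term -a g pushes g at a definite rate back into any band around L / a,
from above and from below. -/
theorem tendsto_of_relaxation {g h : ℝ → ℝ} {t₀ a L : ℝ} (ha : 0 < a)
    (hd : ∀ t, t₀ ≤ t → HasDerivAt g (-a * g t + h t) t) (hh : Tendsto h atTop (𝓝 L)) :
    Tendsto g atTop (𝓝 (L / a)) := by
  rw [Metric.tendsto_atTop]
  intro η hη
  obtain ⟨T, hT⟩ := (Metric.tendsto_atTop.1 hh) (a * η / 4) (by positivity)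
  have hLa : a * (L / a) = L := by field_simp
  obtain ⟨t₁, -, h1⟩ := eventually_nonneg_of_pushed (h := fun t => L / a + η / 2 - g t)
    (h' := fun t => -(-a * g t + h t)) (t₀ := max t₀ T) (η := a * η / 4) (by positivity)
    (fun t ht => (hd t ((le_max_left _ _).trans ht)).const_sub _)
    (fun t ht hle => by
      have := abs_lt.1 (by simpa [Real.dist_eq] using hT t ((le_max_right _ _).trans ht))
      have h2 : a * (L / a + η / 2) ≤ a * g t := mul_le_mul_of_nonneg_left (by linarith) ha.le
      rw [mul_add, hLa] at h2
      linarith [this.2])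
  obtain ⟨t₂, -, h2⟩ := eventually_nonneg_of_pushed (h := fun t => g t - (L / a - η / 2))
    (h' := fun t => (-a * g t + h t)) (t₀ := max t₀ T) (η := a * η / 4) (by positivity)
    (fun t ht => (hd t ((le_max_left _ _).trans ht)).sub_const _)
    (fun t ht hle => by
      have := abs_lt.1 (by simpa [Real.dist_eq] using hT t ((le_max_right _ _).trans ht))
      have h2 : a * g t ≤ a * (L / a - η / 2) := mul_le_mul_of_nonneg_left (by linarith) ha.le
      rw [mul_sub, hLa] at h2
      linarith [this.1])
  refine ⟨max t₁ t₂, fun t ht => ?_⟩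
  have h3 := h1 t ((le_max_left _ _).trans ht)
  have h4 := h2 t ((le_max_right _ _).trans ht)
  rw [Real.dist_eq, abs_lt]
  constructor <;> linarith

/-- f minus (K/δ) e^{-δt} is nondecreasing, while f plus the same term is nonincreasing and so
bounds it; monotone convergence applies and the correction vanishes at infinity. -/
theorem exists_tendsto_of_deriv_exp_bound {f f' : ℝ → ℝ} {t₀ K δ : ℝ} (hδ : 0 < δ)
    (hd : ∀ t, t₀ ≤ t → HasDerivAt f (f' t) t)
    (hK : ∀ t, t₀ ≤ t → |f' t| ≤ K * Real.exp (-δ * t)) : ∃ L, Tendsto f atTop (𝓝 L) := by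
  have hE : ∀ t, HasDerivAt (fun t => K / δ * Real.exp (-δ * t)) (-(K * Real.exp (-δ * t))) t := by
    intro t
    have := (((hasDerivAt_id t).const_mul (-δ)).exp).const_mul (K / δ)
    refine this.congr_deriv ?_
    simp only [id]; field_simp
  have hK0 : 0 ≤ K := by
    have := (abs_nonneg _).trans (hK t₀ le_rfl)
    exact nonneg_of_mul_nonneg_left this (Real.exp_pos _)
  -- The maximum freezes the function before t₀, so that it is monotone on the whole line.
  set g : ℝ → ℝ := fun t => f (max t t₀) - K / δ * Real.exp (-δ * max t t₀) with hg
  have hmono : Monotone g := by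
    intro s t hst
    refine image_le_image_of_deriv_nonneg (f := fun t => f t - K / δ * Real.exp (-δ * t))
      (max_le_max_right t₀ hst)
      (fun x hx => (hd x ((le_max_right _ _).trans hx.1)).sub (hE x)) (fun x hx => ?_)
    linarith [abs_le.1 (hK x ((le_max_right _ _).trans hx.1))]
  have hbdd : BddAbove (range g) := by
    refine ⟨f t₀ + K / δ * Real.exp (-δ * t₀), ?_⟩
    rintro _ ⟨t, rfl⟩
    have h1 := image_le_image_of_deriv_nonpos (f := fun t => f t + K / δ * Real.exp (-δ * t))
      (le_max_right t t₀) (fun x hx => (hd x hx.1).add (hE x)) (fun x hx => by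
        linarith [abs_le.1 (hK x hx.1)])
    have h2 : 0 ≤ K / δ * Real.exp (-δ * max t t₀) := by positivity
    simp only [hg] at h1 ⊢
    linarith
  have h1 := tendsto_atTop_ciSup hmono hbdd
  have h2 : Tendsto (fun t => K / δ * Real.exp (-δ * t)) atTop (𝓝 0) := by
    rw [show (0 : ℝ) = K / δ * 0 by ring]
    refine Tendsto.const_mul _ (Real.tendsto_exp_atBot.comp ?_)
    exact tendsto_id.const_mul_atTop_of_neg (by linarith)
  refine ⟨_, (h1.add h2).congr' ?_⟩
  filter_upwards [eventually_ge_atTop t₀] with t ht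
  simp [hg, max_eq_left ht]

theorem deriv_limit_eq_zero_of_bounded {f f' : ℝ → ℝ} {t₀ B ℓ : ℝ}
    (hd : ∀ t, t₀ ≤ t → HasDerivAt f (f' t) t) (hB : ∀ t, t₀ ≤ t → |f t| ≤ B)
    (hl : Tendsto f' atTop (𝓝 ℓ)) : ℓ = 0 := by
  have key : ∀ (f f' : ℝ → ℝ) (ℓ : ℝ), (∀ t, t₀ ≤ t → HasDerivAt f (f' t) t) →
      (∀ t, t₀ ≤ t → |f t| ≤ B) → Tendsto f' atTop (𝓝 ℓ) → ℓ ≤ 0 := by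
    intro f f' ℓ hd hB hl
    by_contra! hpos
    obtain ⟨T, hT⟩ := eventually_atTop.1 (hl.eventually (Ici_mem_nhds (half_lt_self hpos)))
    obtain ⟨t, ht, h⟩ := exists_ge_of_le_deriv (half_pos hpos) (t₀ := max t₀ T)
      (fun x hx => hd x ((le_max_left _ _).trans hx))
      (fun x hx => hT x ((le_max_right _ _).trans hx)) (B + 1)
    linarith [le_abs_self (f t), hB t ((le_max_left _ _).trans ht)]
  refine le_antisymm (key f f' ℓ hd hB hl) ?_
  have := key (fun t => -f t) (fun t => -f' t) (-ℓ) (fun t ht => (hd t ht).neg)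
    (fun t ht => by rw [abs_neg]; exact hB t ht) hl.neg
  linarith

/-! ### Scalar autonomous equations -/

/-- Separation of variables for `ξ' = G(ξ)`. -/
theorem exists_autonomous_solution {G : ℝ → ℝ} {K : ℝ} (hG : Continuous G) (hpos : ∀ x, 0 < G x)
    (hK : ∀ x ≤ 0, G x ≤ K) :
    ∃ ξ : ℝ → ℝ, Tendsto ξ atBot atBot ∧
      (((∀ t, HasDerivAt ξ (G (ξ t)) t) ∧ Tendsto ξ atTop atTop) ∨
      ∃ T, (∀ t < T, HasDerivAt ξ (G (ξ t)) t) ∧ Tendsto ξ (𝓝[<] T) atTop) := by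
  have hGi : Continuous fun x => (G x)⁻¹ := hG.inv₀ fun x => (hpos x).ne'
  -- τ is the time needed to reach x from 0; the solution ξ is its inverse.
  set τ : ℝ → ℝ := fun x => ∫ u in (0 : ℝ)..x, (G u)⁻¹ with hτ
  have hder : ∀ x, HasDerivAt τ (G x)⁻¹ x := fun x => hGi.integral_hasStrictDerivAt 0 x |>.hasDerivAt
  have hcont : Continuous τ := continuous_iff_continuousAt.2 fun x => (hder x).continuousAt
  have hmono : StrictMono τ := strictMono_of_deriv_pos fun x => by
    rw [(hder x).deriv]; exact inv_pos.2 (hpos x)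
  have hKpos : 0 < K := (hpos 0).trans_le (hK 0 le_rfl)
  -- The bound on G over x ≤ 0 makes the travel time from -∞ infinite, so ξ is defined for all early
  -- times.
  have hlow : ∀ t, ∃ x, τ x < t := by
    intro t
    have h1 : ∀ x ≤ 0, τ x ≤ τ 0 + K⁻¹ * x := fun x hx => by
      have := add_mul_le_of_le_deriv (f := τ) (η := K⁻¹) hx (fun y _ => hder y)
        (fun y hy => inv_anti₀ (hpos y) (hK y hy.2))
      linarith
    refine ⟨-(K * (|t - τ 0| + 1)), ?_⟩
    have h2 := h1 (-(K * (|t - τ 0| + 1))) (by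
      have : 0 ≤ K * (|t - τ 0| + 1) := by positivity
      linarith)
    have h3 : K⁻¹ * -(K * (|t - τ 0| + 1)) = -(|t - τ 0| + 1) := by field_simp
    rw [h3] at h2
    linarith [neg_abs_le (t - τ 0)]
  have hrange : ∀ t, (∃ x, t < τ x) → t ∈ range τ := fun t ⟨x, hx⟩ => by
    obtain ⟨y, hy⟩ := hlow t
    exact mem_range_of_exists_le_of_exists_ge hcont ⟨y, hy.le⟩ ⟨x, hx.le⟩
  have hnomax : ∀ x, ∃ y, τ x < τ y := fun x => ⟨x + 1, hmono (by linarith)⟩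
  have hopen : IsOpen (range τ) := by
    have : range τ = ⋃ x, Iio (τ x) := by
      ext t
      simp only [mem_iUnion, mem_Iio]
      refine ⟨?_, hrange t⟩
      rintro ⟨x, rfl⟩
      exact hnomax x
    rw [this]
    exact isOpen_iUnion fun _ => isOpen_Iio
  have hemb : IsOpenEmbedding τ :=
    ⟨hmono.isEmbedding_of_ordConnected (hc := (isPreconnected_range hcont).ordConnected), hopen⟩
  set e := hemb.toOpenPartialHomeomorph τ with he
  set ξ := e.symm with hξ
  have hτξ : ∀ t ∈ range τ, τ (ξ t) = t := fun t ht => by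
    obtain ⟨x, rfl⟩ := ht
    rw [hξ, he, hemb.toOpenPartialHomeomorph_left_inv]
  have hξd : ∀ t ∈ range τ, HasDerivAt ξ (G (ξ t)) t := fun t ht => by
    have := e.hasDerivAt_symm (a := t) (f' := (G (ξ t))⁻¹) (by simpa [he] using ht)
      (inv_pos.2 (hpos _)).ne' (hder _)
    rwa [inv_inv] at this
  have hgt : ∀ x, ∀ t ∈ range τ, τ x ≤ t → x ≤ ξ t := fun x t ht hx => by
    rw [← hmono.le_iff_le, hτξ t ht]; exact hx
  have hlt : ∀ x, ∀ t ≤ τ x, ξ t ≤ x := fun x t hx => by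
    have ht : t ∈ range τ := hrange t (by obtain ⟨y, hy⟩ := hnomax x; exact ⟨y, hx.trans_lt hy⟩)
    rw [← hmono.le_iff_le, hτξ t ht]; exact hx
  refine ⟨ξ, ?_, ?_⟩
  · rw [tendsto_atBot]
    intro b
    filter_upwards [eventually_le_atBot (τ b)] with t ht using hlt b t ht
  -- Finite-time blow-up is the case in which the total travel time to +∞ is finite; T is its
  -- supremum.
  by_cases hb : BddAbove (range τ)
  · right
    have hmem : ∀ t < sSup (range τ), t ∈ range τ := fun t ht => by
      obtain ⟨_, ⟨x, rfl⟩, hx⟩ := exists_lt_of_lt_csSup (range_nonempty τ) ht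
      exact hrange t ⟨x, hx⟩
    refine ⟨sSup (range τ), fun t ht => hξd t (hmem t ht), ?_⟩
    rw [tendsto_atTop]
    intro b
    have hlt : τ b < sSup (range τ) := by
      obtain ⟨y, hy⟩ := hnomax b
      exact hy.trans_le (le_csSup hb ⟨y, rfl⟩)
    filter_upwards [Ioo_mem_nhdsLT hlt] with t ht using hgt b t (hmem t ht.2) ht.1.le
  · left
    have hmem : ∀ t, t ∈ range τ := fun t => by
      obtain ⟨_, ⟨x, rfl⟩, hx⟩ := not_bddAbove_iff.1 hb t
      exact hrange t ⟨x, hx⟩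
    refine ⟨fun t => hξd t (hmem t), ?_⟩
    rw [tendsto_atTop]
    intro b
    filter_upwards [eventually_ge_atTop (τ b)] with t ht using hgt b t (hmem t) ht

theorem not_tendsto_atTop_of_deriv_le {ξ ξ' : ℝ → ℝ} {T K : ℝ}
    (hd : ∀ t < T, HasDerivAt ξ (ξ' t) t) (hK : ∀ t < T, ξ' t ≤ K) :
    ¬ Tendsto ξ (𝓝[<] T) atTop := by
  intro h
  have h1 := (tendsto_atTop.1 h (ξ (T - 1) + |K| + 1)).and (Ioo_mem_nhdsLT (show T - 1 < T by linarith))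
  obtain ⟨t, ht, ht'⟩ := h1.exists
  have := add_mul_le_of_le_deriv (f := fun x => -ξ x) (η := -|K|) ht'.1.le
    (fun x hx => (hd x (hx.2.trans_lt ht'.2)).neg)
    (fun x hx => by linarith [le_abs_self K, hK x (hx.2.trans_lt ht'.2)])
  nlinarith [abs_nonneg K, ht'.1, ht'.2]

/-- Separation of variables for `ξ' = G(ξ)` with bounded `G`. -/
theorem exists_global_autonomous_solution {G : ℝ → ℝ} {K : ℝ} (hG : Continuous G)
    (hpos : ∀ x, 0 < G x) (hK : ∀ x, G x ≤ K) :
    ∃ ξ : ℝ → ℝ, Tendsto ξ atBot atBot ∧ (∀ t, HasDerivAt ξ (G (ξ t)) t) ∧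
      Tendsto ξ atTop atTop := by
  obtain ⟨ξ, h1, h2 | ⟨T, h2, h3⟩⟩ := exists_autonomous_solution hG hpos (fun x _ => hK x)
  · exact ⟨ξ, h1, h2⟩
  · exact absurd h3 (not_tendsto_atTop_of_deriv_le h2 fun t _ => hK _)

end HardyHenon

namespace HardyHenon

/-! ### Solutions of scalar equations between barriers -/

theorem abs_clamp_sub_clamp_le (l u y z : ℝ) :
    |max l (min u y) - max l (min u z)| ≤ |y - z| := by
  calc _ ≤ max |l - l| |min u y - min u z| := abs_max_sub_max_le_max _ _ _ _
    _ ≤ max |l - l| (max |u - u| |y - z|) := max_le_max le_rfl (abs_min_sub_min_le_max _ _ _ _)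
    _ = |y - z| := by simp

theorem isCompact_region {b₁ b₂ : ℝ → ℝ} (hb₁ : Continuous b₁) (hb₂ : Continuous b₂) (a b : ℝ) :
    IsCompact {z : ℝ × ℝ | z.1 ∈ Icc a b ∧ z.2 ∈ Icc (b₁ z.1) (b₂ z.1)} := by
  obtain ⟨m, hm⟩ := ((isCompact_Icc (a := a) (b := b)).image hb₁).bddBelow
  obtain ⟨M, hM⟩ := ((isCompact_Icc (a := a) (b := b)).image hb₂).bddAbove
  refine ((isCompact_Icc (a := a) (b := b)).prod (isCompact_Icc (a := m) (b := M))).of_isClosed_subset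
    ?_ ?_
  · exact (isClosed_Icc.preimage continuous_fst).inter
      ((isClosed_le (hb₁.comp continuous_fst) continuous_snd).inter
        (isClosed_le continuous_snd (hb₂.comp continuous_fst)))
  · rintro ⟨x, y⟩ ⟨hx, hy⟩
    exact ⟨hx, (hm ⟨x, hx, rfl⟩).trans hy.1, hy.2.trans (hM ⟨x, hx, rfl⟩)⟩

/-- Clamping y between the barriers makes the field bounded and globally Lipschitz, so
Picard–Lindelöf covers all of [a, b]; the barrier inequalities then show that the clamp is never
active. -/
theorem exists_solution_between_on_Icc {F : ℝ → ℝ → ℝ} {b₁ b₂ b₁' b₂' : ℝ → ℝ} {a b K : ℝ}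
    (hab : a ≤ b) (h12 : ∀ x ∈ Icc a b, b₁ x ≤ b₂ x)
    (hF : ContinuousOn (Function.uncurry F)
      {z : ℝ × ℝ | z.1 ∈ Icc a b ∧ z.2 ∈ Icc (b₁ z.1) (b₂ z.1)})
    (hLip : ∀ x ∈ Icc a b, ∀ y ∈ Icc (b₁ x) (b₂ x), ∀ z ∈ Icc (b₁ x) (b₂ x),
      |F x y - F x z| ≤ K * |y - z|)
    (hb₁ : ∀ x, HasDerivAt b₁ (b₁' x) x) (hb₂ : ∀ x, HasDerivAt b₂ (b₂' x) x)
    (hsub : ∀ x ∈ Ioo a b, b₁' x ≤ F x (b₁ x)) (hsup : ∀ x ∈ Ioo a b, F x (b₂ x) ≤ b₂' x) :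
    ∃ y : ℝ → ℝ, y a = b₂ a ∧ (∀ x ∈ Icc a b, y x ∈ Icc (b₁ x) (b₂ x)) ∧
      ContinuousOn y (Icc a b) ∧ ∀ x ∈ Ioo a b, HasDerivAt y (F x (y x)) x := by
  have hc₁ : Continuous b₁ := continuous_iff_continuousAt.2 fun x => (hb₁ x).continuousAt
  have hc₂ : Continuous b₂ := continuous_iff_continuousAt.2 fun x => (hb₂ x).continuousAt
  set D := {z : ℝ × ℝ | z.1 ∈ Icc a b ∧ z.2 ∈ Icc (b₁ z.1) (b₂ z.1)} with hD
  obtain ⟨M, hM⟩ := (isCompact_region hc₁ hc₂ a b).exists_bound_of_continuousOn hF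
  set c : ℝ → ℝ → ℝ := fun x y => max (b₁ x) (min (b₂ x) y) with hcdef
  have hcl : ∀ x ∈ Icc a b, ∀ y, c x y ∈ Icc (b₁ x) (b₂ x) := fun x hx y =>
    ⟨le_max_left _ _, max_le (h12 x hx) (min_le_left _ _)⟩
  have hPL : IsPicardLindelof (fun x y => F x (c x y)) (⟨a, le_rfl, hab⟩ : Icc a b) (b₂ a)
      (|M| * (b - a)).toNNReal 0 |M|.toNNReal |K|.toNNReal := by
    refine ⟨fun x hx => LipschitzOnWith.of_dist_le_mul fun y _ z _ => ?_, fun y _ => ?_,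
      fun x hx y _ => ?_, ?_⟩
    · rw [Real.dist_eq, Real.dist_eq, Real.coe_toNNReal _ (abs_nonneg _)]
      calc _ ≤ K * |c x y - c x z| := hLip x hx _ (hcl x hx y) _ (hcl x hx z)
        _ ≤ |K| * |c x y - c x z| := mul_le_mul_of_nonneg_right (le_abs_self _) (abs_nonneg _)
        _ ≤ |K| * |y - z| :=
          mul_le_mul_of_nonneg_left (abs_clamp_sub_clamp_le _ _ _ _) (abs_nonneg _)
    · refine hF.comp (f := fun x => (x, c x y)) (Continuous.continuousOn ?_)
        (fun x hx => ⟨hx, hcl x hx y⟩)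
      exact continuous_id.prodMk (hc₁.max (hc₂.min continuous_const))
    · rw [Real.coe_toNNReal _ (abs_nonneg _)]
      exact (hM (x, c x y) ⟨hx, hcl x hx y⟩).trans (le_abs_self _)
    · have h1 : 0 ≤ |M| * (b - a) := mul_nonneg (abs_nonneg _) (by linarith)
      rw [Real.coe_toNNReal _ (abs_nonneg _), Real.coe_toNNReal _ h1]
      simp [hab]
  obtain ⟨y, hya, hy⟩ := hPL.exists_eq_forall_mem_Icc_hasDerivWithinAt₀
  have hcont : ContinuousOn y (Icc a b) := fun x hx => (hy x hx).continuousWithinAt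
  have hder : ∀ x ∈ Ioo a b, HasDerivAt y (F x (c x (y x))) x := fun x hx =>
    (hy x (Ioo_subset_Icc_self hx)).hasDerivAt (Icc_mem_nhds hx.1 hx.2)
  simp only at hya
  have hup : ∀ x ∈ Icc a b, y x ≤ b₂ x := by
    have := nonpos_of_deriv_nonpos_of_pos (h := fun x => y x - b₂ x) (a := a) (b := b)
      (hcont.sub hc₂.continuousOn) (fun x hx => (hder x hx).sub (hb₂ x)) (by simp [hya])
      (fun x hx hpos => by
        have h1 : c x (y x) = b₂ x := by
          simp only [hcdef]
          rw [min_eq_left (by linarith), max_eq_right (h12 x (Ioo_subset_Icc_self hx))]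
        rw [h1]; linarith [hsup x hx])
    intro x hx
    linarith [this x hx]
  have hlo : ∀ x ∈ Icc a b, b₁ x ≤ y x := by
    have := nonpos_of_deriv_nonpos_of_pos (h := fun x => b₁ x - y x) (a := a) (b := b)
      (hc₁.continuousOn.sub hcont) (fun x hx => (hb₁ x).sub (hder x hx))
      (by simpa [hya] using h12 a ⟨le_rfl, hab⟩)
      (fun x hx hpos => by
        have h1 : c x (y x) = b₁ x := by
          simp only [hcdef]
          rw [max_eq_left ((min_le_right _ _).trans (by linarith))]
        rw [h1]; linarith [hsub x hx])
    intro x hx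
    linarith [this x hx]
  refine ⟨y, hya, fun x hx => ⟨hlo x hx, hup x hx⟩, hcont, fun x hx => ?_⟩
  have hx' := Ioo_subset_Icc_self hx
  have h1 : c x (y x) = y x := by
    simp only [hcdef]
    rw [min_eq_right (hup x hx'), max_eq_right (hlo x hx')]
  simpa [h1] using hder x hx

/-- The factor e^{-Kx} absorbs the Lipschitz growth of the difference, to which the comparison
principle then applies. -/
theorem le_of_solutions {F : ℝ → ℝ → ℝ} {b₁ b₂ y z : ℝ → ℝ} {a b K : ℝ}
    (hLip : ∀ x ∈ Icc a b, ∀ y ∈ Icc (b₁ x) (b₂ x), ∀ z ∈ Icc (b₁ x) (b₂ x),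
      |F x y - F x z| ≤ K * |y - z|)
    (hy : ContinuousOn y (Icc a b)) (hz : ContinuousOn z (Icc a b))
    (hym : ∀ x ∈ Icc a b, y x ∈ Icc (b₁ x) (b₂ x)) (hzm : ∀ x ∈ Icc a b, z x ∈ Icc (b₁ x) (b₂ x))
    (hy' : ∀ x ∈ Ioo a b, HasDerivAt y (F x (y x)) x)
    (hz' : ∀ x ∈ Ioo a b, HasDerivAt z (F x (z x)) x) (ha : y a ≤ z a) :
    ∀ x ∈ Icc a b, y x ≤ z x := by
  have hE : ∀ x, HasDerivAt (fun x => Real.exp (-K * x)) (-K * Real.exp (-K * x)) x := fun x => by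
    have := ((hasDerivAt_id x).const_mul (-K)).exp
    refine this.congr_deriv ?_
    simp only [id]; ring
  have := nonpos_of_deriv_nonpos_of_pos (h := fun x => Real.exp (-K * x) * (y x - z x))
    (a := a) (b := b) (ContinuousOn.mul (by fun_prop) (hy.sub hz))
    (fun x hx => (hE x).mul ((hy' x hx).sub (hz' x hx)))
    (mul_nonpos_of_nonneg_of_nonpos (Real.exp_pos _).le (by linarith))
    (fun x hx hpos => by
      have hx' := Ioo_subset_Icc_self hx
      have h1 : 0 < y x - z x := pos_of_mul_pos_right hpos (Real.exp_pos _).le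
      have h2 := hLip x hx' _ (hym x hx') _ (hzm x hx')
      rw [abs_of_pos h1] at h2
      have h3 := (le_abs_self _).trans h2
      have h4 := mul_le_mul_of_nonneg_left h3 (Real.exp_pos (-K * x)).le
      linarith)
  intro x hx
  have h1 := this x hx
  by_contra! hlt
  have := mul_pos (Real.exp_pos (-K * x)) (sub_pos.2 hlt)
  linarith

/-- A scalar equation with a sub- and a supersolution on a (possibly singular) interval exhausted
by the intervals `[a n, b n]` has a solution in between. -/
theorem exists_solution_between {F F' : ℝ → ℝ → ℝ} {b₁ b₂ b₁' b₂' : ℝ → ℝ} {a b : ℕ → ℝ}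
    (ha : Antitone a) (hb : Monotone b) (hab : ∀ n, a n < b n)
    (h12 : ∀ n, ∀ x ∈ Icc (a n) (b n), b₁ x ≤ b₂ x)
    (hF : ∀ n, ContinuousOn (Function.uncurry F)
      {z : ℝ × ℝ | z.1 ∈ Icc (a n) (b n) ∧ z.2 ∈ Icc (b₁ z.1) (b₂ z.1)})
    (hF' : ∀ n, ContinuousOn (Function.uncurry F')
      {z : ℝ × ℝ | z.1 ∈ Icc (a n) (b n) ∧ z.2 ∈ Icc (b₁ z.1) (b₂ z.1)})
    (hFd : ∀ n, ∀ x ∈ Icc (a n) (b n), ∀ y ∈ Icc (b₁ x) (b₂ x),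
      HasDerivAt (fun y => F x y) (F' x y) y)
    (hb₁ : ∀ x, HasDerivAt b₁ (b₁' x) x) (hb₂ : ∀ x, HasDerivAt b₂ (b₂' x) x)
    (hsub : ∀ n, ∀ x ∈ Ioo (a n) (b n), b₁' x ≤ F x (b₁ x))
    (hsup : ∀ n, ∀ x ∈ Ioo (a n) (b n), F x (b₂ x) ≤ b₂' x) :
    ∃ y : ℝ → ℝ, (∀ n, ∀ x ∈ Icc (a n) (b n), y x ∈ Icc (b₁ x) (b₂ x)) ∧
      (∀ n, ContinuousOn y (Icc (a n) (b n))) ∧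
      (∀ n, ∀ x ∈ Ioo (a n) (b n), HasDerivAt y (F x (y x)) x) ∧
      ((∀ n, a n = a 0) → y (a 0) = b₂ (a 0)) := by
  have hc₁ : Continuous b₁ := continuous_iff_continuousAt.2 fun x => (hb₁ x).continuousAt
  have hc₂ : Continuous b₂ := continuous_iff_continuousAt.2 fun x => (hb₂ x).continuousAt
  have hLip : ∀ n, ∃ K, ∀ x ∈ Icc (a n) (b n), ∀ y ∈ Icc (b₁ x) (b₂ x), ∀ z ∈ Icc (b₁ x) (b₂ x),
      |F x y - F x z| ≤ K * |y - z| := by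
    intro n
    obtain ⟨K, hK⟩ := (isCompact_region hc₁ hc₂ (a n) (b n)).exists_bound_of_continuousOn (hF' n)
    refine ⟨K, fun x hx y hy z hz => ?_⟩
    have := (convex_Icc (b₁ x) (b₂ x)).norm_image_sub_le_of_norm_hasDerivWithin_le
      (f := fun y => F x y) (fun u hu => (hFd n x hx u hu).hasDerivWithinAt)
      (fun u hu => hK (x, u) ⟨hx, hu⟩) hz hy
    simpa [Real.norm_eq_abs] using this
  choose K hK using hLip
  have hsol := fun n => exists_solution_between_on_Icc (hab n).le (h12 n) (hF n) (hK n) hb₁ hb₂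
    (hsub n) (hsup n)
  choose Y hY0 hYm hYc hYd using hsol
  have hIcc : ∀ {n k}, n ≤ k → Icc (a n) (b n) ⊆ Icc (a k) (b k) := fun h =>
    Icc_subset_Icc (ha h) (hb h)
  have hIoo : ∀ {n k}, n ≤ k → Ioo (a n) (b n) ⊆ Ioo (a k) (b k) := fun h =>
    Ioo_subset_Ioo (ha h) (hb h)
  -- Each `Y n` starts on the upper barrier at its own left endpoint, where `Y (n + 1)` is already
  -- below that barrier; by comparison the sequence decreases.
  have hanti : ∀ n, ∀ x ∈ Icc (a n) (b n), Y (n + 1) x ≤ Y n x := fun n => by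
    have hs := hIcc n.le_succ
    refine le_of_solutions (hK n) ((hYc (n + 1)).mono hs) (hYc n)
      (fun x hx => hYm (n + 1) x (hs hx)) (hYm n)
      (fun x hx => hYd (n + 1) x (hIoo n.le_succ hx)) (hYd n) ?_
    rw [hY0 n]
    exact (hYm (n + 1) _ (hs ⟨le_rfl, (hab n).le⟩)).2
  have hlim : ∀ n, ∀ x ∈ Icc (a n) (b n), ∃ l, Tendsto (fun k => Y k x) atTop (𝓝 l) := by
    intro n x hx
    have h1 : Antitone fun k => Y (k + n) x := antitone_nat_of_succ_le fun k => by
      have := hanti (k + n) x (hIcc (Nat.le_add_left _ _) hx)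
      rwa [show k + 1 + n = k + n + 1 by ring]
    have h2 : BddBelow (range fun k => Y (k + n) x) := by
      refine ⟨b₁ x, ?_⟩
      rintro _ ⟨k, rfl⟩
      exact (hYm (k + n) x (hIcc (Nat.le_add_left _ _) hx)).1
    exact ⟨_, (tendsto_add_atTop_iff_nat n).1 (tendsto_atTop_ciInf h1 h2)⟩
  set y : ℝ → ℝ := fun x => limUnder atTop fun k => Y k x with hydef
  have hy : ∀ n, ∀ x ∈ Icc (a n) (b n), Tendsto (fun k => Y k x) atTop (𝓝 (y x)) :=
    fun n x hx => tendsto_nhds_limUnder (hlim n x hx)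
  have hym : ∀ n, ∀ x ∈ Icc (a n) (b n), y x ∈ Icc (b₁ x) (b₂ x) := fun n x hx =>
    isClosed_Icc.mem_of_tendsto (hy n x hx) (by
      filter_upwards [eventually_ge_atTop n] with k hk using hYm k x (hIcc hk hx))
  have hcomp : ∀ n (z : ℝ → ℝ), ContinuousOn z (Icc (a n) (b n)) →
      (∀ x ∈ Icc (a n) (b n), z x ∈ Icc (b₁ x) (b₂ x)) →
      ContinuousOn (fun x => F x (z x)) (Icc (a n) (b n)) := fun n z hz hzm =>
    (hF n).comp (f := fun x => (x, z x)) (continuousOn_id.prodMk hz) (fun x hx => ⟨hx, hzm x hx⟩)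
  have hMn : ∀ n, ∃ M, ∀ x ∈ Icc (a n) (b n), ∀ u ∈ Icc (b₁ x) (b₂ x), |F x u| ≤ M := fun n => by
    obtain ⟨M, hM⟩ := (isCompact_region hc₁ hc₂ (a n) (b n)).exists_bound_of_continuousOn (hF n)
    exact ⟨M, fun x hx u hu => hM (x, u) ⟨hx, hu⟩⟩
  have hYint : ∀ n k, n ≤ k → ∀ s ∈ Icc (a n) (b n), ∀ x ∈ Icc (a n) (b n), s ≤ x →
      ∫ u in s..x, F u (Y k u) = Y k x - Y k s := by
    intro n k hnk s hs x hx hsx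
    have hsub : Icc s x ⊆ Icc (a n) (b n) := Icc_subset_Icc hs.1 hx.2
    refine intervalIntegral.integral_eq_sub_of_hasDerivAt_of_le hsx
      ((hYc k).mono (hsub.trans (hIcc hnk)))
      (fun u hu => hYd k u (hIoo hnk ⟨hs.1.trans_lt hu.1, hu.2.trans_le hx.2⟩)) ?_
    refine ContinuousOn.intervalIntegrable ?_
    rw [uIcc_of_le hsx]
    exact (hcomp k (Y k) (hYc k) (hYm k)).mono (hsub.trans (hIcc hnk))
  -- The integral equation survives the pointwise limit by dominated convergence, F being bounded on
  -- each compact region between the barriers.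
  have hyint : ∀ n, ∀ s ∈ Icc (a n) (b n), ∀ x ∈ Icc (a n) (b n), s ≤ x →
      ∫ u in s..x, F u (y u) = y x - y s := by
    intro n s hs x hx hsx
    obtain ⟨M, hM⟩ := hMn n
    have hsub : Icc s x ⊆ Icc (a n) (b n) := Icc_subset_Icc hs.1 hx.2
    have hsub' : uIoc s x ⊆ Icc (a n) (b n) := by
      rw [uIoc_of_le hsx]; exact Ioc_subset_Icc_self.trans hsub
    have h1 : Tendsto (fun k => ∫ u in s..x, F u (Y k u)) atTop (𝓝 (∫ u in s..x, F u (y u))) := by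
      refine intervalIntegral.tendsto_integral_filter_of_dominated_convergence (fun _ => M) ?_ ?_
        (by simp) ?_
      · filter_upwards [eventually_ge_atTop n] with k hk
        exact (((hcomp k (Y k) (hYc k) (hYm k)).mono (hIcc hk)).aestronglyMeasurable
          measurableSet_Icc).mono_measure (MeasureTheory.Measure.restrict_mono hsub' le_rfl)
      · filter_upwards [eventually_ge_atTop n] with k hk
        exact Eventually.of_forall fun u hu => hM u (hsub' hu) _ (hYm k u (hIcc hk (hsub' hu)))
      · refine Eventually.of_forall fun u hu => ?_
        have hu := hsub' hu
        have h2 := (hFd n u hu (y u) (hym n u hu)).continuousAt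
        exact h2.tendsto.comp (hy n u hu)
    have h2 : Tendsto (fun k => ∫ u in s..x, F u (Y k u)) atTop (𝓝 (y x - y s)) := by
      refine ((hy n x hx).sub (hy n s hs)).congr' ?_
      filter_upwards [eventually_ge_atTop n] with k hk using (hYint n k hk s hs x hx hsx).symm
    exact tendsto_nhds_unique h1 h2
  have hycont : ∀ n, ContinuousOn y (Icc (a n) (b n)) := by
    intro n
    obtain ⟨M, hM⟩ := hMn n
    have hle : ∀ s ∈ Icc (a n) (b n), ∀ x ∈ Icc (a n) (b n), s ≤ x → |y x - y s| ≤ M * |x - s| := by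
      intro s hs x hx hsx
      have hsub : Icc s x ⊆ Icc (a n) (b n) := Icc_subset_Icc hs.1 hx.2
      rw [← hyint n s hs x hx hsx, ← Real.norm_eq_abs]
      refine intervalIntegral.norm_integral_le_of_norm_le_const fun u hu => ?_
      rw [uIoc_of_le hsx] at hu
      have hu := hsub (Ioc_subset_Icc_self hu)
      exact hM u hu _ (hym n u hu)
    refine LipschitzOnWith.continuousOn (K := |M|.toNNReal)
      (LipschitzOnWith.of_dist_le_mul fun s hs x hx => ?_)
    rw [Real.dist_eq, Real.dist_eq, Real.coe_toNNReal _ (abs_nonneg _)]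
    have hMM : ∀ u : ℝ, M * |u| ≤ |M| * |u| := fun u =>
      mul_le_mul_of_nonneg_right (le_abs_self _) (abs_nonneg _)
    rcases le_total s x with h | h
    · rw [abs_sub_comm, abs_sub_comm s x]
      exact (hle s hs x hx h).trans (hMM _)
    · exact (hle x hx s hs h).trans (hMM _)
  refine ⟨y, hym, hycont, fun n x hx => ?_, fun hconst => ?_⟩
  · have hx' := Ioo_subset_Icc_self hx
    have hcn : ContinuousOn (fun x => F x (y x)) (Icc (a n) (b n)) := hcomp n y (hycont n) (hym n)
    have hI : IntervalIntegrable (fun x => F x (y x)) MeasureTheory.volume (a n) x := by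
      refine ContinuousOn.intervalIntegrable ?_
      rw [uIcc_of_le hx.1.le]
      exact hcn.mono (Icc_subset_Icc_right hx.2.le)
    have h1 := intervalIntegral.integral_hasDerivAt_right hI
      ((hcn.mono Ioo_subset_Icc_self).stronglyMeasurableAtFilter isOpen_Ioo x hx)
      (hcn.continuousAt (Icc_mem_nhds hx.1 hx.2))
    refine (h1.const_add (y (a n))).congr_of_eventuallyEq ?_
    filter_upwards [Ioo_mem_nhds hx.1 hx.2] with u hu
    rw [hyint n (a n) ⟨le_rfl, (hab n).le⟩ u (Ioo_subset_Icc_self hu) hu.1.le]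
    ring
  -- With a fixed left endpoint all approximations share the barrier value there, and the limit
  -- keeps it.
  · have h1 := hy 0 (a 0) ⟨le_rfl, (hab 0).le⟩
    refine tendsto_nhds_unique h1 ?_
    refine tendsto_const_nhds.congr fun k => ?_
    have := hY0 k
    rw [hconst k] at this
    exact this.symm

end HardyHenon

namespace HardyHenon

/-! ### The autonomous system -/

/-- The conditions on the coefficients of the autonomous system. -/
structure Admissible (β κ m q : ℝ) : Prop where
  β_pos : 0 < β
  m_pos : 0 < m
  q_pos : 0 < q
  one_lt : 1 < q * m
  lt_mul : β < κ * m
  mul_lt : β * q < κ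

theorem Admissible.κ_pos {β κ m q : ℝ} (h : Admissible β κ m q) : 0 < κ :=
  (mul_pos h.β_pos h.q_pos).trans h.mul_lt

/-- `(v, Z)` solves `v' = β (Z^m - v)`, `Z' = -κ (ε v^q + Z)` with `v > 0` at all times in `J`. -/
structure IsOrbit (β κ m q ε : ℝ) (J : Set ℝ) (v Z : ℝ → ℝ) : Prop where
  pos : ∀ t ∈ J, 0 < v t
  deriv_fst : ∀ t ∈ J, HasDerivAt v (β * (spow m (Z t) - v t)) t
  deriv_snd : ∀ t ∈ J, HasDerivAt Z (-κ * (ε * v t ^ q + Z t)) t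

theorem IsOrbit.mono {β κ m q ε : ℝ} {J J' : Set ℝ} {v Z : ℝ → ℝ}
    (h : IsOrbit β κ m q ε J v Z) (hJ : J' ⊆ J) : IsOrbit β κ m q ε J' v Z :=
  ⟨fun t ht => h.pos t (hJ ht), fun t ht => h.deriv_fst t (hJ ht),
    fun t ht => h.deriv_snd t (hJ ht)⟩

theorem IsOrbit.shift {β κ m q ε : ℝ} {J : Set ℝ} {v Z : ℝ → ℝ}
    (h : IsOrbit β κ m q ε J v Z) (s : ℝ) :
    IsOrbit β κ m q ε ((fun t => t + s) ⁻¹' J) (fun t => v (t + s)) (fun t => Z (t + s)) :=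
  ⟨fun _ ht => h.pos _ ht, fun t ht => (h.deriv_fst _ ht).comp_add_const t s,
    fun t ht => (h.deriv_snd _ ht).comp_add_const t s⟩

/-- The first equation recovers Z from v and v', the odd power being injective. -/
theorem IsOrbit.snd_eq_of_fst_eq {β κ m q ε : ℝ} {J : Set ℝ} {v Z v' Z' : ℝ → ℝ}
    (hβ : 0 < β) (hm : 0 < m) (hJ : IsOpen J) (h : IsOrbit β κ m q ε J v Z)
    (h' : IsOrbit β κ m q ε J v' Z') (heq : ∀ t ∈ J, v t = v' t) : ∀ t ∈ J, Z t = Z' t := by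
  intro t ht
  have h1 : v =ᶠ[𝓝 t] v' := by
    filter_upwards [hJ.mem_nhds ht] with s hs using heq s hs
  have h2 := ((h'.deriv_fst t ht).congr_of_eventuallyEq h1).unique (h.deriv_fst t ht)
  rw [heq t ht] at h2
  refine (spow_strictMono hm).injective ?_
  have := mul_left_cancel₀ hβ.ne' h2
  linarith

/-! ### The parameters -/

/-- The range of the parameters. -/
structure ParameterRange (p q N σ : ℝ) : Prop where
  hp : 1 < p
  hq : p - 1 < q
  hσ : p < -σ
  hN : -σ < N

/-- The exponent `-γ > 0` of `w*`. -/
noncomputable def bet (p q σ : ℝ) : ℝ := -gam p q σ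

/-- The coefficient of the flux equation of the autonomous system. -/
noncomputable def kap (p q N σ : ℝ) : ℝ := N - p + bet p q σ * (p - 1)

variable {p q N σ ε : ℝ}

theorem bet_mul (h : ParameterRange p q N σ) : bet p q σ * (q + 1 - p) = -(p + σ) := by
  have : q + 1 - p ≠ 0 := by linarith [h.hq]
  rw [bet, gam]; field_simp

theorem bet_pos (h : ParameterRange p q N σ) : 0 < bet p q σ := by
  have h1 := bet_mul h
  refine pos_of_mul_pos_left (b := q + 1 - p) ?_ (by linarith [h.hq])
  rw [h1]; linarith [h.hσ]

/-- Once denominators are cleared and `bet_mul` is used, the last three conditions read q > p - 1, N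
> p and N + σ > 0. -/
theorem admissible (h : ParameterRange p q N σ) :
    Admissible (bet p q σ) (kap p q N σ) (1 / (p - 1)) q := by
  have h1 : 0 < p - 1 := by linarith [h.hp]
  have h2 := bet_mul h
  refine ⟨bet_pos h, by positivity, by linarith [h.hq], ?_, ?_, ?_⟩
  · rw [mul_one_div, lt_div_iff₀ h1]; linarith [h.hq]
  · rw [mul_one_div, lt_div_iff₀ h1, kap]; linarith [h.hσ, h.hN]
  · rw [kap]; nlinarith [h.hσ, h.hN]

theorem kap_pos (h : ParameterRange p q N σ) : 0 < kap p q N σ := (admissible h).κ_pos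

theorem aStar_base (h : ParameterRange p q N σ) :
    -1 * flux p (gam p q σ) * (N - p - (p - 1) * gam p q σ) =
      bet p q σ ^ (p - 1) * kap p q N σ := by
  have h1 := flux_eq_spow h.hp (gam p q σ)
  have h2 := spow_neg (p - 1) (bet p q σ)
  rw [spow_of_nonneg (by linarith [h.hp]) (bet_pos h).le] at h2
  have h3 : gam p q σ = -bet p q σ := by rw [bet]; ring
  rw [h1, h3, h2, kap]; ring

theorem aStar_pos (h : ParameterRange p q N σ) : 0 < aStar p q N σ (-1) := by
  rw [aStar, aStar_base h]
  have := bet_pos h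
  have := kap_pos h
  positivity

theorem aStar_rpow (h : ParameterRange p q N σ) :
    aStar p q N σ (-1) ^ (q + 1 - p) = bet p q σ ^ (p - 1) * kap p q N σ := by
  rw [aStar, aStar_base h]
  have := bet_pos h
  have := kap_pos h
  rw [← Real.rpow_mul (by positivity), one_div_mul_cancel (by linarith [h.hq]), Real.rpow_one]

/-- The constant relating the two equations. -/
theorem aStar_mul_bet_rpow (h : ParameterRange p q N σ) :
    (aStar p q N σ (-1) * bet p q σ) ^ (p - 1) * kap p q N σ = aStar p q N σ (-1) ^ q := by
  have ha := aStar_pos h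
  rw [Real.mul_rpow ha.le (bet_pos h).le, mul_assoc, ← aStar_rpow h, ← Real.rpow_add ha]
  congr 1; ring

/-! ### From orbits to solutions -/

/-- The function of `r` with the profile `v` relative to `w*`. -/
noncomputable def ofProfile (p q N σ : ℝ) (v : ℝ → ℝ) (r : ℝ) : ℝ :=
  aStar p q N σ (-1) * r ^ bet p q σ * v (Real.log r)

theorem hasDerivAt_ofProfile {v Z : ℝ → ℝ} {r κ m : ℝ} (hr : 0 < r)
    (hv : IsOrbit (bet p q σ) κ m q ε {Real.log r} v Z) :
    HasDerivAt (ofProfile p q N σ v)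
      (aStar p q N σ (-1) * bet p q σ * (r ^ (bet p q σ - 1) * spow m (Z (Real.log r)))) r := by
  have h1 := ((Real.hasDerivAt_rpow_const (p := bet p q σ) (Or.inl hr.ne')).const_mul
    (aStar p q N σ (-1))).mul ((hv.deriv_fst _ rfl).comp r (Real.hasDerivAt_log hr.ne'))
  refine h1.congr_deriv ?_
  have h2 : r ^ bet p q σ = r ^ (bet p q σ - 1) * r := by
    rw [← Real.rpow_add_one hr.ne', sub_add_cancel]
  simp only [Function.comp]
  rw [h2]; field_simp; ring

theorem deriv_ofProfile {v Z : ℝ → ℝ} {κ m : ℝ} {I : Set ℝ} (hI : I ⊆ Ioi 0)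
    (hv : IsOrbit (bet p q σ) κ m q ε (Real.exp ⁻¹' I) v Z) {r : ℝ} (hr : r ∈ I) :
    HasDerivAt (ofProfile p q N σ v)
      (aStar p q N σ (-1) * bet p q σ * (r ^ (bet p q σ - 1) * spow m (Z (Real.log r)))) r :=
  hasDerivAt_ofProfile (hI hr) (hv.mono (by
    rw [singleton_subset_iff, mem_preimage, Real.exp_log (hI hr)]; exact hr))

/-- The powers m and p - 1 cancel, so the flux is (a*β)^{p-1} r^{(β-1)(p-1)} Z. Powers of r match
because (β-1)(p-1) - 1 = σ + βq, and coefficients match by `aStar_mul_bet_rpow`. -/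
theorem isPosSolution_ofProfile (h : ParameterRange p q N σ) {v Z : ℝ → ℝ} {I : Set ℝ}
    (hIo : IsOpen I) (hI : I ⊆ Ioi 0)
    (hv : IsOrbit (bet p q σ) (kap p q N σ) (1 / (p - 1)) q ε (Real.exp ⁻¹' I) v Z) :
    IsPosSolution p q N σ ε I (ofProfile p q N σ v) := by
  have ha := aStar_pos h
  have hβ := bet_pos h
  have hp1 : 0 < p - 1 := by linarith [h.hp]
  set a := aStar p q N σ (-1) with hadef
  set β := bet p q σ with hβdef
  have hlog : ∀ r ∈ I, Real.log r ∈ Real.exp ⁻¹' I := fun r hr => by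
    rw [mem_preimage, Real.exp_log (hI hr)]; exact hr
  have hder := fun r (hr : r ∈ I) => deriv_ofProfile (N := N) hI hv hr
  have hflux : ∀ r ∈ I, flux p (deriv (ofProfile p q N σ v) r) =
      (a * β) ^ (p - 1) * (r ^ ((β - 1) * (p - 1)) * Z (Real.log r)) := fun r hr => by
    have hr0 : 0 < r := hI hr
    rw [(hder r hr).deriv, flux_eq_spow h.hp, spow_mul hp1 (by positivity),
      spow_mul hp1 (by positivity), spow_spow hp1 (by positivity),
      one_div_mul_cancel hp1.ne', spow_one_left, ← Real.rpow_mul hr0.le]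
  have hfluxd : ∀ r ∈ I, HasDerivAt (fun x => flux p (deriv (ofProfile p q N σ v) x))
      ((a * β) ^ (p - 1) * ((β - 1) * (p - 1) * r ^ ((β - 1) * (p - 1) - 1) * Z (Real.log r) +
        r ^ ((β - 1) * (p - 1)) *
          (-kap p q N σ * (ε * v (Real.log r) ^ q + Z (Real.log r)) * r⁻¹))) r := fun r hr => by
    have hr0 : 0 < r := hI hr
    refine HasDerivAt.congr_of_eventuallyEq ?_ (eventually_of_mem (hIo.mem_nhds hr) hflux)
    exact ((Real.hasDerivAt_rpow_const (Or.inl hr0.ne')).mul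
      ((hv.deriv_snd _ (hlog r hr)).comp r (Real.hasDerivAt_log hr0.ne'))).const_mul _
  refine ⟨fun r hr => ?_, fun r hr => (hder r hr).differentiableAt,
    fun r hr => (hfluxd r hr).differentiableAt, fun r hr => ?_⟩
  · have := hv.pos _ (hlog r hr)
    have hr0 : 0 < r := hI hr
    simp only [ofProfile]
    positivity
  · have hr0 : 0 < r := hI hr
    have hvp := hv.pos _ (hlog r hr)
    have h4 : ofProfile p q N σ v r ^ q = a ^ q * r ^ (β * q) * v (Real.log r) ^ q := by
      rw [ofProfile, Real.mul_rpow (by positivity) hvp.le, Real.mul_rpow ha.le (by positivity),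
        ← Real.rpow_mul hr0.le]
    rw [(hfluxd r hr).deriv, hflux r hr, h4, ← aStar_mul_bet_rpow h]
    have h1 : r ^ ((β - 1) * (p - 1)) = r ^ ((β - 1) * (p - 1) - 1) * r := by
      rw [← Real.rpow_add_one hr0.ne', sub_add_cancel]
    have h2 : r ^ ((β - 1) * (p - 1) - 1) = r ^ σ * r ^ (β * q) := by
      rw [← Real.rpow_add hr0]
      congr 1
      have := bet_mul h
      linarith
    rw [h1, h2]
    have h3 : kap p q N σ = N - p + β * (p - 1) := rfl
    field_simp
    rw [h3]; ring

/-- w' is a power of r times the odd power of the C¹ function Z(log r). That odd power is smooth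
away from 0, whence the condition on Z. -/
theorem contDiffOn_ofProfile (h : ParameterRange p q N σ) {v Z : ℝ → ℝ} {I : Set ℝ}
    (hIo : IsOpen I) (hI : I ⊆ Ioi 0)
    (hv : IsOrbit (bet p q σ) (kap p q N σ) (1 / (p - 1)) q ε (Real.exp ⁻¹' I) v Z)
    (hZ : ∀ t ∈ Real.exp ⁻¹' I, Z t ≠ 0) : ContDiffOn ℝ 2 (ofProfile p q N σ v) I := by
  have hp1 : 0 < p - 1 := by linarith [h.hp]
  have hlog : ∀ r ∈ I, Real.log r ∈ Real.exp ⁻¹' I := fun r hr => by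
    rw [mem_preimage, Real.exp_log (hI hr)]; exact hr
  have hder := fun r (hr : r ∈ I) => deriv_ofProfile (N := N) hI hv hr
  have hlogc : ContinuousOn Real.log I :=
    Real.continuousOn_log.mono fun r hr => (ne_of_gt (hI hr) : r ≠ 0)
  have hvc : ContinuousOn (fun r => v (Real.log r)) I := fun r hr =>
    ((hv.deriv_fst _ (hlog r hr)).continuousAt.comp
      (Real.continuousAt_log (ne_of_gt (hI hr)))).continuousWithinAt
  have hZc : ContinuousOn (fun r => Z (Real.log r)) I := fun r hr =>
    ((hv.deriv_snd _ (hlog r hr)).continuousAt.comp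
      (Real.continuousAt_log (ne_of_gt (hI hr)))).continuousWithinAt
  have hZd : ∀ r ∈ I, HasDerivAt (fun r => Z (Real.log r))
      (-kap p q N σ * (ε * v (Real.log r) ^ q + Z (Real.log r)) * r⁻¹) r := fun r hr =>
    (hv.deriv_snd _ (hlog r hr)).comp r (Real.hasDerivAt_log (ne_of_gt (hI hr)))
  have hZ1 : ContDiffOn ℝ 1 (fun r => Z (Real.log r)) I := by
    rw [show (1 : WithTop ℕ∞) = 0 + 1 by simp, contDiffOn_succ_iff_deriv_of_isOpen hIo]
    refine ⟨fun r hr => (hZd r hr).differentiableAt.differentiableWithinAt, by simp, ?_⟩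
    rw [contDiffOn_zero]
    refine ContinuousOn.congr ?_ fun r hr => (hZd r hr).deriv
    refine (continuousOn_const.mul ((continuousOn_const.mul (hvc.rpow_const fun r hr =>
      Or.inl (hv.pos _ (hlog r hr)).ne')).add hZc)).mul ?_
    exact continuousOn_inv₀.mono fun r hr => (ne_of_gt (hI hr) : r ≠ 0)
  rw [show (2 : WithTop ℕ∞) = 1 + 1 by norm_num, contDiffOn_succ_iff_deriv_of_isOpen hIo]
  refine ⟨fun r hr => (hder r hr).differentiableAt.differentiableWithinAt, by simp, ?_⟩
  refine ContDiffOn.congr ?_ fun r hr => (hder r hr).deriv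
  refine contDiffOn_const.mul (ContDiffOn.mul ?_ ?_)
  · exact contDiffOn_id.rpow_const_of_ne fun r hr => (ne_of_gt (hI hr) : r ≠ 0)
  · intro r hr
    exact (contDiffAt_spow (one_div_pos.2 hp1) (hZ _ (hlog r hr))).comp_contDiffWithinAt r (hZ1 r hr)

/-! ### From solutions to orbits -/

/-- The profile of `w` relative to `w*`. -/
noncomputable def profile (p q N σ : ℝ) (w : ℝ → ℝ) (t : ℝ) : ℝ :=
  (aStar p q N σ (-1))⁻¹ * (Real.exp (-bet p q σ * t) * w (Real.exp t))

/-- The flux of `w` relative to that of `w*`. -/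
noncomputable def fluxProfile (p q N σ : ℝ) (w : ℝ → ℝ) (t : ℝ) : ℝ :=
  ((aStar p q N σ (-1) * bet p q σ) ^ (p - 1))⁻¹ *
    (Real.exp (-((bet p q σ - 1) * (p - 1)) * t) * flux p (deriv w (Real.exp t)))

theorem isOrbit_profile (h : ParameterRange p q N σ) {w : ℝ → ℝ} {I : Set ℝ}
    (hw : IsPosSolution p q N σ ε I w) :
    IsOrbit (bet p q σ) (kap p q N σ) (1 / (p - 1)) q ε (Real.exp ⁻¹' I)
      (profile p q N σ w) (fluxProfile p q N σ w) := by
  have ha := aStar_pos h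
  have hβ := bet_pos h
  have hp1 : 0 < p - 1 := by linarith [h.hp]
  have hA := aStar_mul_bet_rpow h
  have hB := bet_mul h
  have hK : kap p q N σ = N - p + bet p q σ * (p - 1) := rfl
  have hE : ∀ c t : ℝ, HasDerivAt (fun t => Real.exp (c * t)) (c * Real.exp (c * t)) t :=
    fun c t => by
      refine (((hasDerivAt_id t).const_mul c).exp).congr_deriv ?_
      simp only [id]; ring
  have hC : 0 < (aStar p q N σ (-1) * bet p q σ) ^ (p - 1) := by positivity
  refine ⟨fun t ht => ?_, fun t ht => ?_, fun t ht => ?_⟩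
  · have := hw.pos _ ht
    simp only [profile]
    positivity
  · have h1 := (((hE (-bet p q σ) t).mul ((hw.differentiable _ ht).hasDerivAt.comp t
      (Real.hasDerivAt_exp t))).const_mul (aStar p q N σ (-1))⁻¹)
    refine h1.congr_deriv ?_
    have h2 : spow (1 / (p - 1)) (fluxProfile p q N σ w t) =
        (aStar p q N σ (-1) * bet p q σ)⁻¹ *
          (Real.exp (-(bet p q σ - 1) * t) * deriv w (Real.exp t)) := by
      rw [fluxProfile, spow_mul (by positivity) (by positivity), spow_mul (by positivity)
        (by positivity), flux_eq_spow h.hp, spow_spow (by positivity) hp1,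
        mul_one_div_cancel hp1.ne', spow_one_left, Real.inv_rpow (by positivity),
        ← Real.rpow_mul (by positivity), mul_one_div_cancel hp1.ne', Real.rpow_one,
        ← Real.exp_mul]
      congr 3
      field_simp
    rw [h2, profile]
    have h3 : Real.exp (-(bet p q σ - 1) * t) = Real.exp (-bet p q σ * t) * Real.exp t := by
      rw [← Real.exp_add]; congr 1; ring
    rw [h3]
    simp only [Function.comp]
    field_simp
    ring
  · have h1 := (((hE (-((bet p q σ - 1) * (p - 1))) t).mul
      ((hw.flux_differentiable _ ht).hasDerivAt.comp t
      (Real.hasDerivAt_exp t))).const_mul ((aStar p q N σ (-1) * bet p q σ) ^ (p - 1))⁻¹)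
    refine h1.congr_deriv ?_
    have heq := hw.equation _ ht
    have hwp := hw.pos _ ht
    have het := Real.exp_pos t
    simp only [Function.comp]
    set D := deriv (fun x => flux p (deriv w x)) (Real.exp t) with hD
    have h2 : D * Real.exp t = -(N - 1) * flux p (deriv w (Real.exp t)) -
        ε * (Real.exp t ^ σ * Real.exp t) * w (Real.exp t) ^ q := by
      have : D = -(N - 1) / Real.exp t * flux p (deriv w (Real.exp t)) -
        ε * Real.exp t ^ σ * w (Real.exp t) ^ q := by
        linear_combination (-1) * heq
      rw [this]; field_simp
    have h3 : profile p q N σ w t ^ q = (aStar p q N σ (-1) ^ q)⁻¹ *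
        (Real.exp (-bet p q σ * q * t) * w (Real.exp t) ^ q) := by
      rw [profile, Real.mul_rpow (by positivity) (by positivity),
        Real.mul_rpow (by positivity) hwp.le, Real.inv_rpow ha.le, ← Real.exp_mul]
      congr 3; ring
    have h4 : Real.exp t ^ σ * Real.exp t * Real.exp (-((bet p q σ - 1) * (p - 1)) * t) =
        Real.exp (-bet p q σ * q * t) := by
      rw [← Real.exp_mul, ← Real.exp_add, ← Real.exp_add]
      congr 1
      linear_combination t * hB
    rw [h2, h3, fluxProfile, ← hA, ← h4]
    have hk := kap_pos h
    field_simp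
    rw [hK]
    ring

theorem ofProfile_profile (h : ParameterRange p q N σ) {w : ℝ → ℝ} {r : ℝ} (hr : 0 < r) :
    ofProfile p q N σ (profile p q N σ w) r = w r := by
  have ha := aStar_pos h
  rw [ofProfile, profile, Real.exp_log hr, neg_mul, Real.exp_neg, mul_comm (bet p q σ),
    Real.exp_mul, Real.exp_log hr]
  field_simp

theorem profile_eq_of_eqOn (h : ParameterRange p q N σ) {v w : ℝ → ℝ} {t : ℝ}
    (hw : w (Real.exp t) = ofProfile p q N σ v (Real.exp t)) : profile p q N σ w t = v t := by
  have ha := aStar_pos h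
  rw [profile, hw, ofProfile, Real.log_exp, neg_mul, Real.exp_neg, mul_comm (bet p q σ),
    Real.exp_mul]
  field_simp

/-- A global extension would have as profile an orbit on the whole line that agrees with v;
agreement of the second components is then automatic. -/
theorem isNonglobal_ofProfile (h : ParameterRange p q N σ) {v Z : ℝ → ℝ} {I : Set ℝ}
    (hIo : IsOpen I)
    (hv : IsOrbit (bet p q σ) (kap p q N σ) (1 / (p - 1)) q ε (Real.exp ⁻¹' I) v Z)
    (hng : ∀ v' Z' : ℝ → ℝ,
      IsOrbit (bet p q σ) (kap p q N σ) (1 / (p - 1)) q ε univ v' Z' →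
      ¬ ∀ t ∈ Real.exp ⁻¹' I, v' t = v t ∧ Z' t = Z t) :
    IsNonglobal p q N σ ε I (ofProfile p q N σ v) := by
  intro W hW hEq
  have hW' := isOrbit_profile h hW
  have huniv : Real.exp ⁻¹' Ioi 0 = univ := by
    ext t; simp [Real.exp_pos]
  rw [huniv] at hW'
  have h1 : ∀ t ∈ Real.exp ⁻¹' I, profile p q N σ W t = v t := fun t ht =>
    profile_eq_of_eqOn h (hEq ht)
  refine hng _ _ hW' fun t ht => ⟨h1 t ht, ?_⟩
  exact IsOrbit.snd_eq_of_fst_eq (bet_pos h) (admissible h).m_pos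
    (hIo.preimage Real.continuous_exp) (hW'.mono (subset_univ _)) hv h1 t ht

end HardyHenon

namespace HardyHenon

variable {β κ m q ε : ℝ} {J : Set ℝ} {v Z : ℝ → ℝ}

/-! ### Behaviour of orbits at `-∞` -/

theorem hasDerivAt_exp_mul_const (c t : ℝ) :
    HasDerivAt (fun t => Real.exp (c * t)) (c * Real.exp (c * t)) t := by
  refine (((hasDerivAt_id t).const_mul c).exp).congr_deriv ?_
  simp only [id]; ring

theorem IsOrbit.hasDerivAt_exp_mul_fst (h : IsOrbit β κ m q ε J v Z) {t : ℝ} (ht : t ∈ J) :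
    HasDerivAt (fun t => Real.exp (β * t) * v t) (β * (Real.exp (β * t) * spow m (Z t))) t := by
  refine ((hasDerivAt_exp_mul_const β t).mul (h.deriv_fst t ht)).congr_deriv ?_
  ring

theorem IsOrbit.hasDerivAt_exp_mul_snd (h : IsOrbit β κ m q ε J v Z) {t : ℝ} (ht : t ∈ J) :
    HasDerivAt (fun t => Real.exp (κ * t) * Z t) (-κ * ε * (Real.exp (κ * t) * v t ^ q)) t := by
  refine ((hasDerivAt_exp_mul_const κ t).mul (h.deriv_snd t ht)).congr_deriv ?_
  ring

theorem exp_mul_rpow_eq {v q t : ℝ} (hv : 0 < v) (β κ : ℝ) :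
    Real.exp (κ * t) * v ^ q = Real.exp ((κ - β * q) * t) * (Real.exp (β * t) * v) ^ q := by
  rw [Real.mul_rpow (Real.exp_pos _).le hv.le, ← Real.exp_mul, ← mul_assoc, ← Real.exp_add]
  congr 2; ring

/-- Turns a flux bound Z ≥ c e^{-ks} into a lower bound for the derivative of e^{βs} v that is
uniform as s → -∞; this is where β ≤ km matters. -/
theorem le_exp_mul_rpow {c k s t y : ℝ} (hm : 0 < m) (hβ : 0 < β) (hc : 0 < c) (hk : β ≤ k * m)
    (hst : s ≤ t) (hy : c ≤ Real.exp (k * s) * y) :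
    β * (Real.exp ((β - k * m) * t) * c ^ m) ≤ β * (Real.exp (β * s) * y ^ m) := by
  have hy0 : 0 < y := pos_of_mul_pos_right (hc.trans_le hy) (Real.exp_pos _).le
  have h1 : c ^ m ≤ (Real.exp (k * s) * y) ^ m := Real.rpow_le_rpow hc.le hy hm.le
  rw [Real.mul_rpow (Real.exp_pos _).le hy0.le, ← Real.exp_mul] at h1
  refine mul_le_mul_of_nonneg_left ?_ hβ.le
  calc Real.exp ((β - k * m) * t) * c ^ m ≤ Real.exp ((β - k * m) * s) * c ^ m := by
        refine mul_le_mul_of_nonneg_right (Real.exp_le_exp.2 ?_) (by positivity)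
        nlinarith
    _ ≤ Real.exp ((β - k * m) * s) * (Real.exp (k * s * m) * y ^ m) :=
        mul_le_mul_of_nonneg_left h1 (Real.exp_pos _).le
    _ = Real.exp (β * s) * y ^ m := by
        rw [← mul_assoc, ← Real.exp_add]; congr 2; ring

theorem nonneg_of_neg_exp_le {A l t y : ℝ} (hl : 0 < l)
    (h : ∀ s ≤ t, -(A * Real.exp (l * s)) ≤ y) : 0 ≤ y := by
  have h1 : Tendsto (fun s => -(A * Real.exp (l * s))) atBot (𝓝 (-(A * 0))) := by
    refine (Tendsto.const_mul A (Real.tendsto_exp_atBot.comp ?_)).neg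
    exact tendsto_id.const_mul_atBot hl
  have := le_of_tendsto h1 ((eventually_le_atBot t).mono h)
  simpa using this

/-- Going backwards from t, f would be nonpositive by the time t - f(t)/η. -/
theorem false_of_le_deriv_of_pos {f f' : ℝ → ℝ} {t η : ℝ} (hη : 0 < η)
    (hd : ∀ s ≤ t, HasDerivAt f (f' s) s) (h : ∀ s ≤ t, η ≤ f' s) (hpos : ∀ s ≤ t, 0 < f s) :
    False := by
  have h0 := hpos t le_rfl
  have h1 : t - f t / η ≤ t := by have : 0 ≤ f t / η := by positivity
                                  linarith
  have := add_mul_le_of_le_deriv h1 (fun x hx => hd x hx.2) (fun x hx => h x hx.2)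
  have h2 : η * (t - (t - f t / η)) = f t := by field_simp; ring
  linarith [hpos _ h1]

/-- With a positive flux of order `e^{-kt}`, the profile cannot be positive up to `-∞`. -/
theorem IsOrbit.false_of_exp_mul_snd_ge (h : IsOrbit β κ m q ε J v Z) (hm : 0 < m) (hβ : 0 < β)
    {c k t : ℝ} (hc : 0 < c) (hk : β ≤ k * m) (hJ : Iic t ⊆ J)
    (hZ : ∀ s ≤ t, c ≤ Real.exp (k * s) * Z s) : False := by
  refine false_of_le_deriv_of_pos (f := fun s => Real.exp (β * s) * v s) (t := t)
    (η := β * (Real.exp ((β - k * m) * t) * c ^ m)) (by positivity)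
    (fun s hs => h.hasDerivAt_exp_mul_fst (hJ hs)) (fun s hs => ?_)
    (fun s hs => mul_pos (Real.exp_pos _) (h.pos s (hJ hs)))
  have h1 := hZ s hs
  have h2 : 0 < Z s := pos_of_mul_pos_right (hc.trans_le h1) (Real.exp_pos _).le
  rw [spow_of_nonneg hm h2.le]
  exact le_exp_mul_rpow hm hβ hc hk hs h1

/-- For ε = 1, e^{κt} Z is nonincreasing, so a positive value of Z would persist backwards and drive
e^{βt} v below 0. Hence Z ≤ 0 and e^{βt} v is nonincreasing. Integrating the flux equation from -∞
gives Z ≤ -c v^q, so v' ≤ -β c^m v^{qm}, which with qm > 1 cannot hold for all early times. -/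
theorem not_isOrbit_one_near_neg_infty (ha : Admissible β κ m q) {T : ℝ} :
    ¬ IsOrbit β κ m q 1 (Iio T) v Z := by
  intro h
  have hκ := ha.κ_pos
  have hβ := ha.β_pos
  have hm := ha.m_pos
  have hq := ha.q_pos
  have hl : 0 < κ - β * q := by linarith [ha.mul_lt]
  have hZ : ∀ t < T, Z t ≤ 0 := by
    intro t ht
    by_contra! hpos
    refine h.false_of_exp_mul_snd_ge hm hβ (k := κ) (c := Real.exp (κ * t) * Z t) (by positivity)
      ha.lt_mul.le (Iic_subset_Iio.2 ht) (fun s hs => ?_)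
    refine image_le_image_of_deriv_nonpos hs
      (fun x hx => h.hasDerivAt_exp_mul_snd (mem_Iio.2 (hx.2.trans_lt ht))) (fun x hx => ?_)
    have := h.pos x (hx.2.trans_lt ht)
    have : 0 < κ * (Real.exp (κ * x) * v x ^ q) := by positivity
    linarith
  have hanti : ∀ s t, s ≤ t → t < T → Real.exp (β * t) * v t ≤ Real.exp (β * s) * v s := by
    intro s t hst ht
    refine image_le_image_of_deriv_nonpos (f := fun t => Real.exp (β * t) * v t) hst
      (fun x hx => h.hasDerivAt_exp_mul_fst (mem_Iio.2 (hx.2.trans_lt ht))) (fun x hx => ?_)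
    have h1 : spow m (Z x) ≤ 0 := by
      rw [← spow_zero hm]; exact (spow_strictMono hm).monotone (hZ x (hx.2.trans_lt ht))
    exact mul_nonpos_of_nonneg_of_nonpos hβ.le
      (mul_nonpos_of_nonneg_of_nonpos (Real.exp_pos _).le h1)
  -- This is κ times the integral of e^{(κ-βq)s} over s ≤ t, up to the factor e^{(κ-βq)t}; it is
  -- finite because βq < κ.
  set c := κ / (κ - β * q) with hc
  have hcpos : 0 < c := by positivity
  have hZv : ∀ t < T, Z t ≤ -(c * v t ^ q) := by
    intro t ht
    have hvt := h.pos t ht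
    set A := (Real.exp (β * t) * v t) ^ q with hA
    have h1 : 0 ≤ -(Real.exp (κ * t) * Z t + c * A * Real.exp ((κ - β * q) * t)) := by
      refine nonneg_of_neg_exp_le (A := c * A) hl (t := t) fun s hs => ?_
      have h2 := image_le_image_of_deriv_nonpos
        (f := fun τ => Real.exp (κ * τ) * Z τ + c * A * Real.exp ((κ - β * q) * τ)) hs
        (fun x hx => (h.hasDerivAt_exp_mul_snd (mem_Iio.2 (hx.2.trans_lt ht))).add
          ((hasDerivAt_exp_mul_const (κ - β * q) x).const_mul (c * A))) (fun x hx => by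
          have h3 : c * A * ((κ - β * q) * Real.exp ((κ - β * q) * x)) =
            κ * (Real.exp ((κ - β * q) * x) * A) := by
            rw [hc]; field_simp
          rw [h3, exp_mul_rpow_eq (h.pos x (hx.2.trans_lt ht)) β κ]
          have h4 : A ≤ (Real.exp (β * x) * v x) ^ q :=
            Real.rpow_le_rpow (by positivity) (hanti x t hx.2 ht) hq.le
          have h5 := mul_le_mul_of_nonneg_left
            (mul_le_mul_of_nonneg_left h4 (Real.exp_pos ((κ - β * q) * x)).le) hκ.le
          linarith)
      have h6 : Real.exp (κ * s) * Z s ≤ 0 :=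
        mul_nonpos_of_nonneg_of_nonpos (Real.exp_pos _).le (hZ s (hs.trans_lt ht))
      linarith
    have h7 : c * A * Real.exp ((κ - β * q) * t) = Real.exp (κ * t) * (c * v t ^ q) := by
      have := exp_mul_rpow_eq (q := q) (t := t) hvt β κ
      rw [mul_left_comm, this]; ring
    rw [h7, ← mul_add] at h1
    have h8 : Z t + c * v t ^ q ≤ 0 := by
      by_contra! hlt
      have := mul_pos (Real.exp_pos (κ * t)) hlt
      linarith
    linarith
  have hqm : 0 < q * m - 1 := by linarith [ha.one_lt]
  -- The power v^{1-qm} straightens v' ≤ -β c^m v^{qm} into growth at a constant rate, contradicting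
  -- its positivity far in the past.
  refine false_of_le_deriv_of_pos (f := fun t => v t ^ (-(q * m - 1))) (t := T - 1)
    (η := (q * m - 1) * (β * c ^ m)) (by positivity)
    (fun s hs => (h.deriv_fst s (show s < T by linarith)).rpow_const
      (Or.inl (h.pos s (show s < T by linarith)).ne'))
    (fun s hs => ?_) (fun s hs => ?_)
  · have hsT : s < T := by linarith
    have hv := h.pos s hsT
    have h1 : spow m (Z s) ≤ -(c ^ m * v s ^ (q * m)) := by
      have := (spow_strictMono hm).monotone (hZv s hsT)
      rwa [spow_neg, spow_of_nonneg (x := c * v s ^ q) hm (by positivity), Real.mul_rpow hcpos.le (by positivity),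
        ← Real.rpow_mul hv.le] at this
    have h2 : β * (spow m (Z s) - v s) ≤ -(β * c ^ m * v s ^ (q * m)) := by
      have : β * (spow m (Z s) - v s) ≤ β * (-(c ^ m * v s ^ (q * m))) :=
        mul_le_mul_of_nonneg_left (by linarith) hβ.le
      linarith
    have h3 : v s ^ (-(q * m - 1) - 1) * v s ^ (q * m) = 1 := by
      rw [← Real.rpow_add hv, show -(q * m - 1) - 1 + q * m = 0 by ring, Real.rpow_zero]
    have h4 : 0 ≤ (q * m - 1) * v s ^ (-(q * m - 1) - 1) := by positivity
    have h5 := mul_le_mul_of_nonneg_left h2 h4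
    have h6 : (q * m - 1) * v s ^ (-(q * m - 1) - 1) * -(β * c ^ m * v s ^ (q * m)) =
        -((q * m - 1) * (β * c ^ m)) := by
      calc _ = -((q * m - 1) * (β * c ^ m)) * (v s ^ (-(q * m - 1) - 1) * v s ^ (q * m)) := by ring
        _ = _ := by rw [h3, mul_one]
    rw [h6] at h5
    linarith
  · have := h.pos s (show s < T by linarith)
    positivity

/-- A negative value of Z would make e^{βs} v grow linearly as s → -∞, against the finite limit.
Hence Z ≥ 0 and e^{βt} v ≥ c; integrating the flux equation gives Z ≥ A e^{-βqt}, a positive flux so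
large that v could not stay positive. -/
theorem IsOrbit.not_tendsto_near_neg_infty (ha : Admissible β κ m q) {T c : ℝ}
    (h : IsOrbit β κ m q (-1) (Iio T) v Z) (hc : 0 < c) :
    ¬ Tendsto (fun t => Real.exp (β * t) * v t) atBot (𝓝 c) := by
  intro hlim
  have hκ := ha.κ_pos
  have hβ := ha.β_pos
  have hm := ha.m_pos
  have hq := ha.q_pos
  have hl : 0 < κ - β * q := by linarith [ha.mul_lt]
  have hZ : ∀ t < T, 0 ≤ Z t := by
    intro t ht
    by_contra! hneg
    set c₀ := -(Real.exp (κ * t) * Z t) with hc₀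
    have hc₀p : 0 < c₀ := by
      have := mul_pos (Real.exp_pos (κ * t)) (neg_pos.2 hneg)
      rw [hc₀]; linarith
    have hX : ∀ s ≤ t, c₀ ≤ Real.exp (κ * s) * -Z s := fun s hs => by
      have := image_le_image_of_deriv_nonneg (f := fun t => Real.exp (κ * t) * Z t) hs
        (fun x hx => h.hasDerivAt_exp_mul_snd (mem_Iio.2 (hx.2.trans_lt ht))) (fun x hx => by
          have := h.pos x (hx.2.trans_lt ht)
          have : 0 < κ * (Real.exp (κ * x) * v x ^ q) := by positivity
          linarith)
      rw [hc₀]; linarith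
    set η := β * (Real.exp ((β - κ * m) * t) * c₀ ^ m) with hη
    have hηp : 0 < η := by positivity
    have hgrow : ∀ s ≤ t, η * (t - s) ≤ Real.exp (β * s) * v s := by
      intro s hs
      have := add_mul_le_of_le_deriv (f := fun s => -(Real.exp (β * s) * v s)) (η := η) hs
        (fun x hx => (h.hasDerivAt_exp_mul_fst (mem_Iio.2 (hx.2.trans_lt ht))).neg) (fun x hx => by
          have h1 := hX x hx.2
          have h2 : 0 < -Z x := pos_of_mul_pos_right (hc₀p.trans_le h1) (Real.exp_pos _).le
          have h3 := le_exp_mul_rpow hm hβ hc₀p ha.lt_mul.le hx.2 h1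
          rw [← spow_of_nonneg hm h2.le, spow_neg] at h3
          linarith)
      have := mul_pos (Real.exp_pos (β * t)) (h.pos t ht)
      linarith
    obtain ⟨s, hs1, hs2⟩ := ((hlim.eventually (gt_mem_nhds (lt_add_one c))).and
      (eventually_le_atBot (t - (c + 1) / η))).exists
    have hpos : 0 < (c + 1) / η := by positivity
    have h1 := hgrow s (by linarith)
    have h2 : η * ((c + 1) / η) ≤ η * (t - s) := mul_le_mul_of_nonneg_left (by linarith) hηp.le
    rw [mul_div_cancel₀ _ hηp.ne'] at h2
    linarith
  have hcw : ∀ t < T, c ≤ Real.exp (β * t) * v t := by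
    intro t ht
    refine le_of_tendsto hlim ?_
    filter_upwards [eventually_le_atBot t] with s hs
    refine image_le_image_of_deriv_nonneg (f := fun t => Real.exp (β * t) * v t) hs
      (fun x hx => h.hasDerivAt_exp_mul_fst (mem_Iio.2 (hx.2.trans_lt ht))) (fun x hx => ?_)
    have := spow_nonneg hm (hZ x (hx.2.trans_lt ht))
    positivity
  set A := κ / (κ - β * q) * c ^ q with hA
  have hAp : 0 < A := by positivity
  have hT : T - 1 < T := by linarith
  -- The rate k = βq meets β ≤ km because qm > 1.
  refine h.false_of_exp_mul_snd_ge hm hβ (t := T - 1) hAp (k := β * q) ?_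
    (Iic_subset_Iio.2 hT) fun t ht => ?_
  · nlinarith [ha.one_lt]
  · have htT : t < T := by linarith
    have h1 : 0 ≤ Real.exp (κ * t) * Z t - A * Real.exp ((κ - β * q) * t) := by
      refine nonneg_of_neg_exp_le (A := A) hl (t := t) fun s hs => ?_
      have h2 := image_le_image_of_deriv_nonneg
        (f := fun τ => Real.exp (κ * τ) * Z τ - A * Real.exp ((κ - β * q) * τ)) hs
        (fun x hx => (h.hasDerivAt_exp_mul_snd (mem_Iio.2 (hx.2.trans_lt htT))).sub
          ((hasDerivAt_exp_mul_const (κ - β * q) x).const_mul A)) (fun x hx => by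
          have h3 : A * ((κ - β * q) * Real.exp ((κ - β * q) * x)) =
            κ * (Real.exp ((κ - β * q) * x) * c ^ q) := by
            rw [hA]; field_simp
          rw [h3, exp_mul_rpow_eq (h.pos x (hx.2.trans_lt htT)) β κ]
          have h4 : c ^ q ≤ (Real.exp (β * x) * v x) ^ q :=
            Real.rpow_le_rpow hc.le (hcw x (hx.2.trans_lt htT)) hq.le
          have h5 := mul_le_mul_of_nonneg_left
            (mul_le_mul_of_nonneg_left h4 (Real.exp_pos ((κ - β * q) * x)).le) hκ.le
          linarith)
      have h6 : 0 ≤ Real.exp (κ * s) * Z s :=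
        mul_nonneg (Real.exp_pos _).le (hZ s (hs.trans_lt htT))
      linarith
    have h7 : Real.exp (κ * t) = Real.exp ((κ - β * q) * t) * Real.exp (β * q * t) := by
      rw [← Real.exp_add]; congr 1; ring
    rw [h7] at h1
    have h8 : 0 ≤ Real.exp ((κ - β * q) * t) * (Real.exp (β * q * t) * Z t - A) := by linarith
    have := nonneg_of_mul_nonneg_right h8 (Real.exp_pos _)
    linarith

/-! ### Orbits at `+∞` -/

theorem IsOrbit.hasDerivAt_log (h : IsOrbit β κ m q ε J v Z) {t : ℝ} (ht : t ∈ J) :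
    HasDerivAt (fun t => Real.log (v t)) (β * (spow m (Z t) / v t - 1)) t := by
  have hv := h.pos t ht
  refine ((h.deriv_fst t ht).log hv.ne').congr_deriv ?_
  field_simp

/-- The bound gives |Z^m / v| ≤ K^m v^{qm-1} → 0, so v first decays at least like e^{-βt/2}. This
makes the derivative of βt + log v exponentially small, so that this function converges. -/
theorem IsOrbit.exists_tendsto_of_abs_snd_le (ha : Admissible β κ m q) {t₀ K : ℝ}
    (h : IsOrbit β κ m q ε (Ici t₀) v Z) (hK : ∀ t, t₀ ≤ t → |Z t| ≤ K * v t ^ q)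
    (hv : Tendsto v atTop (𝓝 0)) :
    ∃ c, 0 < c ∧ Tendsto (fun t => Real.exp (β * t) * v t) atTop (𝓝 c) := by
  have hβ := ha.β_pos
  have hm := ha.m_pos
  have hqm : 0 < q * m - 1 := by linarith [ha.one_lt]
  have hK0 : 0 ≤ K := by
    have h0 := h.pos t₀ self_mem_Ici
    have := (abs_nonneg _).trans (hK t₀ le_rfl)
    exact nonneg_of_mul_nonneg_left this (by positivity)
  have hs : ∀ t, t₀ ≤ t → |spow m (Z t) / v t| ≤ K ^ m * v t ^ (q * m - 1) := by
    intro t ht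
    have hvt := h.pos t ht
    rw [abs_div, abs_spow hm, abs_of_pos hvt, div_le_iff₀ hvt, mul_assoc,
      ← Real.rpow_add_one hvt.ne', sub_add_cancel, Real.rpow_mul hvt.le,
      ← Real.mul_rpow hK0 (by positivity)]
    exact Real.rpow_le_rpow (abs_nonneg _) (hK t ht) hm.le
  have hsmall : Tendsto (fun t => K ^ m * v t ^ (q * m - 1)) atTop (𝓝 0) := by
    have := (hv.rpow_const (p := q * m - 1) (Or.inr hqm.le)).const_mul (K ^ m)
    rwa [Real.zero_rpow hqm.ne', mul_zero] at this
  obtain ⟨t₁, ht₁⟩ := eventually_atTop.1 (hsmall.eventually (gt_mem_nhds one_half_pos))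
  set t₂ := max t₀ t₁ with ht₂
  have hdecay : ∀ t, t₂ ≤ t → v t ≤ v t₂ * Real.exp (-(β / 2) * (t - t₂)) := by
    intro t ht
    have hv2 := h.pos t₂ (mem_Ici.2 (le_max_left _ _))
    have hvt := h.pos t ((le_max_left _ _).trans ht)
    have h1 := add_mul_le_of_le_deriv (f := fun s => -Real.log (v s)) (η := β / 2) ht
      (fun x hx => (h.hasDerivAt_log ((le_max_left _ _).trans hx.1 : t₀ ≤ x)).neg) (fun x hx => by
        have h1 := (le_abs_self _).trans (hs x ((le_max_left _ _).trans hx.1))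
        have h2 := ht₁ x ((le_max_right _ _).trans hx.1)
        have h3 : β * (spow m (Z x) / v x - 1) ≤ β * (-(1 / 2)) :=
          mul_le_mul_of_nonneg_left (by linarith) hβ.le
        linarith)
    rw [← Real.exp_log hv2, ← Real.exp_add, ← Real.log_le_iff_le_exp hvt]
    linarith
  obtain ⟨L, hL⟩ := exists_tendsto_of_deriv_exp_bound (f := fun t => β * t + Real.log (v t))
    (f' := fun t => β * 1 + β * (spow m (Z t) / v t - 1)) (t₀ := t₂)
    (K := β * K ^ m * (v t₂ ^ (q * m - 1) * Real.exp (β / 2 * t₂ * (q * m - 1))))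
    (δ := β / 2 * (q * m - 1)) (by positivity)
    (fun t ht => ((hasDerivAt_id t).const_mul β).add
      (h.hasDerivAt_log ((le_max_left _ _).trans ht : t₀ ≤ t)))
    (fun t ht => by
      have ht0 : t₀ ≤ t := (le_max_left _ _).trans ht
      have hv2 := h.pos t₂ (mem_Ici.2 (le_max_left _ _))
      have hvt := h.pos t ht0
      rw [show β * 1 + β * (spow m (Z t) / v t - 1) = β * (spow m (Z t) / v t) by ring, abs_mul,
        abs_of_pos hβ]
      have h1 : v t ^ (q * m - 1) ≤ v t₂ ^ (q * m - 1) *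
          Real.exp (-(β / 2) * (t - t₂) * (q * m - 1)) := by
        rw [Real.exp_mul, ← Real.mul_rpow hv2.le (Real.exp_pos _).le]
        exact Real.rpow_le_rpow hvt.le (hdecay t ht) hqm.le
      calc _ ≤ β * (K ^ m * v t ^ (q * m - 1)) := mul_le_mul_of_nonneg_left (hs t ht0) hβ.le
        _ ≤ β * (K ^ m * (v t₂ ^ (q * m - 1) * Real.exp (-(β / 2) * (t - t₂) * (q * m - 1)))) := by
          gcongr
        _ = _ := by
          rw [show -(β / 2) * (t - t₂) * (q * m - 1) = β / 2 * t₂ * (q * m - 1) +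
            -(β / 2 * (q * m - 1)) * t by ring, Real.exp_add]
          ring)
  refine ⟨Real.exp L, Real.exp_pos _, ?_⟩
  refine ((Real.continuous_exp.tendsto L).comp hL).congr' ?_
  filter_upwards [eventually_ge_atTop t₀] with t ht
  simp only [Function.comp]
  rw [Real.exp_add, Real.exp_log (h.pos t ht)]

/-- e^{βqt} Z solves a relaxation equation with rate κ - βq > 0 and the convergent source -κε
(e^{βt} v)^q. -/
theorem IsOrbit.tendsto_exp_mul_snd (ha : Admissible β κ m q) {t₀ c : ℝ}
    (h : IsOrbit β κ m q ε (Ici t₀) v Z)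
    (hc : Tendsto (fun t => Real.exp (β * t) * v t) atTop (𝓝 c)) :
    Tendsto (fun t => Real.exp (β * q * t) * Z t) atTop (𝓝 (-ε * (κ * c ^ q / (κ - β * q)))) := by
  have hl : 0 < κ - β * q := by linarith [ha.mul_lt]
  have h1 := tendsto_of_relaxation (g := fun t => Real.exp (β * q * t) * Z t) (t₀ := t₀)
    (h := fun t => -κ * ε * (Real.exp (β * t) * v t) ^ q) hl
    (fun t ht => by
      refine ((hasDerivAt_exp_mul_const (β * q) t).mul (h.deriv_snd t ht)).congr_deriv ?_
      have h2 : Real.exp (β * q * t) * v t ^ q = (Real.exp (β * t) * v t) ^ q := by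
        rw [Real.mul_rpow (Real.exp_pos _).le (h.pos t ht).le, ← Real.exp_mul]
        congr 2; ring
      rw [← h2]; ring)
    ((hc.rpow_const (Or.inr ha.q_pos.le)).const_mul (-κ * ε))
  refine h1.congr' (Eventually.of_forall fun t => rfl) |>.trans ?_
  rw [show -κ * ε * c ^ q / (κ - β * q) = -ε * (κ * c ^ q / (κ - β * q)) by ring]

end HardyHenon

namespace HardyHenon

variable {β κ m q ε : ℝ} {J : Set ℝ} {v Z : ℝ → ℝ}

/-! ### Blow-up -/

theorem eventually_gt_of_hasDerivAt_pos {f : ℝ → ℝ} {f' x : ℝ} (hf : HasDerivAt f f' x)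
    (hpos : 0 < f') : ∀ᶠ y in 𝓝[>] x, f x < f y := by
  have h1 := (hasDerivAt_iff_tendsto_slope.1 hf).mono_left
    (nhdsWithin_mono x (fun y (hy : x < y) => (ne_of_gt hy : y ≠ x)))
  filter_upwards [h1.eventually (lt_mem_nhds hpos), self_mem_nhdsWithin] with y hy hxy
  have hxy : x < y := hxy
  rw [slope_def_field] at hy
  have := (div_pos_iff_of_pos_right (sub_pos.2 hxy)).1 hy
  linarith

/-- A quadrant `{P ≥ b, V ≥ V₀}` is invariant if `V` increases in it and `P` increases on its
lower edge. -/
theorem quadrant_invariant {P V P' V' : ℝ → ℝ} {t₀ b V₀ : ℝ}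
    (hP : ∀ t, t₀ ≤ t → HasDerivAt P (P' t) t) (hV : ∀ t, t₀ ≤ t → HasDerivAt V (V' t) t)
    (hP' : ∀ t, t₀ ≤ t → P t = b → V₀ ≤ V t → 0 < P' t)
    (hV' : ∀ t, t₀ ≤ t → b ≤ P t → 0 ≤ V' t) (hP0 : b ≤ P t₀) (hV0 : V₀ ≤ V t₀) :
    ∀ t, t₀ ≤ t → b ≤ P t ∧ V₀ ≤ V t := by
  intro t ht
  have hPc : ContinuousOn P (Icc t₀ t) := fun x hx => (hP x hx.1).continuousAt.continuousWithinAt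
  have hVc : ContinuousOn V (Icc t₀ t) := fun x hx => (hV x hx.1).continuousAt.continuousWithinAt
  have hcl : IsClosed ({x | b ≤ P x ∧ V₀ ≤ V x} ∩ Icc t₀ t) := by
    have h1 := hPc.preimage_isClosed_of_isClosed isClosed_Icc (isClosed_Ici (a := b))
    have h2 := hVc.preimage_isClosed_of_isClosed isClosed_Icc (isClosed_Ici (a := V₀))
    convert h1.inter h2 using 1
    ext x
    simp only [mem_inter_iff, mem_ofPred_eq, mem_preimage, mem_Ici]
    tauto
  refine hcl.Icc_subset_of_forall_mem_nhdsWithin ⟨hP0, hV0⟩ ?_ ⟨ht, le_rfl⟩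
  rintro x ⟨⟨hx1, hx2⟩, hx3⟩
  have hPev : ∀ᶠ y in 𝓝[>] x, b ≤ P y := by
    rcases hx1.eq_or_lt with h | h
    · filter_upwards [eventually_gt_of_hasDerivAt_pos (hP x hx3.1) (hP' x hx3.1 h.symm hx2)]
        with y hy
      linarith
    · filter_upwards [nhdsWithin_le_nhds ((hP x hx3.1).continuousAt.eventually (lt_mem_nhds h))]
        with y hy using le_of_lt hy
  obtain ⟨u, hu, hsub⟩ := mem_nhdsGT_iff_exists_Ioo_subset.1 hPev
  refine mem_nhdsGT_iff_exists_Ioo_subset.2 ⟨u, hu, fun y hy => ⟨hsub hy, hx2.trans ?_⟩⟩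
  refine image_le_image_of_deriv_nonneg hy.1.le (fun z hz => hV z (hx3.1.trans hz.1)) (fun z hz => ?_)
  refine hV' z (hx3.1.trans hz.1) ?_
  rcases hz.1.eq_or_lt with h | h
  · rw [← h]; exact hx1
  · exact hsub ⟨h, hz.2.trans_lt hy.2⟩

theorem self_mul_spow (hm : 0 < m) (x : ℝ) : x * spow m x = |x| ^ (1 + m) := by
  have h1 : ∀ x : ℝ, 0 ≤ x → x * spow m x = |x| ^ (1 + m) := fun x hx => by
    rw [spow_of_nonneg hm hx, abs_of_nonneg hx, Real.rpow_add_of_nonneg hx zero_le_one hm.le,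
      Real.rpow_one]
  rcases le_total 0 x with hx | hx
  · exact h1 x hx
  · have := h1 (-x) (by linarith)
    rw [spow_neg, abs_neg] at this
    linarith

/-- Superlinear growth: the system for `V` and `P` has no solution on a half-line starting in the
quadrant `V > 1`, `P ≥ ς`. -/
theorem false_of_superlinear {V P : ℝ → ℝ} {t₀ ν b c ς : ℝ} (hm : 0 < m) (hν : 0 < ν) (hb : 0 < b)
    (hc : 0 < c) (hς : ς = 1 ∨ ς = -1)
    (hV : ∀ t, t₀ ≤ t → HasDerivAt V (c * V t * (spow m (P t) - ς)) t)
    (hP : ∀ t, t₀ ≤ t → HasDerivAt P ((ν + b) * V t - ς * ν * P t - b * |P t| ^ (1 + m)) t)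
    (hVpos : ∀ t, t₀ ≤ t → 0 < V t) (hV0 : 1 < V t₀) (hP0 : ς ≤ P t₀) : False := by
  have hςς : ς * ς = 1 := by rcases hς with rfl | rfl <;> norm_num
  have hςa : |ς| = 1 := by rcases hς with rfl | rfl <;> simp
  have hς1 : ς ≤ 1 := hςa ▸ le_abs_self ς
  have hςn : -1 ≤ ς := by have := neg_abs_le ς; rwa [hςa] at this
  have hsς : spow m ς = ς := by
    rcases hς with rfl | rfl
    · exact spow_one hm
    · rw [spow_neg, spow_one hm]
  have hmono := (spow_strictMono hm).monotone
  have hV' : ∀ t, t₀ ≤ t → ς ≤ P t → 0 ≤ c * V t * (spow m (P t) - ς) := fun t ht h => by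
    have h1 := hmono h
    rw [hsς] at h1
    exact mul_nonneg (mul_nonneg hc.le (hVpos t ht).le) (by linarith)
  have hinv := quadrant_invariant hP hV (b := ς) (V₀ := V t₀) (fun t ht h1 h2 => by
    rw [h1, hςa, Real.one_rpow, mul_right_comm, hςς]
    have : 0 < (ν + b) * (V t - 1) := mul_pos (by linarith) (by linarith)
    linarith) hV' hP0 le_rfl
  have hVmono : ∀ s t, t₀ ≤ s → s ≤ t → V s ≤ V t := fun s t hs hst =>
    image_le_image_of_deriv_nonneg hst (fun x hx => hV x (hs.trans hx.1))
      (fun x hx => hV' x (hs.trans hx.1) (hinv x (hs.trans hx.1)).1)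
  -- At P = ς the right-hand side is at least (ν + b)(V(t₀) - 1) > 0. By continuity P is pushed
  -- across a band around ς, after which V grows at a definite rate.
  obtain ⟨ρ, hρ, t₁, ht₁, hPρ⟩ : ∃ ρ, ς < ρ ∧ ∃ t₁, t₀ ≤ t₁ ∧ ∀ t, t₁ ≤ t → ρ ≤ P t := by
    set Φ : ℝ → ℝ := fun x => (ν + b) * V t₀ - ς * ν * x - b * |x| ^ (1 + m) with hΦ
    have hΦc : Continuous Φ := by
      refine Continuous.sub (by fun_prop) (continuous_const.mul ?_)
      exact continuous_abs.rpow_const fun _ => Or.inr (by linarith)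
    have hΦς : Φ ς = (ν + b) * (V t₀ - 1) := by
      simp only [hΦ]
      rw [hςa, Real.one_rpow, mul_right_comm, hςς]; ring
    have hη : 0 < (ν + b) * (V t₀ - 1) := mul_pos (by linarith) (by linarith)
    have h1 : ∀ᶠ x in 𝓝 ς, (ν + b) * (V t₀ - 1) / 2 < Φ x := by
      refine hΦc.continuousAt.eventually (lt_mem_nhds ?_)
      rw [hΦς]; linarith
    obtain ⟨δ, hδ, hball⟩ := Metric.eventually_nhds_iff.1 h1
    obtain ⟨t₁, ht₁, h2⟩ := eventually_nonneg_of_pushed (h := fun t => P t - (ς + δ / 2))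
      (half_pos hη) (fun t ht => (hP t ht).sub_const _) (fun t ht hle => by
        have h3 := hinv t ht
        have h4 := hball (y := P t) (by
          rw [Real.dist_eq, abs_lt]; constructor <;> linarith)
        have h5 : (ν + b) * V t₀ ≤ (ν + b) * V t := mul_le_mul_of_nonneg_left h3.2 (by linarith)
        simp only [hΦ] at h4
        linarith)
    exact ⟨ς + δ / 2, by linarith, t₁, ht₁, fun t ht => by linarith [h2 t ht]⟩
  have hVtop : ∀ M, ∃ T, t₀ ≤ T ∧ ∀ t, T ≤ t → M ≤ V t := by
    intro M
    have hρ' : 0 < spow m ρ - ς := by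
      have := spow_strictMono hm hρ
      rw [hsς] at this; linarith
    obtain ⟨T, hT, hMT⟩ := exists_ge_of_le_deriv (f := V) (t₀ := t₁) (η := c * (spow m ρ - ς))
      (by positivity) (fun t ht => hV t (ht₁.trans ht)) (fun t ht => by
        have h1 := hmono (hPρ t ht)
        have h2 := (hinv t (ht₁.trans ht)).2
        calc c * (spow m ρ - ς) ≤ c * (spow m (P t) - ς) :=
              mul_le_mul_of_nonneg_left (by linarith) hc.le
          _ = c * 1 * (spow m (P t) - ς) := by ring
          _ ≤ c * V t * (spow m (P t) - ς) := by
              refine mul_le_mul_of_nonneg_right ?_ (by linarith)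
              exact mul_le_mul_of_nonneg_left (by linarith) hc.le) M
    exact ⟨T, ht₁.trans hT, fun t ht => hMT.trans (hVmono T t (ht₁.trans hT) ht)⟩
  -- With this θ, as long as P ≤ V^θ, the linear term, the term b|P|^{1+m} and the derivative of V^θ
  -- are all O(V^{1/2}), hence dominated by the source (ν + b)V.
  set θ : ℝ := 1 / (2 * (1 + m)) with hθ
  have hθpos : 0 < θ := by positivity
  have hθ1 : θ * (1 + m) = 1 / 2 := by rw [hθ]; field_simp
  have hθhalf : θ ≤ 1 / 2 := by nlinarith
  have hA : 0 < ν + b + 2 * c := by linarith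
  set A := ν + b + 2 * c with hAdef
  -- Once V ≥ x₀², the source exceeds the total loss A V^{1/2} by at least 1.
  set x₀ := (A + 1) / (ν + b) + 1 with hx₀
  have hx₀1 : 1 ≤ x₀ := by
    have : 0 ≤ (A + 1) / (ν + b) := by positivity
    linarith
  obtain ⟨T₁, hT₁0, hT₁⟩ := hVtop (x₀ ^ 2)
  have hpush : ∀ t, T₁ ≤ t → P t - V t ^ θ ≤ 0 →
      1 ≤ ((ν + b) * V t - ς * ν * P t - b * |P t| ^ (1 + m)) -
        c * V t * (spow m (P t) - ς) * θ * V t ^ (θ - 1) := by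
    intro t ht hle
    have ht0 := hT₁0.trans ht
    have hVt := hVpos t ht0
    have hVx := hT₁ t ht
    have hV1 : 1 ≤ V t := (by nlinarith : (1 : ℝ) ≤ x₀ ^ 2).trans hVx
    have hVθ1 : 1 ≤ V t ^ θ := Real.one_le_rpow hV1 hθpos.le
    have hPabs : |P t| ≤ V t ^ θ := abs_le.2 ⟨by linarith [(hinv t ht0).1], by linarith⟩
    set y := V t ^ (1 / 2 : ℝ) with hy
    have hyy : y * y = V t := by
      rw [hy, ← Real.rpow_add hVt]; norm_num
    have hy0 : 0 < y := by positivity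
    have hyx : x₀ ≤ y := by nlinarith
    have hVθy : V t ^ θ ≤ y := Real.rpow_le_rpow_of_exponent_le hV1 hθhalf
    have e1 : ς * ν * P t ≤ ν * y := by
      calc ς * ν * P t ≤ |ς * ν * P t| := le_abs_self _
        _ = ν * |P t| := by rw [abs_mul, abs_mul, hςa, abs_of_pos hν]; ring
        _ ≤ ν * y := mul_le_mul_of_nonneg_left (hPabs.trans hVθy) hν.le
    have e2 : b * |P t| ^ (1 + m) ≤ b * y := by
      refine mul_le_mul_of_nonneg_left ?_ hb.le
      calc |P t| ^ (1 + m) ≤ (V t ^ θ) ^ (1 + m) :=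
            Real.rpow_le_rpow (abs_nonneg _) hPabs (by linarith)
        _ = y := by rw [← Real.rpow_mul hVt.le, hθ1]
    have e3 : c * V t * (spow m (P t) - ς) * θ * V t ^ (θ - 1) ≤ 2 * c * y := by
      have f1 : V t * V t ^ (θ - 1) = V t ^ θ := by
        rw [mul_comm, ← Real.rpow_add_one hVt.ne', sub_add_cancel]
      have f2 : spow m (P t) ≤ V t ^ (θ * m) := by
        have := hmono (le_trans (le_abs_self _) hPabs)
        rwa [spow_of_nonneg (x := V t ^ θ) hm (by positivity), ← Real.rpow_mul hVt.le] at this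
      have f3 : V t ^ θ * V t ^ (θ * m) = y := by
        rw [← Real.rpow_add hVt, hy, ← hθ1]; congr 1; ring
      calc _ = c * θ * ((V t * V t ^ (θ - 1)) * (spow m (P t) - ς)) := by ring
        _ = c * θ * (V t ^ θ * (spow m (P t) - ς)) := by rw [f1]
        _ ≤ c * θ * (V t ^ θ * (V t ^ (θ * m) + 1)) := by
          refine mul_le_mul_of_nonneg_left ?_ (by positivity)
          exact mul_le_mul_of_nonneg_left (by linarith) (by positivity)
        _ = c * θ * (y + V t ^ θ) := by rw [← f3]; ring
        _ ≤ c * 1 * (y + y) := by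
          refine mul_le_mul ?_ (by linarith) (by positivity) (by linarith)
          exact mul_le_mul_of_nonneg_left (by linarith) hc.le
        _ = 2 * c * y := by ring
    have e4 : (A + 1) * y ≤ (ν + b) * V t := by
      have : (ν + b) * x₀ = A + 1 + (ν + b) := by rw [hx₀]; field_simp
      have h5 : (ν + b) * x₀ ≤ (ν + b) * y := mul_le_mul_of_nonneg_left hyx (by linarith)
      have h6 : (A + 1) * y ≤ ((ν + b) * y) * y :=
        mul_le_mul_of_nonneg_right (by linarith) hy0.le
      calc _ ≤ ((ν + b) * y) * y := h6
        _ = (ν + b) * V t := by rw [← hyy]; ring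
    have e5 : A * y = ν * y + b * y + 2 * c * y := by rw [hAdef]; ring
    linarith
  obtain ⟨T₂, hT₂, hPV⟩ := eventually_nonneg_of_pushed (h := fun t => P t - V t ^ θ) one_pos
    (fun t ht => (hP t (hT₁0.trans ht)).sub
      ((hV t (hT₁0.trans ht)).rpow_const (Or.inl (hVpos t (hT₁0.trans ht)).ne'))) hpush
  -- Past this threshold V^{θm} ≥ 2, so subtracting ς costs at most half of it.
  obtain ⟨T₃, hT₃0, hT₃⟩ := hVtop (2 ^ (1 / (θ * m)))
  have hθm : 0 < θ * m := by positivity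
  -- Now V' ≥ (c/2) V^{1+θm}, so V^{-θm} decreases at least linearly and would become nonpositive.
  obtain ⟨t, ht, hft⟩ := exists_ge_of_le_deriv (f := fun t => -(V t ^ (-(θ * m))))
    (t₀ := max T₂ T₃) (η := θ * m * c / 2) (by positivity)
    (fun t ht => ((hV t (hT₃0.trans ((le_max_right _ _).trans ht))).rpow_const
      (Or.inl (hVpos t (hT₃0.trans ((le_max_right _ _).trans ht))).ne')).neg)
    (fun t ht => by
      have ht0 := hT₃0.trans ((le_max_right _ _).trans ht)
      have hVt := hVpos t ht0
      have h1 : V t ^ θ ≤ P t := by linarith [hPV t ((le_max_left _ _).trans ht)]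
      have h2 : V t ^ (θ * m) ≤ spow m (P t) := by
        have := hmono h1
        rwa [spow_of_nonneg (x := V t ^ θ) hm (by positivity), ← Real.rpow_mul hVt.le] at this
      have h3 : 2 ≤ V t ^ (θ * m) := by
        have := Real.rpow_le_rpow (by positivity) (hT₃ t ((le_max_right _ _).trans ht)) hθm.le
        rwa [← Real.rpow_mul (by norm_num), one_div_mul_cancel hθm.ne', Real.rpow_one] at this
      have h4 : V t ^ (θ * m) / 2 ≤ spow m (P t) - ς := by linarith
      have h5 : V t * V t ^ (-(θ * m) - 1) * V t ^ (θ * m) = 1 := by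
        nth_rewrite 1 [← Real.rpow_one (V t)]
        rw [← Real.rpow_add hVt, ← Real.rpow_add hVt, show
          1 + (-(θ * m) - 1) + θ * m = 0 by ring, Real.rpow_zero]
      have h6 : 0 < c * (θ * m) * (V t * V t ^ (-(θ * m) - 1)) := by positivity
      calc θ * m * c / 2 = c * (θ * m) / 2 * (V t * V t ^ (-(θ * m) - 1) * V t ^ (θ * m)) := by
            rw [h5]; ring
        _ = c * (θ * m) * (V t * V t ^ (-(θ * m) - 1)) * (V t ^ (θ * m) / 2) := by ring
        _ ≤ c * (θ * m) * (V t * V t ^ (-(θ * m) - 1)) * (spow m (P t) - ς) :=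
            mul_le_mul_of_nonneg_left h4 h6.le
        _ = _ := by ring) 0
  have := Real.rpow_pos_of_pos (hVpos t (hT₃0.trans ((le_max_right _ _).trans ht))) (-(θ * m))
  linarith

/-! ### Ratio variables and the region v > 1 -/

/-- The ratio of the flux to the flux of a power is governed by a Riccati equation. -/
theorem IsOrbit.hasDerivAt_ratio (h : IsOrbit β κ m q (-1) J v Z) (hm : 0 < m) {t : ℝ}
    (ht : t ∈ J) :
    HasDerivAt (fun t => v t ^ (-(1 / m)) * Z t)
      (κ * v t ^ (q - 1 / m) - (κ - β / m) * (v t ^ (-(1 / m)) * Z t) -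
        β / m * |v t ^ (-(1 / m)) * Z t| ^ (1 + m)) t := by
  have hv := h.pos t ht
  refine (((h.deriv_fst t ht).rpow_const (p := -(1 / m)) (Or.inl hv.ne')).mul
    (h.deriv_snd t ht)).congr_deriv ?_
  have h1 : spow m (v t ^ (-(1 / m)) * Z t) = (v t)⁻¹ * spow m (Z t) := by
    rw [spow_mul hm (by positivity), ← Real.rpow_mul hv.le, neg_mul, one_div_mul_cancel hm.ne',
      Real.rpow_neg_one]
  rw [← self_mul_spow hm, h1, Real.rpow_sub_one hv.ne', sub_eq_add_neg q, Real.rpow_add hv]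
  field_simp
  ring

theorem IsOrbit.hasDerivAt_power (h : IsOrbit β κ m q ε J v Z) (hm : 0 < m) {t : ℝ} (ht : t ∈ J) :
    HasDerivAt (fun t => v t ^ (q - 1 / m))
      ((q - 1 / m) * β * v t ^ (q - 1 / m) * (spow m (v t ^ (-(1 / m)) * Z t) - 1)) t := by
  have hv := h.pos t ht
  refine ((h.deriv_fst t ht).rpow_const (p := q - 1 / m) (Or.inl hv.ne')).congr_deriv ?_
  have h1 : spow m (v t ^ (-(1 / m)) * Z t) = (v t)⁻¹ * spow m (Z t) := by
    rw [spow_mul hm (by positivity), ← Real.rpow_mul hv.le, neg_mul, one_div_mul_cancel hm.ne',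
      Real.rpow_neg_one]
  rw [h1, Real.rpow_sub_one hv.ne']
  field_simp

theorem spow_ratio (hm : 0 < m) {x z : ℝ} (hx : 0 < x) :
    spow m (x ^ (-(1 / m)) * z) = x⁻¹ * spow m z := by
  rw [spow_mul hm (by positivity), ← Real.rpow_mul hx.le, neg_mul, one_div_mul_cancel hm.ne',
    Real.rpow_neg_one]

theorem one_le_ratio_iff (hm : 0 < m) {x z : ℝ} (hx : 0 < x) :
    1 ≤ x ^ (-(1 / m)) * z ↔ x ≤ spow m z := by
  rw [← (spow_strictMono hm).le_iff_le, spow_one hm, spow_ratio hm hx, inv_mul_eq_div,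
    one_le_div hx]

theorem ratio_le_one_iff (hm : 0 < m) {x z : ℝ} (hx : 0 < x) :
    x ^ (-(1 / m)) * z ≤ 1 ↔ spow m z ≤ x := by
  rw [← (spow_strictMono hm).le_iff_le, spow_one hm, spow_ratio hm hx, inv_mul_eq_div,
    div_le_one hx]

theorem Admissible.sub_pos (ha : Admissible β κ m q) : 0 < q - 1 / m := by
  have := ha.one_lt
  have hm := ha.m_pos
  rw [_root_.sub_pos, div_lt_iff₀ hm]; exact this

theorem Admissible.ν_pos (ha : Admissible β κ m q) : 0 < κ - β / m := by
  have := ha.lt_mul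
  have hm := ha.m_pos
  rw [_root_.sub_pos, div_lt_iff₀ hm]; exact this

theorem IsOrbit.false_of_expanding (ha : Admissible β κ m q) {t₀ : ℝ}
    (h : IsOrbit β κ m q (-1) (Ici t₀) v Z) (hv : 1 < v t₀) (hZ : v t₀ ≤ spow m (Z t₀)) :
    False := by
  have hm := ha.m_pos
  have hβ := ha.β_pos
  have hs := ha.sub_pos
  refine false_of_superlinear (V := fun t => v t ^ (q - 1 / m))
    (P := fun t => v t ^ (-(1 / m)) * Z t) (t₀ := t₀) (ν := κ - β / m) (b := β / m)
    (c := (q - 1 / m) * β) (ς := 1) hm ha.ν_pos (by positivity) (by positivity) (Or.inl rfl)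
    (fun t ht => h.hasDerivAt_power hm ht) (fun t ht => ?_) (fun t ht => ?_)
    (Real.one_lt_rpow hv hs) ((one_le_ratio_iff hm (by linarith)).2 hZ)
  · refine (h.hasDerivAt_ratio hm ht).congr_deriv ?_
    ring
  · have := h.pos t ht
    positivity

/-- Reversing time and the sign of the ratio turns the system into the one with ς = -1, in the same
quadrant. -/
theorem IsOrbit.false_of_expanding_backward (ha : Admissible β κ m q) {t₀ : ℝ}
    (h : IsOrbit β κ m q (-1) (Iic t₀) v Z) (hv : 1 < v t₀) (hZ : spow m (Z t₀) ≤ v t₀) :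
    False := by
  have hm := ha.m_pos
  have hβ := ha.β_pos
  have hs := ha.sub_pos
  have hmem : ∀ t, -t₀ ≤ t → -t ∈ Iic t₀ := fun t ht => mem_Iic.2 (by linarith)
  refine false_of_superlinear (V := fun t => v (-t) ^ (q - 1 / m))
    (P := fun t => -(v (-t) ^ (-(1 / m)) * Z (-t))) (t₀ := -t₀) (ν := κ - β / m) (b := β / m)
    (c := (q - 1 / m) * β) (ς := -1) hm ha.ν_pos (by positivity) (by positivity) (Or.inr rfl)
    (fun t ht => ?_) (fun t ht => ?_) (fun t ht => ?_) ?_ ?_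
  · refine ((h.hasDerivAt_power hm (hmem t ht)).comp t (hasDerivAt_neg t)).congr_deriv ?_
    rw [spow_neg]; ring
  · refine ((h.hasDerivAt_ratio hm (hmem t ht)).comp t (hasDerivAt_neg t)).neg.congr_deriv ?_
    rw [abs_neg]; ring
  · have := h.pos _ (hmem t ht)
    positivity
  · simpa using Real.one_lt_rpow hv hs
  · simpa using (ratio_le_one_iff hm (by linarith)).2 hZ

/-! ### Global orbits for `ε = -1` -/

/-- Otherwise the region R ≥ 1, V ≤ V(t₁) < 1 is invariant backwards. There Z ≥ v^{1/m} > v^q, so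
going back v decreases and Z increases; the slope of v stays bounded below and v would reach 0. -/
theorem IsOrbit.spow_snd_lt (ha : Admissible β κ m q) (h : IsOrbit β κ m q (-1) univ v Z) {t₁ : ℝ}
    (hv : v t₁ < 1) : spow m (Z t₁) < v t₁ := by
  have hm := ha.m_pos
  have hβ := ha.β_pos
  have hκ := ha.κ_pos
  have hs := ha.sub_pos
  by_contra! hle
  set R : ℝ → ℝ := fun t => v t ^ (-(1 / m)) * Z t with hR
  set V : ℝ → ℝ := fun t => v t ^ (q - 1 / m) with hV
  have hpos := fun t => h.pos t (mem_univ t)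
  have hV1 : V t₁ < 1 := Real.rpow_lt_one (hpos t₁).le hv hs
  have hRd := fun t : ℝ => (h.hasDerivAt_ratio hm (mem_univ (-t))).comp t (hasDerivAt_neg t)
  have hVd := fun t : ℝ => ((h.hasDerivAt_power hm (mem_univ (-t))).comp t (hasDerivAt_neg t)).neg
  have hRR : ∀ t, |R t| ^ (1 + m) = R t * spow m (R t) := fun t => (self_mul_spow hm _).symm
  have hinv : ∀ t, -t₁ ≤ t → 1 ≤ R (-t) ∧ -V t₁ ≤ -V (-t) := by
    refine quadrant_invariant (P := fun t => R (-t)) (V := fun t => -V (-t))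
      (fun t _ => hRd t) (fun t _ => hVd t) ?_ ?_ ?_ ?_
    · intro t _ h1 h2
      have h1' : v (-t) ^ (-(1 / m)) * Z (-t) = 1 := h1
      have h2' : v (-t) ^ (q - 1 / m) ≤ V t₁ := neg_le_neg_iff.1 h2
      rw [h1', abs_one, Real.one_rpow]
      have : 0 < κ * (1 - v (-t) ^ (q - 1 / m)) := mul_pos hκ (by linarith)
      linarith
    · intro t _ h1
      have h3 : 1 ≤ spow m (v (-t) ^ (-(1 / m)) * Z (-t)) := by
        exact le_of_eq_of_le (spow_one hm).symm ((spow_strictMono hm).monotone h1)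
      have h4 : 0 ≤ (q - 1 / m) * β * v (-t) ^ (q - 1 / m) *
          (spow m (v (-t) ^ (-(1 / m)) * Z (-t)) - 1) := by
        have := hpos (-t)
        exact mul_nonneg (by positivity) (by linarith)
      linarith
    · simpa [hR] using (one_le_ratio_iff hm (hpos t₁)).2 hle
    · simp
  have hinv' : ∀ s ≤ t₁, v s ≤ spow m (Z s) ∧ V s ≤ V t₁ := fun s hs => by
    have := hinv (-s) (by linarith)
    rw [neg_neg] at this
    exact ⟨(one_le_ratio_iff hm (hpos s)).1 this.1, by linarith [this.2]⟩
  have hvlt : ∀ s ≤ t₁, v s < 1 := fun s hst => by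
    by_contra! hge
    have := Real.one_le_rpow hge hs.le
    have h2 : V s ≤ V t₁ := (hinv' s hst).2
    simp only [hV] at h2 hV1
    linarith
  have hZq : ∀ s ≤ t₁, v s ^ q < Z s := fun s hst => by
    have h1 := (one_le_ratio_iff hm (hpos s)).2 (hinv' s hst).1
    have h2 : v s ^ (1 / m) ≤ Z s := by
      rw [Real.rpow_neg (hpos s).le, inv_mul_eq_div, one_le_div (by have := hpos s; positivity)]
        at h1
      exact h1
    exact (Real.rpow_lt_rpow_of_exponent_gt (hpos s) (hvlt s hst) (by linarith)).trans_le h2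
  have hZmono : ∀ s t, s ≤ t → t ≤ t₁ → Z t ≤ Z s := fun s t hst ht =>
    image_le_image_of_deriv_nonpos hst (fun x _ => h.deriv_snd x (mem_univ x)) (fun x hx => by
      have h1 := mul_pos hκ (sub_pos.2 (hZq x (hx.2.trans ht)))
      linarith)
  have hvmono : ∀ s t, s ≤ t → t ≤ t₁ → v s ≤ v t := fun s t hst ht =>
    image_le_image_of_deriv_nonneg hst (fun x _ => h.deriv_fst x (mem_univ x)) (fun x hx =>
      mul_nonneg hβ.le (by linarith [(hinv' x (hx.2.trans ht)).1]))
  -- At t₁ only the weak inequality is known; strictness appears one unit earlier at the latest,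
  -- because Z is strictly larger there.
  obtain ⟨t₂, ht₂, hstrict⟩ : ∃ t₂ ≤ t₁, v t₂ < spow m (Z t₂) := by
    by_contra! hall
    have hZlt : Z t₁ < Z (t₁ - 1) := by
      have := add_mul_le_of_le_deriv (f := fun t => -Z t) (s := t₁ - 1) (t := t₁)
        (η := κ * (Z t₁ - v t₁ ^ q))
        (by linarith) (fun x _ => (h.deriv_snd x (mem_univ x)).neg) (fun x hx => by
          have h1 := hZmono x t₁ hx.2 le_rfl
          have h2 : v x ^ q ≤ v t₁ ^ q :=
            Real.rpow_le_rpow (hpos x).le (hvmono x t₁ hx.2 le_rfl) ha.q_pos.le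
          have h3 := mul_le_mul_of_nonneg_left (show Z t₁ - v t₁ ^ q ≤ Z x - v x ^ q by linarith)
            hκ.le
          linarith)
      have h4 := mul_pos hκ (sub_pos.2 (hZq t₁ le_rfl))
      linarith
    have h1 := spow_strictMono hm hZlt
    have h2 := hall (t₁ - 1) (by linarith)
    have h3 := hvmono (t₁ - 1) t₁ (by linarith) le_rfl
    linarith
  refine false_of_le_deriv_of_pos (f := v) (t := t₂) (η := β * (spow m (Z t₂) - v t₂))
    (mul_pos hβ (by linarith)) (fun s _ => h.deriv_fst s (mem_univ s)) (fun s hs => ?_)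
    (fun s _ => hpos s)
  have h1 := (spow_strictMono hm).monotone (hZmono s t₂ hs ht₂)
  have h2 := hvmono s t₂ hs ht₂
  exact mul_le_mul_of_nonneg_left (by linarith) hβ.le

/-- A value above 1 forces finite-time blow-up, forward or backward according to the sign of Z^m -
v. -/
theorem IsOrbit.fst_le_one (ha : Admissible β κ m q) (h : IsOrbit β κ m q (-1) univ v Z) (t : ℝ) :
    v t ≤ 1 := by
  by_contra! hv
  rcases le_total (v t) (spow m (Z t)) with hZ | hZ
  · exact (h.mono (subset_univ _)).false_of_expanding ha hv hZ
  · exact (h.mono (subset_univ _)).false_of_expanding_backward ha hv hZ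

/-- Since v ≤ 1, the value 1 is a maximum, so v' = 0 and Z = 1 there. The field is C¹ near (1,1), so
local uniqueness makes the contact set open; it is also closed. -/
theorem IsOrbit.eq_one_of_exists (ha : Admissible β κ m q) (h : IsOrbit β κ m q (-1) univ v Z)
    (hex : ∃ t, v t = 1) : ∀ t, v t = 1 ∧ Z t = 1 := by
  have hm := ha.m_pos
  have hβ := ha.β_pos
  have hZ : ∀ t, v t = 1 → Z t = 1 := fun t ht => by
    have hmax : IsLocalMax v t := Eventually.of_forall fun s => by
      rw [ht]; exact h.fst_le_one ha s
    have h1 := hmax.hasDerivAt_eq_zero (h.deriv_fst t (mem_univ t))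
    rw [ht] at h1
    have h2 : spow m (Z t) = spow m 1 := by
      rw [spow_one hm]
      have := (mul_eq_zero.1 h1).resolve_left hβ.ne'
      linarith
    exact (spow_strictMono hm).injective h2
  set F : ℝ × ℝ → ℝ × ℝ := fun x => (β * (spow m x.2 - x.1), -κ * (-1 * x.1 ^ q + x.2)) with hF
  have hFd : ContDiffAt ℝ 1 F (1, 1) := by
    refine ContDiffAt.prodMk ?_ ?_
    · exact contDiffAt_const.mul
        (((contDiffAt_spow hm one_ne_zero).comp (1, 1) contDiffAt_snd).sub contDiffAt_fst)
    · exact contDiffAt_const.mul ((contDiffAt_const.mul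
        (contDiffAt_fst.rpow_const_of_ne one_ne_zero)).add contDiffAt_snd)
  obtain ⟨K, S, hS, hK⟩ := hFd.exists_lipschitzOnWith
  have hcont : Continuous v :=
    continuous_iff_continuousAt.2 fun t => (h.deriv_fst t (mem_univ t)).continuousAt
  have hcontZ : Continuous Z :=
    continuous_iff_continuousAt.2 fun t => (h.deriv_snd t (mem_univ t)).continuousAt
  have hopen : IsOpen {t | v t = 1} := by
    rw [isOpen_iff_mem_nhds]
    intro t ht
    have ht : v t = 1 := ht
    have hmem : ∀ᶠ s in 𝓝 t, (v s, Z s) ∈ S :=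
      (hcont.prodMk hcontZ).continuousAt.eventually (by
        show S ∈ 𝓝 (v t, Z t)
        rw [ht, hZ t ht]; exact hS)
    have heq := ODE_solution_unique_of_eventually (v := fun _ => F) (s := fun _ => S) (K := K)
      (t₀ := t) (f := fun s => (v s, Z s)) (g := fun _ => (1, 1)) (Eventually.of_forall fun _ => hK)
      (hmem.mono fun s hs => ⟨(h.deriv_fst s (mem_univ s)).prodMk (h.deriv_snd s (mem_univ s)), hs⟩)
      (Eventually.of_forall fun s => ⟨by
        have : F (1, 1) = 0 := by simp [hF, spow_one hm]
        rw [this]; exact hasDerivAt_const _ _, mem_of_mem_nhds hS⟩)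
      (by simp [ht, hZ t ht])
    filter_upwards [heq] with s hs
    exact congrArg Prod.fst hs
  have hclosed : IsClosed {t | v t = 1} := isClosed_eq hcont continuous_const
  have huniv : {t | v t = 1} = univ := IsClopen.eq_univ ⟨hclosed, hopen⟩ hex
  intro t
  have ht : v t = 1 := by
    have : t ∈ {t | v t = 1} := huniv ▸ mem_univ t
    exact this
  exact ⟨ht, hZ t ht⟩

theorem eq_zero_or_one_of_rpow_eq_self {l k : ℝ} (hl : 0 ≤ l) (hk : 1 < k) (h : l ^ k = l) :
    l = 0 ∨ l = 1 := by
  rcases hl.eq_or_lt with h0 | h0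
  · exact Or.inl h0.symm
  · right
    rcases lt_trichotomy l 1 with h1 | h1 | h1
    · have := Real.rpow_lt_rpow_of_exponent_gt h0 h1 hk
      rw [h, Real.rpow_one] at this
      exact absurd this (lt_irrefl _)
    · exact h1
    · have := Real.rpow_lt_rpow_of_exponent_lt h1 hk
      rw [h, Real.rpow_one] at this
      exact absurd this (lt_irrefl _)

/-- A limit of a bounded orbit at `±∞` is an equilibrium. -/
theorem equilibrium_of_limit (ha : Admissible β κ m q) {f g : ℝ → ℝ} {l M s : ℝ} (hs : s ≠ 0)
    (hf : ∀ t, HasDerivAt f (s * (β * (spow m (g t) - f t))) t)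
    (hg : ∀ t, HasDerivAt g (s * (-κ * (-1 * f t ^ q + g t))) t)
    (hf1 : ∀ t, 0 ≤ f t ∧ f t ≤ 1) (hg1 : ∀ t, 0 ≤ g t ∧ g t ≤ 1)
    (hl : Tendsto f atTop (𝓝 l)) (hM : Tendsto g atTop (𝓝 M)) : l = 0 ∨ l = 1 := by
  have hβ := ha.β_pos
  have hm := ha.m_pos
  have hκ := ha.κ_pos
  have h1 := deriv_limit_eq_zero_of_bounded (t₀ := 0) (B := 1) (fun t _ => hf t)
    (fun t _ => abs_le.2 ⟨by linarith [(hf1 t).1], (hf1 t).2⟩)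
    ((((((continuous_spow hm).tendsto M).comp hM).sub hl).const_mul β).const_mul s)
  have h2 := deriv_limit_eq_zero_of_bounded (t₀ := 0) (B := 1) (fun t _ => hg t)
    (fun t _ => abs_le.2 ⟨by linarith [(hg1 t).1], (hg1 t).2⟩)
    (((((hl.rpow_const (p := q) (Or.inr ha.q_pos.le)).const_mul (-1)).add hM).const_mul
      (-κ)).const_mul s)
  have h3 : spow m M = l := by
    have := (mul_eq_zero.1 ((mul_eq_zero.1 h1).resolve_left hs)).resolve_left hβ.ne'
    linarith
  have h4 : M = l ^ q := by
    have := (mul_eq_zero.1 ((mul_eq_zero.1 h2).resolve_left hs)).resolve_left (by linarith)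
    linarith
  have hl0 : 0 ≤ l := ge_of_tendsto' hl fun t => (hf1 t).1
  refine eq_zero_or_one_of_rpow_eq_self hl0 ha.one_lt ?_
  rwa [h4, spow_of_nonneg hm (by positivity), ← Real.rpow_mul hl0] at h3

/-- Away from the equilibrium v < 1 and Z^m < v, so v decreases strictly. Once Z > v^q > 0 is known,
Z decreases too, and both limits are equilibria, namely (1,1) in the past and (0,0) in the future. A
bound on Z / v^q then selects the slow rate at the origin. -/
theorem IsOrbit.global_classification (ha : Admissible β κ m q)
    (h : IsOrbit β κ m q (-1) univ v Z) :
    (∀ t, v t = 1 ∧ Z t = 1) ∨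
    ((∀ t, v t < 1) ∧ (∀ t, 0 < Z t) ∧ (∀ t, v t ^ q < Z t) ∧ Tendsto v atBot (𝓝 1) ∧
      ∃ c, 0 < c ∧ Tendsto (fun t => Real.exp (β * t) * v t) atTop (𝓝 c)) := by
  have hm := ha.m_pos
  have hβ := ha.β_pos
  have hκ := ha.κ_pos
  have hq := ha.q_pos
  by_cases hex : ∃ t, v t = 1
  · exact Or.inl (h.eq_one_of_exists ha hex)
  right
  push Not at hex
  have hv1 : ∀ t, v t < 1 := fun t => lt_of_le_of_ne (h.fst_le_one ha t) (hex t)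
  have hpos := fun t => h.pos t (mem_univ t)
  have hvd := fun t => h.deriv_fst t (mem_univ t)
  have hZd := fun t => h.deriv_snd t (mem_univ t)
  have hsZ : ∀ t, spow m (Z t) < v t := fun t => h.spow_snd_lt ha (hv1 t)
  have hvanti : StrictAnti v := strictAnti_of_deriv_neg fun t => by
    rw [(hvd t).deriv]
    exact mul_neg_of_pos_of_neg hβ (by linarith [hsZ t])
  have hXmono : StrictMono fun t => Real.exp (κ * t) * Z t := strictMono_of_deriv_pos fun t => by
    rw [(h.hasDerivAt_exp_mul_snd (mem_univ t)).deriv]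
    have := hpos t
    have : 0 < κ * (Real.exp (κ * t) * v t ^ q) := by positivity
    linarith
  -- As e^{κt} Z increases, a nonpositive value of Z makes Z negative and bounded away from 0 in the
  -- whole past, and 1 - v would become negative there.
  have hZ0 : ∀ t, 0 < Z t := by
    intro t
    by_contra! hneg
    have hX : Real.exp (κ * (t - 1)) * Z (t - 1) < 0 :=
      (hXmono (show t - 1 < t by linarith)).trans_le
        (mul_nonpos_of_nonneg_of_nonpos (Real.exp_pos _).le hneg)
    have hZneg : Z (t - 1) < 0 := by
      by_contra! hge
      have := mul_nonneg (Real.exp_pos (κ * (t - 1))).le hge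
      linarith
    have hZle : ∀ s ≤ t - 1, Z s ≤ Z (t - 1) := by
      intro s hs
      have h1 : Real.exp (κ * s) * Z s ≤ Real.exp (κ * (t - 1)) * Z (t - 1) := hXmono.monotone hs
      have h2 : Real.exp (κ * (t - 1)) * Z (t - 1) ≤ Real.exp (κ * s) * Z (t - 1) :=
        mul_le_mul_of_nonpos_right (Real.exp_le_exp.2 (mul_le_mul_of_nonneg_left hs hκ.le))
          hZneg.le
      exact le_of_mul_le_mul_left (h1.trans h2) (Real.exp_pos _)
    have hη : 0 < -(β * spow m (Z (t - 1))) := by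
      have := spow_strictMono hm hZneg
      rw [spow_zero hm] at this
      linarith [mul_pos hβ (neg_pos.2 this)]
    refine false_of_le_deriv_of_pos (f := fun s => 1 - v s) (t := t - 1) hη
      (fun s _ => (hvd s).const_sub 1) (fun s hs => ?_) (fun s _ => by linarith [hv1 s])
    have h1 := mul_le_mul_of_nonneg_left ((spow_strictMono hm).monotone (hZle s hs)) hβ.le
    have h2 := mul_pos hβ (hpos s)
    linarith
  -- Fixing A at the time of a failure, e^{κx}(Z - A) increases up to that time and would be
  -- negative before it, yet it is at least -A e^{κx} → 0 in the past.
  have hZv : ∀ t, v t ^ q < Z t := by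
    intro t
    by_contra! hle
    set A := v t ^ q with hA
    have hE : ∀ x, HasDerivAt (fun x => Real.exp (κ * x) * (Z x - A))
        (κ * Real.exp (κ * x) * (v x ^ q - A)) x := fun x => by
      refine ((hasDerivAt_exp_mul_const κ x).mul ((hZd x).sub_const A)).congr_deriv ?_
      ring
    have hE1 : Real.exp (κ * (t - 1)) * (Z (t - 1) - A) < Real.exp (κ * t) * (Z t - A) := by
      refine strictMonoOn_of_deriv_pos (convex_Icc (t - 1) t)
        (f := fun x => Real.exp (κ * x) * (Z x - A))
        (fun x _ => (hE x).continuousAt.continuousWithinAt) (fun x hx => ?_)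
        ⟨le_rfl, by linarith⟩ ⟨by linarith, le_rfl⟩ (by linarith)
      rw [interior_Icc] at hx
      rw [(hE x).deriv]
      have := Real.rpow_lt_rpow (hpos t).le (hvanti hx.2) hq
      exact mul_pos (mul_pos hκ (Real.exp_pos _)) (by linarith)
    have hE2 : Real.exp (κ * t) * (Z t - A) ≤ 0 :=
      mul_nonpos_of_nonneg_of_nonpos (Real.exp_pos _).le (by linarith)
    have := nonneg_of_neg_exp_le (A := A) hκ (t := t - 1)
      (y := Real.exp (κ * (t - 1)) * (Z (t - 1) - A)) fun s hs => by
        have h1 := image_le_image_of_deriv_nonneg hs (fun x _ => hE x) (fun x hx => by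
          have := Real.rpow_le_rpow (hpos t).le (hvanti.antitone (show x ≤ t by linarith [hx.2]))
            hq.le
          exact mul_nonneg (mul_pos hκ (Real.exp_pos _)).le (by linarith))
        have h2 := mul_pos (Real.exp_pos (κ * s)) (hZ0 s)
        linarith
    linarith
  have hZanti : Antitone Z := fun s t hst =>
    image_le_image_of_deriv_nonpos hst (fun x _ => hZd x) fun x _ => by
      have := mul_pos hκ (sub_pos.2 (hZv x))
      linarith
  have hZ1 : ∀ t, Z t ≤ 1 := fun t => by
    by_contra! hgt
    have := spow_strictMono hm hgt
    rw [spow_one hm] at this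
    linarith [hsZ t, hv1 t]
  have hbot : Tendsto v atBot (𝓝 1) := by
    have h1 : Tendsto v atBot (𝓝 (⨆ t, v t)) :=
      tendsto_atBot_ciSup hvanti.antitone ⟨1, by rintro _ ⟨t, rfl⟩; exact (hv1 t).le⟩
    have h2 : Tendsto Z atBot (𝓝 (⨆ t, Z t)) :=
      tendsto_atBot_ciSup hZanti ⟨1, by rintro _ ⟨t, rfl⟩; exact hZ1 t⟩
    have h3 := equilibrium_of_limit ha (f := fun t => v (-t)) (g := fun t => Z (-t)) (s := -1)
      (by norm_num) (fun t => ((hvd (-t)).comp t (hasDerivAt_neg t)).congr_deriv (by ring))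
      (fun t => ((hZd (-t)).comp t (hasDerivAt_neg t)).congr_deriv (by ring))
      (fun t => ⟨(hpos _).le, (hv1 _).le⟩) (fun t => ⟨(hZ0 _).le, hZ1 _⟩)
      (h1.comp tendsto_neg_atTop_atBot) (h2.comp tendsto_neg_atTop_atBot)
    rcases h3 with h3 | h3
    · have h4 : v 0 ≤ ⨆ t, v t := hvanti.antitone.ge_of_tendsto h1 0
      linarith [hpos 0]
    · rwa [h3] at h1
  have htop : Tendsto v atTop (𝓝 0) := by
    have h1 : Tendsto v atTop (𝓝 (⨅ t, v t)) :=
      tendsto_atTop_ciInf hvanti.antitone ⟨0, by rintro _ ⟨t, rfl⟩; exact (hpos t).le⟩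
    have h2 : Tendsto Z atTop (𝓝 (⨅ t, Z t)) :=
      tendsto_atTop_ciInf hZanti ⟨0, by rintro _ ⟨t, rfl⟩; exact (hZ0 t).le⟩
    have h3 := equilibrium_of_limit ha (s := 1) one_ne_zero
      (fun t => (hvd t).congr_deriv (by ring)) (fun t => (hZd t).congr_deriv (by ring))
      (fun t => ⟨(hpos _).le, (hv1 _).le⟩) (fun t => ⟨(hZ0 _).le, hZ1 _⟩) h1 h2
    rcases h3 with h3 | h3
    · rwa [h3] at h1
    · have h4 : ⨅ t, v t ≤ v 0 := hvanti.antitone.le_of_tendsto h1 0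
      linarith [hv1 0]
  have hl : 0 < κ - β * q := by linarith [ha.mul_lt]
  -- κ/(κ-βq) is the value above which the derivative of Z / v^q is nonpositive.
  set M := max (Z 0 / v 0 ^ q) (κ / (κ - β * q)) with hM
  have hQ : ∀ t, 0 ≤ t → Z t / v t ^ q - M ≤ 0 := by
    intro t ht
    have hQd : ∀ x, HasDerivAt (fun x => Z x * v x ^ (-q) - M)
        (κ - (κ - β * q) * (Z x * v x ^ (-q)) - q * β * (Z x * v x ^ (-q)) *
          (spow m (Z x) / v x)) x := fun x => by
      have hx := hpos x
      refine (((hZd x).mul ((hvd x).rpow_const (p := -q) (Or.inl hx.ne'))).sub_const M).congr_deriv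
        ?_
      have e1 : v x ^ q * v x ^ (-q) = 1 := by
        rw [← Real.rpow_add hx, add_neg_cancel, Real.rpow_zero]
      rw [Real.rpow_sub_one hx.ne']
      have e2 : -κ * (-1 * v x ^ q + Z x) * v x ^ (-q) =
          κ * (v x ^ q * v x ^ (-q)) - κ * (Z x * v x ^ (-q)) := by ring
      rw [e2, e1]
      field_simp
      ring
    have := nonpos_of_deriv_nonpos_of_pos (a := 0) (b := t)
      (fun x _ => (hQd x).continuousAt.continuousWithinAt) (fun x _ => hQd x)
      (by
        have h1 := le_max_left (Z 0 / v 0 ^ q) (κ / (κ - β * q))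
        rw [Real.rpow_neg (hpos 0).le, ← div_eq_mul_inv]
        linarith)
      (fun x _ hx => by
        have hvx := hpos x
        have hZx := hZ0 x
        have h1 : κ / (κ - β * q) ≤ Z x * v x ^ (-q) := by
          have := le_max_right (Z 0 / v 0 ^ q) (κ / (κ - β * q))
          linarith
        have h2 : κ ≤ (κ - β * q) * (Z x * v x ^ (-q)) := by
          rw [div_le_iff₀ hl] at h1; linarith
        have h3 : 0 ≤ q * β * (Z x * v x ^ (-q)) * (spow m (Z x) / v x) := by
          have := spow_nonneg hm hZx.le
          positivity
        linarith) t ⟨ht, le_rfl⟩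
    rwa [Real.rpow_neg (hpos t).le, ← div_eq_mul_inv] at this
  refine ⟨hv1, hZ0, hZv, hbot, ?_⟩
  refine (h.mono (subset_univ (Ici 0))).exists_tendsto_of_abs_snd_le ha (K := M) (fun t ht => ?_)
    htop
  have h1 := hQ t ht
  rw [abs_of_pos (hZ0 t), ← div_le_iff₀ (by have := hpos t; positivity)]
  linarith

end HardyHenon

namespace HardyHenon

variable {β κ m q ε : ℝ} {J : Set ℝ} {v Z : ℝ → ℝ}

/-! ### Graphs and their parametrization by time -/

/-- Exhausts (0,∞) by compact intervals, which is how a slope equation singular at 0 is started. -/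
theorem exists_solution_between_Ioi {F F' : ℝ → ℝ → ℝ} {b₁ b₂ b₁' b₂' : ℝ → ℝ}
    (h12 : ∀ x, 0 < x → b₁ x ≤ b₂ x)
    (hF : ContinuousOn (Function.uncurry F)
      {z : ℝ × ℝ | 0 < z.1 ∧ z.2 ∈ Icc (b₁ z.1) (b₂ z.1)})
    (hF' : ContinuousOn (Function.uncurry F')
      {z : ℝ × ℝ | 0 < z.1 ∧ z.2 ∈ Icc (b₁ z.1) (b₂ z.1)})
    (hFd : ∀ x, 0 < x → ∀ y ∈ Icc (b₁ x) (b₂ x), HasDerivAt (fun y => F x y) (F' x y) y)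
    (hb₁ : ∀ x, HasDerivAt b₁ (b₁' x) x) (hb₂ : ∀ x, HasDerivAt b₂ (b₂' x) x)
    (hsub : ∀ x, 0 < x → b₁' x ≤ F x (b₁ x)) (hsup : ∀ x, 0 < x → F x (b₂ x) ≤ b₂' x) :
    ∃ y : ℝ → ℝ, ∀ x, 0 < x → y x ∈ Icc (b₁ x) (b₂ x) ∧ HasDerivAt y (F x (y x)) x := by
  have ha0 : ∀ n : ℕ, 0 < 1 / ((n : ℝ) + 1) := fun n => by positivity
  have hpos : ∀ (n : ℕ) {x b : ℝ}, x ∈ Icc (1 / ((n : ℝ) + 1)) b → 0 < x := fun n x b hx =>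
    (ha0 n).trans_le hx.1
  have hsubset : ∀ n : ℕ, {z : ℝ × ℝ | z.1 ∈ Icc (1 / ((n : ℝ) + 1)) ((n : ℝ) + 2) ∧
      z.2 ∈ Icc (b₁ z.1) (b₂ z.1)} ⊆ {z : ℝ × ℝ | 0 < z.1 ∧ z.2 ∈ Icc (b₁ z.1) (b₂ z.1)} :=
    fun n z hz => ⟨hpos n hz.1, hz.2⟩
  obtain ⟨y, hy1, -, hy3, -⟩ := exists_solution_between (F := F) (F' := F') (b₁ := b₁) (b₂ := b₂)
    -- The right endpoint n + 2 keeps the interval nondegenerate at n = 0.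
    (a := fun n : ℕ => 1 / ((n : ℝ) + 1)) (b := fun n : ℕ => (n : ℝ) + 2)
    (fun n k hnk => one_div_le_one_div_of_le (by positivity) (by
      have : (n : ℝ) ≤ k := by exact_mod_cast hnk
      linarith))
    (fun n k hnk => by
      have : (n : ℝ) ≤ k := by exact_mod_cast hnk
      linarith)
    (fun n => by
      have h1 : 1 / ((n : ℝ) + 1) ≤ 1 := by
        rw [div_le_one (by positivity)]; linarith [(Nat.cast_nonneg n : (0 : ℝ) ≤ n)]
      linarith [(Nat.cast_nonneg n : (0 : ℝ) ≤ n)])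
    (fun n x hx => h12 x (hpos n hx)) (fun n => hF.mono (hsubset n))
    (fun n => hF'.mono (hsubset n)) (fun n x hx => hFd x (hpos n hx)) hb₁ hb₂
    (fun n x hx => hsub x (hpos n (Ioo_subset_Icc_self hx)))
    (fun n x hx => hsup x (hpos n (Ioo_subset_Icc_self hx)))
  refine ⟨y, fun x hx => ?_⟩
  obtain ⟨n, hn⟩ := exists_nat_gt (max (1 / x) x)
  have h1 : x ∈ Ioo (1 / ((n : ℝ) + 1)) ((n : ℝ) + 2) := by
    constructor
    · rw [one_div_lt (by positivity) hx]; linarith [le_max_left (1 / x) x]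
    · linarith [le_max_right (1 / x) x]
  exact ⟨hy1 n x (Ioo_subset_Icc_self h1), hy3 n x h1⟩

/-- The substitution x = e^ξ reduces to the whole line; the linear bound near 0 is what makes the
time needed to leave 0 infinite. -/
theorem exists_positive_autonomous_solution {G : ℝ → ℝ} {K : ℝ} (hG : ContinuousOn G (Ioi 0))
    (hpos : ∀ x, 0 < x → 0 < G x) (hK : ∀ x, 0 < x → x ≤ 1 → G x ≤ K * x) :
    ∃ x : ℝ → ℝ, (∀ t, 0 < x t) ∧ Tendsto x atBot (𝓝 0) ∧
      (((∀ t, HasDerivAt x (G (x t)) t) ∧ Tendsto x atTop atTop) ∨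
      ∃ T, (∀ t < T, HasDerivAt x (G (x t)) t) ∧ Tendsto x (𝓝[<] T) atTop) := by
  have hc : Continuous fun ξ => G (Real.exp ξ) / Real.exp ξ := by
    refine Continuous.div ?_ Real.continuous_exp fun ξ => (Real.exp_pos ξ).ne'
    exact hG.comp_continuous Real.continuous_exp fun ξ => Real.exp_pos ξ
  have hd : ∀ (ξ : ℝ → ℝ) (t : ℝ), HasDerivAt ξ (G (Real.exp (ξ t)) / Real.exp (ξ t)) t →
      HasDerivAt (fun t => Real.exp (ξ t)) (G (Real.exp (ξ t))) t := fun ξ t h => by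
    refine h.exp.congr_deriv ?_
    rw [mul_div_cancel₀ _ (Real.exp_pos _).ne']
  obtain ⟨ξ, h1, h2⟩ := exists_autonomous_solution (K := K) hc
    (fun ξ => div_pos (hpos _ (Real.exp_pos ξ)) (Real.exp_pos ξ)) (fun ξ hξ => by
      rw [div_le_iff₀ (Real.exp_pos ξ)]
      exact hK _ (Real.exp_pos ξ) (Real.exp_le_one_iff.2 hξ))
  refine ⟨fun t => Real.exp (ξ t), fun t => Real.exp_pos _, Real.tendsto_exp_atBot.comp h1, ?_⟩
  rcases h2 with ⟨h2, h3⟩ | ⟨T, h2, h3⟩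
  · exact Or.inl ⟨fun t => hd ξ t (h2 t), Real.tendsto_exp_atTop.comp h3⟩
  · exact Or.inr ⟨T, fun t ht => hd ξ t (h2 t ht), Real.tendsto_exp_atTop.comp h3⟩

theorem exists_global_positive_autonomous_solution {G : ℝ → ℝ} {K : ℝ}
    (hG : ContinuousOn G (Ioi 0)) (hpos : ∀ x, 0 < x → 0 < G x) (hK : ∀ x, 0 < x → G x ≤ K * x) :
    ∃ x : ℝ → ℝ, (∀ t, 0 < x t) ∧ Tendsto x atBot (𝓝 0) ∧
      (∀ t, HasDerivAt x (G (x t)) t) ∧ Tendsto x atTop atTop := by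
  have hc : Continuous fun ξ => G (Real.exp ξ) / Real.exp ξ := by
    refine Continuous.div ?_ Real.continuous_exp fun ξ => (Real.exp_pos ξ).ne'
    exact hG.comp_continuous Real.continuous_exp fun ξ => Real.exp_pos ξ
  obtain ⟨ξ, h1, h2, h3⟩ := exists_global_autonomous_solution (K := K) hc
    (fun ξ => div_pos (hpos _ (Real.exp_pos ξ)) (Real.exp_pos ξ)) (fun ξ => by
      rw [div_le_iff₀ (Real.exp_pos ξ)]
      exact hK _ (Real.exp_pos ξ))
  refine ⟨fun t => Real.exp (ξ t), fun t => Real.exp_pos _, Real.tendsto_exp_atBot.comp h1,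
    fun t => ?_, Real.tendsto_exp_atTop.comp h3⟩
  refine (h2 t).exp.congr_deriv ?_
  rw [mul_div_cancel₀ _ (Real.exp_pos _).ne']

/-! ### The unstable manifold of the equilibrium `(1, 1)` -/

theorem one_le_exp_ratio {ς A B : ℝ} (hς : ς = 1 ∨ ς = -1) (hB : 0 < B) (hAB : B ≤ A) :
    1 ≤ (Real.exp (ς * A) - 1) / (Real.exp (ς * B) - 1) := by
  rcases hς with rfl | rfl
  · have h1 : 1 < Real.exp (1 * B) := Real.one_lt_exp_iff.2 (by linarith)
    rw [one_le_div (by linarith)]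
    have := Real.exp_le_exp.2 (show 1 * B ≤ 1 * A by linarith)
    linarith
  · have h1 : Real.exp (-1 * B) < 1 := Real.exp_lt_one_iff.2 (by linarith)
    rw [← neg_div_neg_eq, one_le_div (by linarith)]
    have := Real.exp_le_exp.2 (show -1 * A ≤ -1 * B by linarith)
    linarith

theorem sign_mul_exp_sub_one_pos {ς B : ℝ} (hς : ς = 1 ∨ ς = -1) (hB : 0 < B) :
    0 < ς * (Real.exp (ς * B) - 1) := by
  rcases hς with rfl | rfl
  · have h1 : 1 < Real.exp (1 * B) := Real.one_lt_exp_iff.2 (by linarith)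
    linarith
  · have h1 : Real.exp (-1 * B) < 1 := Real.exp_lt_one_iff.2 (by linarith)
    linarith

/-- With v = e^{ςx} and Z = e^{ςy}, the sign ς selects the branch and both branches have slope
equations on x > 0. The line y = qx is a supersolution because the slope vanishes on it, and y = μx
is a subsolution by `one_le_exp_ratio`. -/
theorem exists_unstable_graph (ha : Admissible β κ m q) {ς : ℝ} (hς : ς = 1 ∨ ς = -1) :
    ∃ y : ℝ → ℝ, ∀ x, 0 < x → 0 < m * y x - x ∧ y x ≤ q * x ∧
      HasDerivAt y (κ / β * ((Real.exp (ς * (q * x - y x)) - 1) /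
        (Real.exp (ς * (m * y x - x)) - 1))) x := by
  have hβ := ha.β_pos
  have hm := ha.m_pos
  have hκ := ha.κ_pos
  have hqm := ha.one_lt
  -- The second entry makes the numerator exponent at least the denominator exponent on y = μx, so
  -- the slope is at least κ/β ≥ μ. Both entries exceed 1/m, so the denominator does not vanish.
  set μ := min (κ / β) ((q + 1) / (1 + m)) with hμ
  have hμ1 : 1 < m * μ := by
    have h1 : 1 / m < κ / β := by
      rw [div_lt_div_iff₀ hm hβ]; linarith [ha.lt_mul]
    have h2 : 1 / m < (q + 1) / (1 + m) := by
      rw [div_lt_div_iff₀ hm (by linarith)]; linarith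
    have := lt_min h1 h2
    rw [div_lt_iff₀ hm] at this
    linarith
  have hμκ : μ ≤ κ / β := min_le_left _ _
  have hμq : m * μ - 1 ≤ q - μ := by
    have h1 : μ ≤ (q + 1) / (1 + m) := min_le_right _ _
    rw [le_div_iff₀ (by linarith)] at h1
    linarith
  have hden : ∀ x, 0 < x → ∀ y ∈ Icc (μ * x) (q * x), 0 < m * y - x := fun x hx y hy => by
    have h1 := mul_le_mul_of_nonneg_left hy.1 hm.le
    have h2 := mul_lt_mul_of_pos_right hμ1 hx
    linarith
  have hden' : ∀ x, 0 < x → ∀ y ∈ Icc (μ * x) (q * x), Real.exp (ς * (m * y - x)) - 1 ≠ 0 :=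
    fun x hx y hy => by
      have := sign_mul_exp_sub_one_pos hς (hden x hx y hy)
      exact right_ne_zero_of_mul this.ne'
  obtain ⟨y, hy⟩ := exists_solution_between_Ioi
    (F := fun x y => κ / β * ((Real.exp (ς * (q * x - y)) - 1) / (Real.exp (ς * (m * y - x)) - 1)))
    (F' := fun x y => κ / β * ((-ς * Real.exp (ς * (q * x - y)) *
      (Real.exp (ς * (m * y - x)) - 1) - (Real.exp (ς * (q * x - y)) - 1) *
        (ς * m * Real.exp (ς * (m * y - x)))) / (Real.exp (ς * (m * y - x)) - 1) ^ 2))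
    (b₁ := fun x => μ * x) (b₂ := fun x => q * x) (b₁' := fun _ => μ) (b₂' := fun _ => q)
    (fun x hx => mul_le_mul_of_nonneg_right (by linarith) hx.le)
    (by
      refine continuousOn_const.mul (ContinuousOn.div (Continuous.continuousOn (by fun_prop))
        (Continuous.continuousOn (by fun_prop)) ?_)
      rintro ⟨x, y⟩ ⟨hx, hy⟩
      exact hden' x hx y hy)
    (by
      refine continuousOn_const.mul (ContinuousOn.div (Continuous.continuousOn (by fun_prop))
        (Continuous.continuousOn (by fun_prop)) ?_)
      rintro ⟨x, y⟩ ⟨hx, hy⟩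
      exact pow_ne_zero 2 (hden' x hx y hy))
    (fun x hx y hy => by
      have h1 : HasDerivAt (fun y => Real.exp (ς * (q * x - y)) - 1)
          (-ς * Real.exp (ς * (q * x - y))) y := by
        refine ((((hasDerivAt_id y).const_sub (q * x)).const_mul ς).exp.sub_const 1).congr_deriv ?_
        simp only [id]; ring
      have h2 : HasDerivAt (fun y => Real.exp (ς * (m * y - x)) - 1)
          (ς * m * Real.exp (ς * (m * y - x))) y := by
        refine (((((hasDerivAt_id y).const_mul m).sub_const x).const_mul ς).exp.sub_const
          1).congr_deriv ?_
        simp only [id]; ring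
      exact (h1.div h2 (hden' x hx y hy)).const_mul (κ / β))
    (fun x => by simpa using (hasDerivAt_id x).const_mul μ)
    (fun x => by simpa using (hasDerivAt_id x).const_mul q)
    (fun x hx => by
      have h1 := one_le_exp_ratio (A := q * x - μ * x) (B := m * (μ * x) - x) hς
        (by have := mul_lt_mul_of_pos_right hμ1 hx; linarith)
        (by have := mul_le_mul_of_nonneg_right hμq hx.le; linarith)
      have h2 : 0 ≤ κ / β := by positivity
      have h3 := mul_le_mul_of_nonneg_left h1 h2
      linarith)
    (fun x _ => by simpa using ha.q_pos.le)
  exact ⟨y, fun x hx => ⟨hden x hx _ (hy x hx).1, (hy x hx).1.2, (hy x hx).2⟩⟩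

theorem isOrbit_of_unstable_graph (ha : Admissible β κ m q) {ς : ℝ} (hς : ς = 1 ∨ ς = -1)
    {x y : ℝ → ℝ} (hx0 : ∀ t, 0 < x t)
    (hy : ∀ x, 0 < x → 0 < m * y x - x ∧ y x ≤ q * x ∧
      HasDerivAt y (κ / β * ((Real.exp (ς * (q * x - y x)) - 1) /
        (Real.exp (ς * (m * y x - x)) - 1))) x)
    (hx : ∀ t ∈ J, HasDerivAt x (ς * (β * (Real.exp (ς * (m * y (x t) - x t)) - 1))) t) :
    IsOrbit β κ m q (-1) J (fun t => Real.exp (ς * x t)) (fun t => Real.exp (ς * y (x t))) := by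
  have hβ := ha.β_pos
  have hm := ha.m_pos
  have hςς : ς * ς = 1 := by rcases hς with rfl | rfl <;> norm_num
  refine ⟨fun t _ => Real.exp_pos _, fun t ht => ?_, fun t ht => ?_⟩
  · refine ((hx t ht).const_mul ς).exp.congr_deriv ?_
    rw [spow_of_nonneg hm (Real.exp_pos _).le, ← Real.exp_mul]
    have h1 : Real.exp (ς * y (x t) * m) =
        Real.exp (ς * x t) * Real.exp (ς * (m * y (x t) - x t)) := by
      rw [← Real.exp_add]; congr 1; ring
    rw [h1]
    linear_combination (β * Real.exp (ς * x t) * (Real.exp (ς * (m * y (x t) - x t)) - 1)) * hςς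
  · obtain ⟨h1, -, h2⟩ := hy (x t) (hx0 t)
    refine (((h2.comp t (hx t ht)).const_mul ς).exp).congr_deriv ?_
    have h3 : Real.exp (ς * (m * y (x t) - x t)) - 1 ≠ 0 :=
      right_ne_zero_of_mul (sign_mul_exp_sub_one_pos hς h1).ne'
    have h4 : Real.exp (ς * x t) ^ q =
        Real.exp (ς * y (x t)) * Real.exp (ς * (q * x t - y (x t))) := by
      rw [← Real.exp_mul, ← Real.exp_add]; congr 1; ring
    rw [h4]
    have h5 : κ / β * ((Real.exp (ς * (q * x t - y (x t))) - 1) /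
        (Real.exp (ς * (m * y (x t) - x t)) - 1)) *
          (ς * (β * (Real.exp (ς * (m * y (x t) - x t)) - 1))) =
        ς * (κ * (Real.exp (ς * (q * x t - y (x t))) - 1)) := by
      generalize Real.exp (ς * (m * y (x t) - x t)) = E at h3
      field_simp
    rw [h5]
    simp only [Function.comp]
    linear_combination (κ * Real.exp (ς * y (x t)) *
      (Real.exp (ς * (q * x t - y (x t))) - 1)) * hςς

theorem continuousOn_time_field {ς : ℝ} {y : ℝ → ℝ} (hy : ContinuousOn y (Ioi 0)) (β m : ℝ) :
    ContinuousOn (fun x => ς * (β * (Real.exp (ς * (m * y x - x)) - 1))) (Ioi 0) := by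
  fun_prop

/-- On the branch ς = -1 the time field is at most linear in x, so the orbit exists for all time. -/
theorem exists_global_orbit (ha : Admissible β κ m q) :
    ∃ v Z : ℝ → ℝ, IsOrbit β κ m q (-1) univ v Z ∧ ∀ t, v t < 1 := by
  have hβ := ha.β_pos
  have hm := ha.m_pos
  obtain ⟨y, hy⟩ := exists_unstable_graph ha (ς := -1) (Or.inr rfl)
  have hyc : ContinuousOn y (Ioi 0) := fun x hx => (hy x hx).2.2.continuousAt.continuousWithinAt
  obtain ⟨x, hx0, -, hx1, -⟩ := exists_global_positive_autonomous_solution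
    (K := β * (m * q - 1)) (continuousOn_time_field (ς := -1) hyc β m)
    (fun x hx => by
      have := mul_pos hβ (sign_mul_exp_sub_one_pos (Or.inr rfl) (hy x hx).1)
      linarith)
    (fun x hx => by
      have h1 := Real.add_one_le_exp (-1 * (m * y x - x))
      have h2 := mul_le_mul_of_nonneg_left (hy x hx).2.1 hm.le
      have h3 : β * (1 - Real.exp (-1 * (m * y x - x))) ≤ β * ((m * q - 1) * x) :=
        mul_le_mul_of_nonneg_left (by linarith) hβ.le
      linarith)
  refine ⟨_, _, isOrbit_of_unstable_graph ha (Or.inr rfl) hx0 hy (fun t _ => hx1 t), fun t => ?_⟩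
  exact Real.exp_lt_one_iff.2 (by linarith [hx0 t])

/-- On the branch ς = 1 the linear bound is available only near 0. Existence for all later time is
excluded because the orbit lies in the expanding region v > 1, Z^m > v. -/
theorem exists_interior_blowup_orbit (ha : Admissible β κ m q) :
    ∃ (T : ℝ) (v Z : ℝ → ℝ), IsOrbit β κ m q (-1) (Iio T) v Z ∧ (∀ t, 0 < Z t) ∧
      Tendsto v atBot (𝓝 1) ∧ Tendsto v (𝓝[<] T) atTop := by
  have hβ := ha.β_pos
  have hm := ha.m_pos
  have hqm := ha.one_lt
  obtain ⟨y, hy⟩ := exists_unstable_graph ha (ς := 1) (Or.inl rfl)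
  have hyc : ContinuousOn y (Ioi 0) := fun x hx => (hy x hx).2.2.continuousAt.continuousWithinAt
  obtain ⟨x, hx0, hx1, hx2⟩ := exists_positive_autonomous_solution
    (K := β * ((m * q - 1) * Real.exp (m * q - 1)))
    (continuousOn_time_field (ς := 1) hyc β m)
    (fun x hx => by
      have := mul_pos hβ (sign_mul_exp_sub_one_pos (Or.inl rfl) (hy x hx).1)
      linarith)
    (fun x hx hx1 => by
      set B := m * y x - x with hB
      have hB0 : 0 < B := (hy x hx).1
      have h2 := mul_le_mul_of_nonneg_left (hy x hx).2.1 hm.le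
      have hBx : B ≤ (m * q - 1) * x := by linarith
      have hB1 : B ≤ m * q - 1 := hBx.trans (by nlinarith)
      have h3 : Real.exp B - 1 ≤ B * Real.exp B := by
        have h4 := mul_le_mul_of_nonneg_right (Real.add_one_le_exp (-B)) (Real.exp_pos B).le
        rw [← Real.exp_add, neg_add_cancel, Real.exp_zero] at h4
        linarith
      have h5 : B * Real.exp B ≤ (m * q - 1) * x * Real.exp (m * q - 1) :=
        mul_le_mul hBx (Real.exp_le_exp.2 hB1) (Real.exp_pos _).le (by nlinarith)
      rw [one_mul, one_mul]
      calc β * (Real.exp B - 1) ≤ β * ((m * q - 1) * x * Real.exp (m * q - 1)) :=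
            mul_le_mul_of_nonneg_left (h3.trans h5) hβ.le
        _ = _ := by ring)
  rcases hx2 with ⟨hx2, -⟩ | ⟨T, hx2, hx3⟩
  · exfalso
    have ho := isOrbit_of_unstable_graph (J := univ) ha (Or.inl rfl) hx0 hy (fun t _ => hx2 t)
    refine (ho.mono (subset_univ (Ici 0))).false_of_expanding ha ?_ ?_
    · exact Real.one_lt_exp_iff.2 (by linarith [hx0 0])
    · rw [spow_of_nonneg hm (Real.exp_pos _).le, ← Real.exp_mul, Real.exp_le_exp]
      linarith [(hy (x 0) (hx0 0)).1]
  · refine ⟨T, _, _, isOrbit_of_unstable_graph ha (Or.inl rfl) hx0 hy (fun t ht => hx2 t ht),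
      fun t => Real.exp_pos _, ?_, ?_⟩
    · have := (hx1.const_mul 1).rexp
      simpa using this
    · simpa using hx3

/-! ### The stable manifold of the equilibrium `(1, 1)` -/

/-- Near 0 this is Bernoulli's inequality, or monotonicity in the exponent when α ≤ 1; for large x
the exponential beats the power. -/
theorem exists_one_sub_spow_le {α : ℝ} (hα : 0 < α) :
    ∃ A, 0 < A ∧ ∀ x, 0 < x → 1 - spow α (1 - x) ≤ A * x * Real.exp (A * x) := by
  refine ⟨α + 2, by linarith, fun x hx => ?_⟩
  have hE : 1 ≤ Real.exp ((α + 2) * x) := Real.one_le_exp (by positivity)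
  rcases le_total x 1 with h1 | h1
  · have h2 : 1 - (α + 1) * x ≤ spow α (1 - x) := by
      rw [spow_of_nonneg hα (by linarith)]
      rcases le_total α 1 with h | h
      · rcases h1.eq_or_lt with rfl | h1
        · rw [sub_self, Real.zero_rpow hα.ne']; linarith
        · have := Real.rpow_le_rpow_of_exponent_ge (show 0 < 1 - x by linarith) (by linarith) h
          rw [Real.rpow_one] at this
          nlinarith
      · have := one_add_mul_self_le_rpow_one_add (s := -x) (by linarith) h
        rw [← sub_eq_add_neg] at this
        nlinarith
    have h3 : (α + 2) * x * 1 ≤ (α + 2) * x * Real.exp ((α + 2) * x) :=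
      mul_le_mul_of_nonneg_left hE (by positivity)
    nlinarith
  · have h2 : spow α (1 - x) = -(x - 1) ^ α := by
      have := spow_neg α (x - 1)
      rwa [neg_sub, spow_of_nonneg (x := x - 1) hα (by linarith)] at this
    have h3 : (x - 1) ^ α ≤ Real.exp ((α + 2) * x) := by
      calc (x - 1) ^ α ≤ Real.exp x ^ α :=
            Real.rpow_le_rpow (by linarith) (by linarith [Real.add_one_le_exp x]) hα.le
        _ = Real.exp (x * α) := (Real.exp_mul _ _).symm
        _ ≤ _ := Real.exp_le_exp.2 (by nlinarith)
    rw [h2]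
    have h4 : 2 * Real.exp ((α + 2) * x) ≤ (α + 2) * x * Real.exp ((α + 2) * x) :=
      mul_le_mul_of_nonneg_right (by nlinarith) (Real.exp_pos _).le
    linarith

/-- A single equation serves both stable branches in reversed time: one unknown is 1 - x and the
other is y, and the two branches differ by exchanging the roles of v and Z. The barriers are 1 and
e^{Bx}; the odd power is needed once 1 - x turns negative. -/
theorem exists_stable_graph {c α δ : ℝ} (hc : 0 < c) (hα : 0 < α) (hδ : 0 < δ) :
    ∃ (B : ℝ) (y : ℝ → ℝ), 0 < B ∧ ∀ x, 0 < x → 1 ≤ y x ∧ y x ≤ Real.exp (B * x) ∧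
      HasDerivAt y (c * ((y x - spow α (1 - x)) / (y x ^ δ - 1 + x))) x := by
  obtain ⟨A, hA, hAx⟩ := exists_one_sub_spow_le hα
  -- B ≥ A bounds the numerator on the upper barrier by 2Bx e^{Bx}, the denominator is at least Bδx,
  -- and 2c ≤ Bδ closes the estimate.
  set B := max A (2 * c / δ) with hB
  have hBA : A ≤ B := le_max_left _ _
  have hB0 : 0 < B := hA.trans_le hBA
  have hBc : 2 * c ≤ B * δ := by
    have : 2 * c / δ ≤ B := le_max_right _ _
    rwa [div_le_iff₀ hδ] at this
  have hden : ∀ x : ℝ, 0 < x → ∀ y : ℝ, 1 ≤ y → 0 < y ^ δ - 1 + x := fun x hx y hy => by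
    have := Real.one_le_rpow hy hδ.le
    linarith
  have hrpow : ContinuousOn (fun z : ℝ × ℝ => z.2 ^ δ)
      {z : ℝ × ℝ | 0 < z.1 ∧ z.2 ∈ Icc 1 (Real.exp (B * z.1))} :=
    continuousOn_snd.rpow_const fun z _ => Or.inr hδ.le
  have hrpow' : ContinuousOn (fun z : ℝ × ℝ => z.2 ^ (δ - 1))
      {z : ℝ × ℝ | 0 < z.1 ∧ z.2 ∈ Icc 1 (Real.exp (B * z.1))} :=
    continuousOn_snd.rpow_const fun z hz => Or.inl (by linarith [hz.2.1])
  have hsp : Continuous fun z : ℝ × ℝ => spow α (1 - z.1) :=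
    (continuous_spow hα).comp (by fun_prop)
  obtain ⟨y, hy⟩ := exists_solution_between_Ioi
    (F := fun x y => c * ((y - spow α (1 - x)) / (y ^ δ - 1 + x)))
    (F' := fun x y => c * ((1 * (y ^ δ - 1 + x) - (y - spow α (1 - x)) * (δ * y ^ (δ - 1))) /
      (y ^ δ - 1 + x) ^ 2))
    (b₁ := fun _ => 1) (b₂ := fun x => Real.exp (B * x)) (b₁' := fun _ => 0)
    (b₂' := fun x => B * Real.exp (B * x))
    (fun x hx => Real.one_le_exp (by positivity))
    (by
      refine continuousOn_const.mul (ContinuousOn.div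
        (continuousOn_snd.sub hsp.continuousOn)
        ((hrpow.sub continuousOn_const).add continuousOn_fst) ?_)
      rintro ⟨x, y⟩ ⟨hx, hy⟩
      exact (hden x hx y hy.1).ne')
    (by
      refine continuousOn_const.mul (ContinuousOn.div
        ((continuousOn_const.mul ((hrpow.sub continuousOn_const).add continuousOn_fst)).sub
          ((continuousOn_snd.sub hsp.continuousOn).mul (continuousOn_const.mul hrpow')))
        (((hrpow.sub continuousOn_const).add continuousOn_fst).pow 2) ?_)
      rintro ⟨x, y⟩ ⟨hx, hy⟩
      exact pow_ne_zero 2 (hden x hx y hy.1).ne')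
    (fun x hx y hy => by
      have h1 : HasDerivAt (fun y => y - spow α (1 - x)) 1 y := (hasDerivAt_id y).sub_const _
      have h2 : HasDerivAt (fun y : ℝ => y ^ δ - 1 + x) (δ * y ^ (δ - 1)) y :=
        ((Real.hasDerivAt_rpow_const (Or.inl (by linarith [hy.1]))).sub_const 1).add_const x
      exact (h1.div h2 (hden x hx y hy.1).ne').const_mul c)
    (fun x => hasDerivAt_const x 1) (fun x => hasDerivAt_exp_mul_const B x)
    (fun x hx => by
      have h1 : spow α (1 - x) ≤ 1 := by
        rw [← spow_one hα, spow_one hα]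
        have := (spow_strictMono hα).monotone (show 1 - x ≤ 1 by linarith)
        rwa [spow_one hα] at this
      have h2 := hden x hx 1 le_rfl
      exact mul_nonneg hc.le (div_nonneg (by linarith) h2.le))
    (fun x hx => by
      have hE : 1 ≤ Real.exp (B * x) := Real.one_le_exp (by positivity)
      have hd := hden x hx _ hE
      rw [← mul_div_assoc, div_le_iff₀ hd]
      have h1 : Real.exp (B * x) - 1 ≤ B * x * Real.exp (B * x) := by
        have h4 := mul_le_mul_of_nonneg_right (Real.add_one_le_exp (-(B * x)))
          (Real.exp_pos (B * x)).le
        rw [← Real.exp_add, neg_add_cancel, Real.exp_zero] at h4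
        linarith
      have h2 : 1 - spow α (1 - x) ≤ B * x * Real.exp (B * x) :=
        (hAx x hx).trans (mul_le_mul (mul_le_mul_of_nonneg_right hBA hx.le)
          (Real.exp_le_exp.2 (mul_le_mul_of_nonneg_right hBA hx.le)) (Real.exp_pos _).le
          (by positivity))
      have h3 : B * δ * x ≤ Real.exp (B * x) ^ δ - 1 + x := by
        rw [← Real.exp_mul]
        have := Real.add_one_le_exp (B * x * δ)
        linarith
      calc c * (Real.exp (B * x) - spow α (1 - x)) ≤ c * (2 * (B * x * Real.exp (B * x))) :=
            mul_le_mul_of_nonneg_left (by linarith) hc.le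
        _ = 2 * c * (B * x * Real.exp (B * x)) := by ring
        _ ≤ B * δ * (B * x * Real.exp (B * x)) :=
            mul_le_mul_of_nonneg_right hBc (by positivity)
        _ = B * Real.exp (B * x) * (B * δ * x) := by ring
        _ ≤ _ := mul_le_mul_of_nonneg_left h3 (by positivity))
  exact ⟨B, y, hB0, fun x hx => ⟨(hy x hx).1.1, (hy x hx).1.2, (hy x hx).2⟩⟩

/-- The time field along the stable manifold. -/
theorem stable_time_field {B k δ : ℝ} {y : ℝ → ℝ} (hk : 0 < k) (hB : 0 < B) (hδ : 0 < δ)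
    (hyc : ContinuousOn y (Ioi 0)) (hy : ∀ x, 0 < x → 1 ≤ y x ∧ y x ≤ Real.exp (B * x)) :
    ContinuousOn (fun x => k * (y x ^ δ - 1 + x)) (Ioi 0) ∧
    (∀ x, 0 < x → 0 < k * (y x ^ δ - 1 + x)) ∧
    ∀ x, 0 < x → x ≤ 1 → k * (y x ^ δ - 1 + x) ≤ k * (B * δ * Real.exp (B * δ) + 1) * x := by
  refine ⟨?_, fun x hx => ?_, fun x hx hx1 => ?_⟩
  · exact continuousOn_const.mul (((hyc.rpow_const fun x _ => Or.inr hδ.le).sub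
      continuousOn_const).add continuousOn_id)
  · have := Real.one_le_rpow (hy x hx).1 hδ.le
    exact mul_pos hk (by linarith)
  · have h0 : y x ^ δ ≤ Real.exp (B * x * δ) := by
      rw [Real.exp_mul]
      exact Real.rpow_le_rpow (by linarith [(hy x hx).1]) (hy x hx).2 hδ.le
    have h1 : Real.exp (B * x * δ) - 1 ≤ B * x * δ * Real.exp (B * x * δ) := by
      have h4 := mul_le_mul_of_nonneg_right (Real.add_one_le_exp (-(B * x * δ)))
        (Real.exp_pos (B * x * δ)).le
      rw [← Real.exp_add, neg_add_cancel, Real.exp_zero] at h4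
      linarith
    have h2 : B * x * δ * Real.exp (B * x * δ) ≤ B * x * δ * Real.exp (B * δ) := by
      refine mul_le_mul_of_nonneg_left (Real.exp_le_exp.2 ?_) (by positivity)
      have := mul_le_mul_of_nonneg_left hx1 (show 0 ≤ B * δ by positivity)
      linarith
    rw [mul_assoc k]
    exact mul_le_mul_of_nonneg_left (by linarith) hk.le

theorem tendsto_one_of_exp_bound {B : ℝ} {x y : ℝ → ℝ} (hx0 : ∀ t, 0 < x t)
    (hx : Tendsto x atBot (𝓝 0)) (hy : ∀ x, 0 < x → 1 ≤ y x ∧ y x ≤ Real.exp (B * x)) :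
    Tendsto (fun t => y (x t)) atBot (𝓝 1) := by
  have h1 : Tendsto (fun t => Real.exp (B * x t)) atBot (𝓝 1) := by
    have := (hx.const_mul B).rexp
    simpa using this
  exact tendsto_of_tendsto_of_tendsto_of_le_of_le tendsto_const_nhds h1
    (fun t => (hy _ (hx0 t)).1) (fun t => (hy _ (hx0 t)).2)

/-- Here v = 1 - x and Z = y in reversed time; the orbit is cut at the time T where x = 1, that is,
where v vanishes. -/
theorem exists_exterior_zero_orbit (ha : Admissible β κ m q) :
    ∃ (T : ℝ) (v Z : ℝ → ℝ), IsOrbit β κ m q (-1) (Ioi T) v Z ∧ (∀ t ∈ Ioi T, 0 < Z t) ∧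
      Tendsto v atTop (𝓝 1) ∧ Tendsto v (𝓝[>] T) (𝓝 0) := by
  have hβ := ha.β_pos
  have hm := ha.m_pos
  have hκ := ha.κ_pos
  have hq := ha.q_pos
  obtain ⟨B, y, hB, hy⟩ := exists_stable_graph (c := κ / β) (α := q) (δ := m) (by positivity) hq hm
  have hyc : ContinuousOn y (Ioi 0) := fun x hx => (hy x hx).2.2.continuousAt.continuousWithinAt
  have hy' : ∀ x, 0 < x → 1 ≤ y x ∧ y x ≤ Real.exp (B * x) := fun x hx =>
    ⟨(hy x hx).1, (hy x hx).2.1⟩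
  obtain ⟨hG1, hG2, hG3⟩ := stable_time_field (k := β) hβ hB hm hyc hy'
  obtain ⟨x, hx0, hxbot, hx⟩ := exists_positive_autonomous_solution hG1 hG2 hG3
  obtain ⟨T, hT, hTx⟩ : ∃ T, (∀ t ≤ T, HasDerivAt x (β * (y (x t) ^ m - 1 + x t)) t) ∧
      x T = 1 := by
    rcases hx with ⟨hx, htop⟩ | ⟨T, hx, htop⟩
    · have hc : Continuous x := continuous_iff_continuousAt.2 fun t => (hx t).continuousAt
      obtain ⟨s, hs⟩ := (hxbot.eventually (gt_mem_nhds one_pos)).exists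
      obtain ⟨t, ht⟩ := (htop.eventually (eventually_ge_atTop 1)).exists
      obtain ⟨T, hT⟩ := mem_range_of_exists_le_of_exists_ge hc ⟨s, hs.le⟩ ⟨t, ht⟩
      exact ⟨T, fun t _ => hx t, hT⟩
    · obtain ⟨t, ht, htT⟩ := ((htop.eventually (eventually_ge_atTop 1)).and
        self_mem_nhdsWithin).exists
      have htT : t < T := htT
      obtain ⟨s, hs, hst⟩ := ((hxbot.eventually (gt_mem_nhds one_pos)).and
        (eventually_le_atBot t)).exists
      have hc : ContinuousOn x (Icc s t) := fun u hu =>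
        (hx u (hu.2.trans_lt htT)).continuousAt.continuousWithinAt
      obtain ⟨T', hT', hxT'⟩ := intermediate_value_Icc hst hc ⟨hs.le, ht⟩
      exact ⟨T', fun u hu => hx u (hu.trans_lt (hT'.2.trans_lt htT)), hxT'⟩
  have hlt : ∀ t < T, x t < 1 := by
    intro t ht
    rw [← hTx]
    refine strictMonoOn_of_deriv_pos (convex_Iic T)
      (fun u hu => (hT u hu).continuousAt.continuousWithinAt) (fun u hu => ?_) ht.le
      (mem_Iic.2 le_rfl) ht
    have hu' : u ∈ Iic T := interior_subset hu
    rw [(hT u hu').deriv]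
    exact hG2 _ (hx0 u)
  refine ⟨-T, fun t => 1 - x (-t), fun t => y (x (-t)), ⟨fun t ht => ?_, fun t ht => ?_,
    fun t ht => ?_⟩, fun t _ => by linarith [(hy' _ (hx0 (-t))).1], ?_, ?_⟩
  · linarith [hlt (-t) (by linarith [mem_Ioi.1 ht])]
  · have ht' : -t < T := by linarith [mem_Ioi.1 ht]
    refine (((hT (-t) ht'.le).comp t (hasDerivAt_neg t)).const_sub 1).congr_deriv ?_
    rw [spow_of_nonneg hm (by linarith [(hy' _ (hx0 (-t))).1])]
    ring
  · have ht' : -t < T := by linarith [mem_Ioi.1 ht]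
    have h1 := (hT (-t) ht'.le).comp t (hasDerivAt_neg t)
    refine ((hy _ (hx0 (-t))).2.2.comp t h1).congr_deriv ?_
    have h2 := hG2 _ (hx0 (-t))
    have h3 : y (x (-t)) ^ m - 1 + x (-t) ≠ 0 := right_ne_zero_of_mul h2.ne'
    rw [spow_of_nonneg hq (by linarith [hlt _ ht'])]
    field_simp
    ring
  · have := (hxbot.comp tendsto_neg_atTop_atBot).const_sub 1
    simpa using this
  · have h1 : ContinuousAt (fun t => 1 - x (-t)) (-T) := by
      refine ContinuousAt.sub continuousAt_const (ContinuousAt.comp ?_ continuous_neg.continuousAt)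
      rw [neg_neg]
      exact (hT T le_rfl).continuousAt
    have h2 := h1.tendsto.mono_left (nhdsWithin_le_nhds (s := Ioi (-T)))
    simpa [hTx] using h2

/-- Here v = y and Z = 1 - x in reversed time. The orbit has v > 1 and Z^m < v, so it cannot last
for all past time; it remains to see that v itself, and not only Z, becomes unbounded. -/
theorem exists_exterior_blowup_orbit (ha : Admissible β κ m q) :
    ∃ (T : ℝ) (v Z : ℝ → ℝ), IsOrbit β κ m q (-1) (Ioi T) v Z ∧
      Tendsto v atTop (𝓝 1) ∧ Tendsto v (𝓝[>] T) atTop := by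
  have hβ := ha.β_pos
  have hm := ha.m_pos
  have hκ := ha.κ_pos
  have hq := ha.q_pos
  obtain ⟨B, y, hB, hy⟩ := exists_stable_graph (c := β / κ) (α := m) (δ := q) (by positivity) hm hq
  have hyc : ContinuousOn y (Ioi 0) := fun x hx => (hy x hx).2.2.continuousAt.continuousWithinAt
  have hy' : ∀ x, 0 < x → 1 ≤ y x ∧ y x ≤ Real.exp (B * x) := fun x hx =>
    ⟨(hy x hx).1, (hy x hx).2.1⟩
  obtain ⟨hG1, hG2, hG3⟩ := stable_time_field (k := κ) hκ hB hq hyc hy'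
  have hspow : ∀ x, 0 < x → spow m (1 - x) < 1 := fun x hx => by
    have := spow_strictMono hm (show 1 - x < 1 by linarith)
    rwa [spow_one hm] at this
  have hypos : ∀ x, 0 < x → 0 < y x - spow m (1 - x) := fun x hx => by
    linarith [hspow x hx, (hy' x hx).1]
  have hyG : ∀ x, 0 < x → 0 < y x ^ q - 1 + x := fun x hx =>
    pos_of_mul_pos_right (hG2 x hx) hκ.le
  have hymono : StrictMonoOn y (Ioi 0) := by
    refine strictMonoOn_of_deriv_pos (convex_Ioi 0) hyc fun x hx => ?_
    have hx := interior_subset hx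
    rw [(hy x hx).2.2.deriv]
    have := hypos x hx
    have := hyG x hx
    positivity
  have horb : ∀ (x : ℝ → ℝ) (J : Set ℝ), (∀ t, 0 < x t) →
      (∀ t ∈ J, HasDerivAt x (κ * (y (x (-(-t))) ^ q - 1 + x t)) t) →
      IsOrbit β κ m q (-1) (Neg.neg ⁻¹' J) (fun t => y (x (-t))) (fun t => 1 - x (-t)) := by
    intro x J hx0 hx
    refine ⟨fun t _ => by linarith [(hy' _ (hx0 (-t))).1], fun t ht => ?_, fun t ht => ?_⟩
    · have h1 := (hx (-t) ht).comp t (hasDerivAt_neg t)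
      refine ((hy _ (hx0 (-t))).2.2.comp t h1).congr_deriv ?_
      have h3 := (hyG _ (hx0 (-t))).ne'
      rw [neg_neg]
      field_simp
      ring
    · refine (((hx (-t) ht).comp t (hasDerivAt_neg t)).const_sub 1).congr_deriv ?_
      rw [neg_neg]
      ring
  have hfalse : ∀ x : ℝ → ℝ, (∀ t, 0 < x t) →
      (∀ t, HasDerivAt x (κ * (y (x t) ^ q - 1 + x t)) t) → False := by
    intro x hx0 hx
    have ho := horb x univ hx0 (fun t _ => by simpa using hx t)
    refine (ho.mono (J' := Iic 0) (fun _ _ => trivial)).false_of_expanding_backward ha ?_ ?_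
    · have h1 := (hy' (x 0 / 2) (half_pos (hx0 0))).1
      have h2 := hymono (half_pos (hx0 0)) (hx0 0) (half_lt_self (hx0 0))
      simp only [neg_zero]
      linarith
    · have h1 := hspow _ (hx0 0)
      have h2 := (hy' _ (hx0 0)).1
      simp only [neg_zero]
      linarith
  -- If y were bounded, the time field would grow at most linearly in x and the orbit would exist
  -- for all time.
  have hunb : ∀ M, ∃ x, 0 < x ∧ M ≤ y x := by
    by_contra! hbd
    obtain ⟨M, hM⟩ := hbd
    have hM1 : 1 < M := (hy' 1 one_pos).1.trans_lt (hM 1 one_pos)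
    have hMq : 0 < M ^ q := by positivity
    obtain ⟨x, hx0, -, hx, -⟩ := exists_global_positive_autonomous_solution hG1 hG2
      (K := κ * (B * q * Real.exp (B * q) + 1) + κ * (M ^ q + 1)) (fun x hx => by
        have hp1 : 0 < κ * (B * q * Real.exp (B * q) + 1) * x := by positivity
        have hp2 : 0 < κ * (M ^ q + 1) * x := by positivity
        rcases le_total x 1 with h | h
        · have := hG3 x hx h
          linarith
        · have h1 : y x ^ q ≤ M ^ q :=
            Real.rpow_le_rpow (by linarith [(hy' x hx).1]) (hM x hx).le hq.le
          have h2 : κ * (y x ^ q - 1 + x) ≤ κ * ((M ^ q + 1) * x) := by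
            refine mul_le_mul_of_nonneg_left ?_ hκ.le
            nlinarith
          linarith)
    exact hfalse x hx0 hx
  obtain ⟨x, hx0, hxbot, ⟨hx, -⟩ | ⟨T, hx, htop⟩⟩ :=
    exists_positive_autonomous_solution hG1 hG2 hG3
  · exact (hfalse x hx0 hx).elim
  have ho := horb x (Iio T) hx0 (fun t ht => by simpa using hx t ht)
  refine ⟨-T, _, _, ho.mono (fun t ht => ?_), ?_, ?_⟩
  · simp only [mem_preimage, mem_Iio]; linarith [mem_Ioi.1 ht]
  · exact (tendsto_one_of_exp_bound hx0 hxbot hy').comp tendsto_neg_atTop_atBot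
  · have h1 : Tendsto (fun t => y (x t)) (𝓝[<] T) atTop := by
      rw [tendsto_atTop]
      intro M
      obtain ⟨x₁, hx₁, hM⟩ := hunb M
      filter_upwards [htop.eventually (eventually_ge_atTop x₁)] with t ht
      exact hM.trans (hymono.monotoneOn hx₁ (hx0 t) ht)
    have h2 : Tendsto (fun t : ℝ => -t) (𝓝[>] (-T)) (𝓝[<] T) := by
      have := tendsto_neg_nhdsGT_neg (a := T)
      exact this
    exact h1.comp h2

end HardyHenon

namespace HardyHenon

variable {β κ m q ε : ℝ} {J : Set ℝ} {v Z : ℝ → ℝ}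

/-! ### Orbits that behave like `exp (-β t)` at `+∞` -/

/-- With v = e^{-x} and Z = -ε e^{-y}, the slow curve stays at bounded distance from y = qx, trapped
between qx - l and qx + 1. It is started on the upper barrier, a choice used later to show
nonglobality. -/
theorem exists_slow_graph (ha : Admissible β κ m q) (hε : ε = 1 ∨ ε = -1) :
    ∃ (x₀ l : ℝ) (y : ℝ → ℝ), ContinuousOn y (Ici x₀) ∧ y x₀ = q * x₀ + 1 ∧
      (∀ x, x₀ ≤ x → q * x - l ≤ y x ∧ Real.exp (x - m * y x) ≤ 1 / 2) ∧
      ∀ x, x₀ < x → HasDerivAt y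
        (κ / β * ((1 - Real.exp (y x - q * x)) / (1 + ε * Real.exp (x - m * y x)))) x := by
  -- Below, l makes c(1 - e^{-l}) = (c + q)/2 on the lower barrier, η makes this at least q(1 + η),
  -- and x₀ is chosen so that e^{x-my} ≤ η above that barrier.
  have hβ := ha.β_pos
  have hm := ha.m_pos
  have hκ := ha.κ_pos
  have hq := ha.q_pos
  have hmq : 0 < m * q - 1 := by linarith [ha.one_lt]
  have hε1 : -1 ≤ ε ∧ ε ≤ 1 := by rcases hε with rfl | rfl <;> norm_num
  set c := κ / β with hc
  have hcq : q < c := by rw [hc, lt_div_iff₀ hβ]; linarith [ha.mul_lt]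
  have hc0 : 0 < c := hq.trans hcq
  set l := -Real.log ((c - q) / (2 * c)) with hl
  have hl0 : 0 < (c - q) / (2 * c) := div_pos (by linarith) (by linarith)
  have hel : Real.exp (-l) = (c - q) / (2 * c) := by rw [hl, neg_neg, Real.exp_log hl0]
  have hlpos : 0 < l := by
    rw [hl, neg_pos]
    exact Real.log_neg hl0 ((div_lt_one (by linarith)).2 (by linarith))
  set η := min (1 / 2) ((c - q) / (2 * q)) with hη
  have hη0 : 0 < η := lt_min (by norm_num) (div_pos (by linarith) (by linarith))
  have hη1 : η ≤ 1 / 2 := min_le_left _ _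
  have hη2 : q * η ≤ (c - q) / 2 := by
    have : η ≤ (c - q) / (2 * q) := min_le_right _ _
    rw [le_div_iff₀ (by linarith)] at this
    linarith
  set x₀ := (m * l - Real.log η) / (m * q - 1) with hx₀
  have hx₀' : (m * q - 1) * x₀ = m * l - Real.log η := by rw [hx₀]; field_simp
  have hexp : ∀ x, x₀ ≤ x → ∀ y, q * x - l ≤ y → Real.exp (x - m * y) ≤ η := by
    intro x hx y hy
    refine (Real.exp_le_exp.2 (?_ : _ ≤ Real.log η)).trans_eq (Real.exp_log hη0)
    have h1 := mul_le_mul_of_nonneg_left hx hmq.le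
    have h2 := mul_le_mul_of_nonneg_left hy hm.le
    linarith
  have hden : ∀ E : ℝ, 0 < E → E ≤ η → 0 < 1 + ε * E ∧ 1 + ε * E ≤ 1 + η := by
    intro E h1 h2
    constructor <;> nlinarith
  have hden' : ∀ x, x₀ ≤ x → ∀ y, q * x - l ≤ y → 1 + ε * Real.exp (x - m * y) ≠ 0 :=
    fun x hx y hy => (hden _ (Real.exp_pos _) (hexp x hx y hy)).1.ne'
  have hcast : ∀ n : ℕ, (0 : ℝ) < n + 1 := fun n => by positivity
  obtain ⟨y, hy1, hy2, hy3, hy4⟩ := exists_solution_between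
    (F := fun x y => c * ((1 - Real.exp (y - q * x)) / (1 + ε * Real.exp (x - m * y))))
    (F' := fun x y => c * ((-Real.exp (y - q * x) * (1 + ε * Real.exp (x - m * y)) -
      (1 - Real.exp (y - q * x)) * (ε * (-m * Real.exp (x - m * y)))) /
        (1 + ε * Real.exp (x - m * y)) ^ 2))
    (b₁ := fun x => q * x - l) (b₂ := fun x => q * x + 1) (b₁' := fun _ => q) (b₂' := fun _ => q)
    (a := fun _ => x₀) (b := fun n => x₀ + (n + 1))
    (fun _ _ _ => le_rfl) (fun i j hij => by simpa using hij)
    (fun n => by linarith [hcast n]) (fun _ _ _ => by linarith)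
    (fun n => by
      refine continuousOn_const.mul (ContinuousOn.div (Continuous.continuousOn (by fun_prop))
        (Continuous.continuousOn (by fun_prop)) ?_)
      rintro ⟨x, y⟩ ⟨hx, hy⟩
      exact hden' x hx.1 y hy.1)
    (fun n => by
      refine continuousOn_const.mul (ContinuousOn.div (Continuous.continuousOn (by fun_prop))
        (Continuous.continuousOn (by fun_prop)) ?_)
      rintro ⟨x, y⟩ ⟨hx, hy⟩
      exact pow_ne_zero 2 (hden' x hx.1 y hy.1))
    (fun n x hx y hy => by
      have h1 : HasDerivAt (fun y => 1 - Real.exp (y - q * x)) (-Real.exp (y - q * x)) y := by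
        refine (((hasDerivAt_id y).sub_const (q * x)).exp.const_sub 1).congr_deriv ?_
        simp only [id]; ring
      have h2 : HasDerivAt (fun y => 1 + ε * Real.exp (x - m * y))
          (ε * (-m * Real.exp (x - m * y))) y := by
        refine (((((hasDerivAt_id y).const_mul m).const_sub x).exp.const_mul ε).const_add
          1).congr_deriv ?_
        simp only [id]; ring
      exact (h1.div h2 (hden' x hx.1 y hy.1)).const_mul c)
    (fun x => by simpa using ((hasDerivAt_id x).const_mul q).sub_const l)
    (fun x => by simpa using ((hasDerivAt_id x).const_mul q).add_const 1)
    (fun n x hx => by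
      have h1 := hden _ (Real.exp_pos _) (hexp x hx.1.le (q * x - l) le_rfl)
      have h2 : q * x - l - q * x = -l := by ring
      rw [h2, hel, ← mul_div_assoc, le_div_iff₀ h1.1]
      have h3 : c * (1 - (c - q) / (2 * c)) = (c + q) / 2 := by field_simp; ring
      have h4 := mul_le_mul_of_nonneg_left h1.2 hq.le
      linarith)
    (fun n x hx => by
      have h1 := hden _ (Real.exp_pos _) (hexp x hx.1.le (q * x + 1) (by linarith))
      have h2 : q * x + 1 - q * x = 1 := by ring
      rw [h2]
      have h3 : (1 - Real.exp 1) / (1 + ε * Real.exp (x - m * (q * x + 1))) ≤ 0 :=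
        div_nonpos_of_nonpos_of_nonneg (by linarith [Real.add_one_le_exp (1 : ℝ)]) h1.1.le
      nlinarith)
  have hex : ∀ x, ∃ n : ℕ, x < x₀ + (n + 1) := fun x => by
    obtain ⟨n, hn⟩ := exists_nat_gt (x - x₀)
    exact ⟨n, by linarith⟩
  refine ⟨x₀, l, y, fun x hx => ?_, hy4 fun _ => rfl, fun x hx => ?_, fun x hx => ?_⟩
  · obtain ⟨n, hn⟩ := hex x
    refine (hy2 n x ⟨hx, hn.le⟩).mono_of_mem_nhdsWithin ?_
    rw [← Ici_inter_Iic]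
    exact inter_mem self_mem_nhdsWithin (mem_nhdsWithin_of_mem_nhds (Iic_mem_nhds hn))
  · obtain ⟨n, hn⟩ := hex x
    have h1 := (hy1 n x ⟨hx, hn.le⟩).1
    exact ⟨h1, (hexp x hx _ h1).trans hη1⟩
  · obtain ⟨n, hn⟩ := hex x
    exact hy3 n x ⟨hx, hn⟩

/-- The lower barrier gives |Z| ≤ e^l v^q, hence the slow rate. For ε = -1 the orbit starts with Z <
v^q, which no global orbit allows. -/
theorem exists_slow_orbit (ha : Admissible β κ m q) (hε : ε = 1 ∨ ε = -1) :
    ∃ (t₀ c : ℝ) (v Z : ℝ → ℝ), IsOrbit β κ m q ε (Ioi t₀) v Z ∧ (∀ t, Z t ≠ 0) ∧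
      0 < c ∧ Tendsto (fun t => Real.exp (β * t) * v t) atTop (𝓝 c) ∧
      ∀ v' Z' : ℝ → ℝ, IsOrbit β κ m q ε univ v' Z' →
        ¬ ∀ t ∈ Ioi t₀, v' t = v t ∧ Z' t = Z t := by
  have hβ := ha.β_pos
  have hm := ha.m_pos
  obtain ⟨x₀, l, y, hyc, hy0, hyb, hyd⟩ := exists_slow_graph ha hε
  have hε0 : ε ≠ 0 := by rcases hε with rfl | rfl <;> norm_num
  have hε1 : -1 ≤ ε ∧ ε ≤ 1 := by rcases hε with rfl | rfl <;> norm_num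
  have hbd : ∀ x, x₀ ≤ x → 0 < β * (1 + ε * Real.exp (x - m * y x)) ∧
      β * (1 + ε * Real.exp (x - m * y x)) ≤ β * 2 := fun x hx => by
    have h1 := (hyb x hx).2
    have h2 := Real.exp_pos (x - m * y x)
    exact ⟨mul_pos hβ (by nlinarith), mul_le_mul_of_nonneg_left (by nlinarith) hβ.le⟩
  have hcont : ContinuousOn (fun x => β * (1 + ε * Real.exp (x - m * y x))) (Ici x₀) := by
    fun_prop
  -- The field is frozen to the left of x₀ to be defined on the whole line; only times after ξ = x₀
  -- are used.
  obtain ⟨ξ, h1, h2, h3⟩ := exists_global_autonomous_solution (K := β * 2)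
    (hcont.comp_continuous (continuous_id.max continuous_const) fun x => le_max_right x x₀)
    (fun x => (hbd _ (le_max_right x x₀)).1) (fun x => (hbd _ (le_max_right x x₀)).2)
  have hξc : Continuous ξ := continuous_iff_continuousAt.2 fun t => (h2 t).continuousAt
  have hξm : StrictMono ξ := strictMono_of_deriv_pos fun t => by
    rw [(h2 t).deriv]; exact (hbd _ (le_max_right _ x₀)).1
  have hsurj : Function.Surjective ξ := hξc.surjective h3 h1
  obtain ⟨t₀, ht₀⟩ := hsurj x₀
  have hgt : ∀ t, t₀ < t → x₀ < ξ t := fun t ht => ht₀ ▸ hξm ht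
  have hξ : ∀ t, t₀ < t → HasDerivAt ξ (β * (1 + ε * Real.exp (ξ t - m * y (ξ t)))) t :=
    fun t ht => by
      have h5 := h2 t
      simp only [Function.comp, id, max_eq_left (hgt t ht).le] at h5
      exact h5
  have ho : IsOrbit β κ m q ε (Ioi t₀) (fun t => Real.exp (-ξ t))
      (fun t => -ε * Real.exp (-y (ξ t))) := by
    refine ⟨fun t _ => Real.exp_pos _, fun t ht => ?_, fun t ht => ?_⟩
    · refine (hξ t ht).neg.exp.congr_deriv ?_
      have h4 : spow m (-ε * Real.exp (-y (ξ t))) =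
          -ε * (Real.exp (-ξ t) * Real.exp (ξ t - m * y (ξ t))) := by
        have h5 : Real.exp (-y (ξ t)) ^ m =
            Real.exp (-ξ t) * Real.exp (ξ t - m * y (ξ t)) := by
          rw [← Real.exp_mul, ← Real.exp_add]; congr 1; ring
        rw [← h5]
        rcases hε with rfl | rfl
        · rw [neg_one_mul, spow_neg, spow_of_nonneg hm (Real.exp_pos _).le, neg_one_mul]
        · rw [neg_neg, one_mul, one_mul, spow_of_nonneg hm (Real.exp_pos _).le]
      rw [h4]
      simp only [Pi.neg_apply]
      ring
    · refine ((((hyd _ (hgt t ht)).comp t (hξ t ht)).neg.exp).const_mul (-ε)).congr_deriv ?_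
      have h4 := right_ne_zero_of_mul (hbd (ξ t) (hgt t ht).le).1.ne'
      have h5 : Real.exp (-ξ t) ^ q =
          Real.exp (-y (ξ t)) * Real.exp (y (ξ t) - q * ξ t) := by
        rw [← Real.exp_mul, ← Real.exp_add]; congr 1; ring
      rw [h5]
      generalize Real.exp (ξ t - m * y (ξ t)) = E at h4
      simp only [Function.comp, Pi.neg_apply]
      field_simp
      ring
  have hv0 : Tendsto (fun t => Real.exp (-ξ t)) atTop (𝓝 0) :=
    Real.tendsto_exp_atBot.comp (tendsto_neg_atTop_atBot.comp h3)
  obtain ⟨c, hc0, hc⟩ := IsOrbit.exists_tendsto_of_abs_snd_le ha (t₀ := t₀ + 1)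
    (K := Real.exp l) (ho.mono fun t ht => by
      simp only [mem_Ioi]; linarith [mem_Ici.1 ht]) (fun t ht => by
      have h4 : |(-ε * Real.exp (-y (ξ t)))| = Real.exp (-y (ξ t)) := by
        rw [abs_mul, abs_of_pos (Real.exp_pos _)]
        rcases hε with rfl | rfl <;> norm_num
      rw [h4, ← Real.exp_mul, ← Real.exp_add, Real.exp_le_exp]
      linarith [(hyb (ξ t) (hgt t (by linarith)).le).1]) hv0
  refine ⟨t₀, c, _, _, ho, fun t => mul_ne_zero (neg_ne_zero.2 hε0) (Real.exp_pos _).ne', hc0, hc,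
    fun v' Z' hvZ heq => ?_⟩
  rcases hε with rfl | rfl
  · exact not_isOrbit_one_near_neg_infty ha (T := 0) (hvZ.mono (subset_univ _))
  -- The starting point is not in the open time interval, so the strict inequality is moved slightly
  -- to its right by continuity.
  · obtain ⟨x₁, hx₁, hyx⟩ : ∃ x₁, x₀ < x₁ ∧ q * x₁ < y x₁ := by
      have h4 : Tendsto (fun x => y x - q * x) (𝓝[>] x₀) (𝓝 1) := by
        have h5 : Tendsto (fun x => y x - q * x) (𝓝[>] x₀) (𝓝 (y x₀ - q * x₀)) :=
          ((hyc x₀ self_mem_Ici).mono Ioi_subset_Ici_self).tendsto.sub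
            (tendsto_nhdsWithin_of_tendsto_nhds (tendsto_id.const_mul q))
        rwa [hy0, add_sub_cancel_left] at h5
      obtain ⟨x₁, h5, h6⟩ := ((h4.eventually (lt_mem_nhds zero_lt_one)).and
        self_mem_nhdsWithin).exists
      exact ⟨x₁, h6, by linarith⟩
    obtain ⟨t₁, rfl⟩ := hsurj x₁
    have ht₁ : t₀ < t₁ := by rwa [← ht₀, hξm.lt_iff_lt] at hx₁
    obtain ⟨h4, h5⟩ := heq t₁ ht₁
    have h6 : Z' t₁ < v' t₁ ^ q := by
      rw [h4, h5, neg_neg, one_mul, ← Real.exp_mul, Real.exp_lt_exp]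
      linarith
    rcases hvZ.global_classification ha with h | ⟨-, -, h, -⟩
    · rw [(h t₁).1, (h t₁).2, Real.one_rpow] at h6
      exact lt_irrefl _ h6
    · exact lt_asymm h6 (h t₁)

/-! ### Orbits that behave like `exp (-κ m t)` at `+∞` -/

/-- Put Z = -Y, v = u Y^m and s = Y^{qm-1}. The origin becomes the line s = 0, where boundedness of
u selects u = θ, and the curve is trapped between θ - As and θ + As. -/
theorem exists_fast_graph (ha : Admissible β κ m q) (hε : ε = 1 ∨ ε = -1) :
    ∃ (s₀ A M θ : ℝ) (u : ℝ → ℝ), 0 < s₀ ∧ 0 < θ ∧ ∀ s, 0 < s → s < s₀ →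
      0 < u s ∧ |u s - θ| ≤ A * s ∧ u s ^ q ≤ M ∧ u s ^ q * s ≤ 1 / 2 ∧
      HasDerivAt u (-((κ * m - β) * u s - β - ε * (m * κ) * (u s ^ (q + 1) * s)) /
        (κ * (q * m - 1) * (s * (1 - ε * (u s ^ q * s))))) s := by
  have hβ := ha.β_pos
  have hm := ha.m_pos
  have hκ := ha.κ_pos
  have hq := ha.q_pos
  have hqm : 0 < q * m - 1 := by linarith [ha.one_lt]
  have hδ : 0 < κ * m - β := by linarith [ha.lt_mul]
  have hε1 : -1 ≤ ε ∧ ε ≤ 1 := by rcases hε with rfl | rfl <;> norm_num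
  -- θ is the zero of the numerator of the slope at s = 0.
  set θ := β / (κ * m - β) with hθ
  have hθ0 : 0 < θ := div_pos hβ hδ
  have hδθ : (κ * m - β) * θ = β := by rw [hθ]; field_simp
  set M := (2 * θ) ^ q with hM
  have hM0 : 0 < M := by positivity
  set A := m * κ * (2 * θ) ^ (q + 1) / (κ * m - β) with hA
  have hA0 : 0 < A := div_pos (by positivity) hδ
  have hAδ : (κ * m - β) * A = m * κ * (2 * θ) ^ (q + 1) := by rw [hA]; field_simp
  -- The first entry keeps u between θ/2 and 2θ, the second keeps u^q s ≤ 1/2, so the denominator is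
  -- positive for either sign of ε.
  set s₀ := min (θ / (2 * A)) (1 / (2 * M)) with hs₀
  have hs₀pos : 0 < s₀ := lt_min (by positivity) (by positivity)
  have hs₀A : A * s₀ ≤ θ / 2 := by
    have : s₀ ≤ θ / (2 * A) := min_le_left _ _
    rw [le_div_iff₀ (by positivity)] at this
    linarith
  have hs₀M : M * s₀ ≤ 1 / 2 := by
    have : s₀ ≤ 1 / (2 * M) := min_le_right _ _
    rw [le_div_iff₀ (by positivity)] at this
    linarith
  have hreg : ∀ s, 0 < s → s ≤ s₀ → ∀ u, u ∈ Icc (θ - A * s) (θ + A * s) →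
      0 < u ∧ u ^ q ≤ M ∧ u ^ q * s ≤ 1 / 2 ∧ u ^ (q + 1) ≤ (2 * θ) ^ (q + 1) := by
    intro s hs hs' u hu
    have h1 := mul_le_mul_of_nonneg_left hs' hA0.le
    have hu0 : 0 < u := by linarith [hu.1]
    have hu2 : u ≤ 2 * θ := by linarith [hu.2]
    have h2 : u ^ q ≤ M := Real.rpow_le_rpow hu0.le hu2 hq.le
    exact ⟨hu0, h2, (mul_le_mul h2 hs' hs.le hM0.le).trans hs₀M,
      Real.rpow_le_rpow hu0.le hu2 (by linarith)⟩
  have hden : ∀ s, 0 < s → s ≤ s₀ → ∀ u, u ∈ Icc (θ - A * s) (θ + A * s) →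
      0 < κ * (q * m - 1) * (s * (1 - ε * (u ^ q * s))) := by
    intro s hs hs' u hu
    obtain ⟨h1, -, h2, -⟩ := hreg s hs hs' u hu
    have h3 : 0 < u ^ q * s := by positivity
    have h4 : 0 < 1 - ε * (u ^ q * s) := by nlinarith
    positivity
  have hcast : ∀ n : ℕ, (0 : ℝ) < n + 2 := fun n => by positivity
  have han : ∀ n : ℕ, 0 < s₀ / (n + 2) := fun n => div_pos hs₀pos (hcast n)
  have hposR : ∀ n : ℕ, ∀ z ∈ {z : ℝ × ℝ | z.1 ∈ Icc (s₀ / (n + 2)) s₀ ∧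
      z.2 ∈ Icc (θ - A * z.1) (θ + A * z.1)}, z.2 ≠ 0 := fun n z hz =>
    (hreg z.1 ((han n).trans_le hz.1.1) hz.1.2 z.2 hz.2).1.ne'
  have hpow : ∀ (n : ℕ) (r : ℝ), ContinuousOn (fun z : ℝ × ℝ => z.2 ^ r)
      {z : ℝ × ℝ | z.1 ∈ Icc (s₀ / (n + 2)) s₀ ∧ z.2 ∈ Icc (θ - A * z.1) (θ + A * z.1)} :=
    fun n r => continuousOn_snd.rpow_const fun z hz => Or.inl (hposR n z hz)
  have hnum : ∀ n : ℕ, ContinuousOn (fun z : ℝ × ℝ => -((κ * m - β) * z.2 - β - ε * (m * κ) *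
      (z.2 ^ (q + 1) * z.1))) {z : ℝ × ℝ | z.1 ∈ Icc (s₀ / (n + 2)) s₀ ∧
        z.2 ∈ Icc (θ - A * z.1) (θ + A * z.1)} := fun n =>
    (((continuousOn_const.mul continuousOn_snd).sub continuousOn_const).sub
      (continuousOn_const.mul ((hpow n _).mul continuousOn_fst))).neg
  have hdenc : ∀ n : ℕ, ContinuousOn (fun z : ℝ × ℝ => κ * (q * m - 1) *
      (z.1 * (1 - ε * (z.2 ^ q * z.1)))) {z : ℝ × ℝ | z.1 ∈ Icc (s₀ / (n + 2)) s₀ ∧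
        z.2 ∈ Icc (θ - A * z.1) (θ + A * z.1)} := fun n =>
    continuousOn_const.mul (continuousOn_fst.mul
      (continuousOn_const.sub (continuousOn_const.mul ((hpow n _).mul continuousOn_fst))))
  obtain ⟨u, hu1, hu2, hu3, -⟩ := exists_solution_between
    (F := fun s u => -((κ * m - β) * u - β - ε * (m * κ) * (u ^ (q + 1) * s)) /
        (κ * (q * m - 1) * (s * (1 - ε * (u ^ q * s)))))
    (F' := fun s u => (-((κ * m - β) - ε * (m * κ) * ((q + 1) * u ^ q * s)) *
        (κ * (q * m - 1) * (s * (1 - ε * (u ^ q * s)))) -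
        (-((κ * m - β) * u - β - ε * (m * κ) * (u ^ (q + 1) * s))) *
        (κ * (q * m - 1) * (s * (-(ε * (q * u ^ (q - 1) * s)))))) /
        (κ * (q * m - 1) * (s * (1 - ε * (u ^ q * s)))) ^ 2)
    (b₁ := fun s => θ - A * s) (b₂ := fun s => θ + A * s) (b₁' := fun _ => -A) (b₂' := fun _ => A)
    -- The shift by 2 keeps the left endpoint strictly below s₀ at n = 0.
    (a := fun n => s₀ / (n + 2)) (b := fun _ => s₀)
    (fun i j hij => by
      have : (i : ℝ) ≤ j := by exact_mod_cast hij
      exact div_le_div_of_nonneg_left hs₀pos.le (hcast i) (by linarith))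
    (fun _ _ _ => le_rfl)
    (fun n => by
      rw [div_lt_iff₀ (hcast n)]
      have : (0 : ℝ) ≤ n := by positivity
      nlinarith)
    (fun n x hx => by
      have := (han n).trans_le hx.1
      have : 0 < A * x := by positivity
      linarith)
    (fun n => (hnum n).div (hdenc n) fun z hz =>
      (hden z.1 ((han n).trans_le hz.1.1) hz.1.2 z.2 hz.2).ne')
    (fun n => by
      refine ContinuousOn.div ?_ ((hdenc n).pow 2) fun z hz =>
        pow_ne_zero 2 (hden z.1 ((han n).trans_le hz.1.1) hz.1.2 z.2 hz.2).ne'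
      refine ContinuousOn.sub (ContinuousOn.mul ?_ (hdenc n)) (ContinuousOn.mul (hnum n) ?_)
      · exact (continuousOn_const.sub (continuousOn_const.mul
          ((continuousOn_const.mul (hpow n _)).mul continuousOn_fst))).neg
      · exact continuousOn_const.mul (continuousOn_fst.mul (continuousOn_const.mul
          ((continuousOn_const.mul (hpow n _)).mul continuousOn_fst)).neg))
    (fun n s hs u hu => by
      have hs0 := (han n).trans_le hs.1
      have hu0 := (hreg s hs0 hs.2 u hu).1
      have hp : ∀ r : ℝ, HasDerivAt (fun u : ℝ => u ^ r) (r * u ^ (r - 1)) u := fun r =>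
        Real.hasDerivAt_rpow_const (Or.inl hu0.ne')
      have h1 : HasDerivAt (fun u => -((κ * m - β) * u - β - ε * (m * κ) * (u ^ (q + 1) * s)))
          (-((κ * m - β) - ε * (m * κ) * ((q + 1) * u ^ q * s))) u := by
        refine (((((hasDerivAt_id u).const_mul (κ * m - β)).sub_const β).sub
          (((hp (q + 1)).mul_const s).const_mul (ε * (m * κ)))).neg).congr_deriv ?_
        rw [add_sub_cancel_right, mul_one]
      have h2 : HasDerivAt (fun u => κ * (q * m - 1) * (s * (1 - ε * (u ^ q * s))))
          (κ * (q * m - 1) * (s * (-(ε * (q * u ^ (q - 1) * s))))) u :=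
        (((((hp q).mul_const s).const_mul ε).const_sub 1).const_mul s).const_mul _
      exact h1.div h2 (hden s hs0 hs.2 u hu).ne')
    (fun s => by simpa using ((hasDerivAt_id s).const_mul A).const_sub θ)
    (fun s => by simpa using ((hasDerivAt_id s).const_mul A).const_add θ)
    (fun n s hs => by
      have hs0 := (han n).trans hs.1
      have hAs : 0 < A * s := by positivity
      have hmem : θ - A * s ∈ Icc (θ - A * s) (θ + A * s) := ⟨le_rfl, by linarith⟩
      obtain ⟨h1, -, -, h2⟩ := hreg s hs0 hs.2.le _ hmem
      have h3 : 0 < (θ - A * s) ^ (q + 1) := by positivity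
      refine (neg_nonpos.2 hA0.le).trans (div_nonneg ?_ (hden s hs0 hs.2.le _ hmem).le)
      have h4 : m * κ * s * (-(ε * (θ - A * s) ^ (q + 1))) ≤ m * κ * s * (2 * θ) ^ (q + 1) :=
        mul_le_mul_of_nonneg_left (by nlinarith) (by positivity)
      linear_combination h4 - s * hAδ + hδθ)
    (fun n s hs => by
      have hs0 := (han n).trans hs.1
      have hAs : 0 < A * s := by positivity
      have hmem : θ + A * s ∈ Icc (θ - A * s) (θ + A * s) := ⟨by linarith, le_rfl⟩
      obtain ⟨h1, -, -, h2⟩ := hreg s hs0 hs.2.le _ hmem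
      have h3 : 0 < (θ + A * s) ^ (q + 1) := by positivity
      refine (div_nonpos_of_nonpos_of_nonneg ?_ (hden s hs0 hs.2.le _ hmem).le).trans hA0.le
      have h4 : m * κ * s * (ε * (θ + A * s) ^ (q + 1)) ≤ m * κ * s * (2 * θ) ^ (q + 1) :=
        mul_le_mul_of_nonneg_left (by nlinarith) (by positivity)
      linear_combination h4 - s * hAδ - hδθ)
  refine ⟨s₀, A, M, θ, u, hs₀pos, hθ0, fun s hs hs' => ?_⟩
  obtain ⟨n, hn⟩ := exists_nat_gt (s₀ / s)
  have hns : s₀ / (n + 2) < s := by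
    rw [div_lt_iff₀ hs] at hn
    rw [div_lt_iff₀ (hcast n)]
    linarith
  have hmem := hu1 n s ⟨hns.le, hs'.le⟩
  obtain ⟨h1, h2, h3, -⟩ := hreg s hs hs'.le _ hmem
  exact ⟨h1, abs_le.2 ⟨by linarith [hmem.1], by linarith [hmem.2]⟩, h2, h3, hu3 n s ⟨hns, hs'⟩⟩

/-- Along the graph Y' = -κY(1 - ε u^q s) with s exponentially small, so e^{κt} Y converges to a
positive limit and v follows as u Y^m. -/
theorem exists_fast_orbit (ha : Admissible β κ m q) (hε : ε = 1 ∨ ε = -1) :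
    ∃ (t₀ k c : ℝ) (v Z : ℝ → ℝ), IsOrbit β κ m q ε (Ioi t₀) v Z ∧ (∀ t, Z t ≠ 0) ∧
      0 < k ∧ 0 < c ∧ Tendsto (fun t => Real.exp (β * t) * v t) atTop (𝓝 0) ∧
      Tendsto (fun t => Real.exp (κ * m * t) * v t) atTop (𝓝 k) ∧
      Tendsto (fun t => Real.exp (κ * t) * Z t) atTop (𝓝 (-c)) ∧
      ∀ v' Z' : ℝ → ℝ, IsOrbit β κ m q ε univ v' Z' →
        ¬ ∀ t ∈ Ioi t₀, v' t = v t ∧ Z' t = Z t := by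
  have hβ := ha.β_pos
  have hm := ha.m_pos
  have hκ := ha.κ_pos
  have hg : 0 < q * m - 1 := by linarith [ha.one_lt]
  obtain ⟨s₀, A, M, θ, u, hs₀, hθ, hu⟩ := exists_fast_graph ha hε
  set g := q * m - 1 with hgdef
  have hε1 : -1 ≤ ε ∧ ε ≤ 1 := by rcases hε with rfl | rfl <;> norm_num
  have hκg : 0 < κ * g := by positivity
  have hbd : ∀ s, 0 < s → s < s₀ → κ * g * (1 / 2) ≤ κ * g * (1 - ε * (u s ^ q * s)) ∧
      κ * g * (1 - ε * (u s ^ q * s)) ≤ κ * g * 2 := fun s hs hs' => by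
    obtain ⟨h1, -, -, h2, -⟩ := hu s hs hs'
    have h3 : 0 < u s ^ q * s := by positivity
    exact ⟨mul_le_mul_of_nonneg_left (by nlinarith) hκg.le,
      mul_le_mul_of_nonneg_left (by nlinarith) hκg.le⟩
  have huc : ContinuousOn u (Ioo 0 s₀) := fun s hs =>
    (hu s hs.1 hs.2).2.2.2.2.continuousAt.continuousWithinAt
  have hcont : ContinuousOn (fun s => κ * g * (1 - ε * (u s ^ q * s))) (Ioo 0 s₀) :=
    continuousOn_const.mul (continuousOn_const.sub (continuousOn_const.mul
      ((huc.rpow_const fun s hs => Or.inl (hu s hs.1 hs.2).1.ne').mul continuousOn_id)))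
  have hmin : ∀ x : ℝ, min (Real.exp (-x)) (s₀ / 2) ∈ Ioo 0 s₀ := fun x =>
    ⟨lt_min (Real.exp_pos _) (half_pos hs₀), (min_le_right _ _).trans_lt (half_lt_self hs₀)⟩
  obtain ⟨ξ, h1, h2, h3⟩ := exists_global_autonomous_solution (K := κ * g * 2)
    (hcont.comp_continuous ((Real.continuous_exp.comp continuous_neg).min continuous_const) hmin)
    (fun x => lt_of_lt_of_le (by positivity) (hbd _ (hmin x).1 (hmin x).2).1)
    (fun x => (hbd _ (hmin x).1 (hmin x).2).2)
  have hξc : Continuous ξ := continuous_iff_continuousAt.2 fun t => (h2 t).continuousAt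
  have hξm : StrictMono ξ := strictMono_of_deriv_pos fun t => by
    rw [(h2 t).deriv]
    exact lt_of_lt_of_le (by positivity) (hbd _ (hmin _).1 (hmin _).2).1
  obtain ⟨t₀, ht₀⟩ := hξc.surjective h3 h1 (-Real.log (s₀ / 2))
  have hlt : ∀ t, t₀ ≤ t → Real.exp (-ξ t) ≤ s₀ / 2 := fun t ht => by
    have h4 := hξm.monotone ht
    rw [ht₀] at h4
    exact (Real.exp_le_exp.2 (by linarith)).trans_eq (Real.exp_log (half_pos hs₀))
  have hlt' : ∀ t, t₀ ≤ t → Real.exp (-ξ t) < s₀ := fun t ht =>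
    (hlt t ht).trans_lt (half_lt_self hs₀)
  have hξ : ∀ t, t₀ ≤ t → HasDerivAt ξ
      (κ * g * (1 - ε * (u (Real.exp (-ξ t)) ^ q * Real.exp (-ξ t)))) t := fun t ht => by
    have h5 := h2 t
    simp only [Function.comp, min_eq_left (hlt t ht)] at h5
    exact h5
  have hs0 : Tendsto (fun t => Real.exp (-ξ t)) atTop (𝓝 0) :=
    Real.tendsto_exp_atBot.comp (tendsto_neg_atTop_atBot.comp h3)
  have hulim : Tendsto (fun t => u (Real.exp (-ξ t))) atTop (𝓝 θ) := by
    rw [tendsto_iff_norm_sub_tendsto_zero]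
    refine squeeze_zero' (Eventually.of_forall fun _ => norm_nonneg _) ?_
      (by simpa using hs0.const_mul A)
    filter_upwards [eventually_ge_atTop t₀] with t ht
    exact (hu _ (Real.exp_pos _) (hlt' t ht)).2.1
  have hY : ∀ t, t₀ ≤ t → HasDerivAt (fun t => Real.exp (-(ξ t / g)))
      (-κ * (Real.exp (-(ξ t / g)) *
        (1 - ε * (u (Real.exp (-ξ t)) ^ q * Real.exp (-ξ t))))) t := fun t ht => by
    refine ((hξ t ht).div_const g).neg.exp.congr_deriv ?_
    simp only [Pi.neg_apply]
    field_simp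
  have hYg : ∀ t, Real.exp (-ξ t) = Real.exp (-(ξ t / g)) ^ g := fun t => by
    rw [← Real.exp_mul]; congr 1; field_simp
  have ho : IsOrbit β κ m q ε (Ioi t₀)
      (fun t => u (Real.exp (-ξ t)) * Real.exp (-(ξ t / g)) ^ m)
      (fun t => -Real.exp (-(ξ t / g))) := by
    have hpos : ∀ t, t₀ ≤ t → 0 < u (Real.exp (-ξ t)) := fun t ht =>
      (hu _ (Real.exp_pos _) (hlt' t ht)).1
    refine ⟨fun t ht => ?_, fun t ht => ?_, fun t ht => ?_⟩
    · have := hpos t (le_of_lt ht)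
      positivity
    · have ht := le_of_lt (mem_Ioi.1 ht)
      have hs := Real.exp_pos (-ξ t)
      have h4 := (hu _ hs (hlt' t ht)).2.2.2.2
      have h5 : 0 < 1 - ε * (u (Real.exp (-ξ t)) ^ q * Real.exp (-ξ t)) := by
        have := (hbd _ hs (hlt' t ht)).1
        exact pos_of_mul_pos_right (lt_of_lt_of_le (by positivity) this) hκg.le
      have h6 := (h4.comp t (hξ t ht).neg.exp).mul ((hY t ht).rpow_const (p := m)
        (Or.inl (Real.exp_pos _).ne'))
      refine h6.congr_deriv ?_
      have hY0 := Real.exp_pos (-(ξ t / g))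
      have h7 : Real.exp (-(ξ t / g)) ^ m =
          Real.exp (-(ξ t / g)) ^ (m - 1) * Real.exp (-(ξ t / g)) := by
        rw [← Real.rpow_add_one hY0.ne', sub_add_cancel]
      have h8 : u (Real.exp (-ξ t)) ^ (q + 1) =
          u (Real.exp (-ξ t)) ^ q * u (Real.exp (-ξ t)) := Real.rpow_add_one (hpos t ht).ne' q
      rw [spow_neg, spow_of_nonneg hm hY0.le]
      simp only [Function.comp, Pi.neg_apply]
      rw [h8, h7]
      generalize u (Real.exp (-ξ t)) ^ q = U at *
      generalize Real.exp (-(ξ t / g)) ^ (m - 1) = Y' at *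
      have h9 := hs.ne'
      generalize Real.exp (-ξ t) = s at *
      have h10 : ∀ n D : ℝ, D ≠ 0 → n / (κ * g * (s * D)) * (s * -(κ * g * D)) = -n := by
        intro n D hD
        field_simp
      rw [h10 _ _ h5.ne']
      ring
    · have ht := le_of_lt (mem_Ioi.1 ht)
      refine (hY t ht).neg.congr_deriv ?_
      have hY0 := Real.exp_pos (-(ξ t / g))
      have h4 : (u (Real.exp (-ξ t)) * Real.exp (-(ξ t / g)) ^ m) ^ q =
          u (Real.exp (-ξ t)) ^ q * (Real.exp (-ξ t) * Real.exp (-(ξ t / g))) := by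
        rw [Real.mul_rpow (hpos t ht).le (by positivity), ← Real.rpow_mul hY0.le, hYg,
          ← Real.rpow_add_one hY0.ne']
        congr 2
        rw [hgdef]; ring
      rw [h4]
      ring
  -- The function is log(e^{κt} Y); its derivative is bounded by a multiple of s, which decays
  -- exponentially because ξ grows at least linearly.
  obtain ⟨L, hL⟩ := exists_tendsto_of_deriv_exp_bound (f := fun t => κ * t - ξ t / g)
    (f' := fun t => κ * (ε * (u (Real.exp (-ξ t)) ^ q * Real.exp (-ξ t)))) (t₀ := t₀)
    (K := κ * (M * Real.exp (κ * g * (1 / 2) * t₀ - ξ t₀))) (δ := κ * g * (1 / 2))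
    (by positivity) (fun t ht => by
      refine (((hasDerivAt_id t).const_mul κ).sub ((hξ t ht).div_const g)).congr_deriv ?_
      field_simp
      ring) (fun t ht => by
      have h4 := add_mul_le_of_le_deriv ht (fun x hx => hξ x hx.1)
        (fun x hx => (hbd _ (Real.exp_pos _) (hlt' x hx.1)).1)
      obtain ⟨h5, -, h6, -⟩ := hu _ (Real.exp_pos _) (hlt' t ht)
      have h7 : Real.exp (-ξ t) ≤
          Real.exp (κ * g * (1 / 2) * t₀ - ξ t₀) * Real.exp (-(κ * g * (1 / 2)) * t) := by
        rw [← Real.exp_add, Real.exp_le_exp]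
        linarith
      have h8 : |ε| = 1 := by rcases hε with rfl | rfl <;> simp
      have h9 : 0 ≤ u (Real.exp (-ξ t)) ^ q := by positivity
      rw [abs_mul, abs_mul, h8, one_mul, abs_of_pos hκ, abs_of_nonneg (by positivity), mul_assoc,
        mul_assoc]
      exact mul_le_mul_of_nonneg_left (mul_le_mul h6 h7 (Real.exp_pos _).le (h9.trans h6)) hκ.le)
  have hYlim : Tendsto (fun t => Real.exp (κ * t) * Real.exp (-(ξ t / g))) atTop
      (𝓝 (Real.exp L)) := by
    refine hL.rexp.congr fun t => ?_
    rw [← Real.exp_add, sub_eq_add_neg]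
  have hvlim : Tendsto (fun t => Real.exp (κ * m * t) *
      (u (Real.exp (-ξ t)) * Real.exp (-(ξ t / g)) ^ m)) atTop (𝓝 (θ * Real.exp L ^ m)) := by
    refine (hulim.mul (hYlim.rpow_const (p := m) (Or.inl (Real.exp_pos L).ne'))).congr fun t => ?_
    rw [Real.mul_rpow (Real.exp_pos _).le (Real.exp_pos _).le, ← Real.exp_mul (κ * t),
      mul_right_comm κ t m]
    ring
  have hv0 : Tendsto (fun t => Real.exp (β * t) *
      (u (Real.exp (-ξ t)) * Real.exp (-(ξ t / g)) ^ m)) atTop (𝓝 0) := by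
    have h4 : Tendsto (fun t => Real.exp (-((κ * m - β) * t))) atTop (𝓝 0) :=
      Real.tendsto_exp_atBot.comp (tendsto_neg_atTop_atBot.comp
        (tendsto_id.const_mul_atTop (by linarith [ha.lt_mul])))
    have h5 := h4.mul hvlim
    rw [zero_mul] at h5
    refine h5.congr fun t => ?_
    rw [← mul_assoc, ← Real.exp_add]
    congr 2; ring
  refine ⟨t₀, _, _, _, _, ho, fun t => neg_ne_zero.2 (Real.exp_pos _).ne',
    by positivity, Real.exp_pos L, hv0, hvlim, hYlim.neg.congr fun t => (mul_neg _ _).symm,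
    fun v' Z' hvZ heq => ?_⟩
  rcases hε with rfl | rfl
  · exact not_isOrbit_one_near_neg_infty ha (T := 0) (hvZ.mono (subset_univ _))
  -- A global orbit has e^{βt} v tending to a positive number or, for the equilibrium, to infinity;
  -- the fast orbit has limit 0.
  · have h4 : Tendsto (fun t => Real.exp (β * t) * v' t) atTop (𝓝 0) := by
      refine hv0.congr' ?_
      filter_upwards [eventually_gt_atTop t₀] with t ht
      rw [(heq t ht).1]
    rcases hvZ.global_classification ha with h | ⟨-, -, -, -, c, hc, h⟩
    · refine not_tendsto_nhds_of_tendsto_atTop ?_ 0 h4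
      refine (Real.tendsto_exp_atTop.comp (tendsto_id.const_mul_atTop hβ)).congr fun t => ?_
      simp [(h t).1]
    · exact hc.ne (tendsto_nhds_unique h4 h)

end HardyHenon

namespace HardyHenon

variable {p q N σ ε : ℝ} {v Z : ℝ → ℝ}

/-! ### Asymptotics of solutions in terms of their orbits -/

theorem exp_preimage_Ioi_zero : Real.exp ⁻¹' Ioi 0 = univ := by
  ext t; simp [Real.exp_pos]

theorem exp_preimage_Ioi {r : ℝ} (hr : 0 < r) : Real.exp ⁻¹' Ioi r = Ioi (Real.log r) := by
  ext t; simp [Real.log_lt_iff_lt_exp hr]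

theorem exp_preimage_Ioo_zero {r : ℝ} (hr : 0 < r) : Real.exp ⁻¹' Ioo 0 r = Iio (Real.log r) := by
  ext t; simp [Real.lt_log_iff_exp_lt hr, Real.exp_pos]

theorem rpow_eq_exp_mul_log {r : ℝ} (hr : 0 < r) (x : ℝ) : r ^ x = Real.exp (x * Real.log r) := by
  rw [Real.rpow_def_of_pos hr, mul_comm]

theorem tendsto_ofProfile_atTop {c : ℝ}
    (hc : Tendsto (fun t => Real.exp (bet p q σ * t) * v t) atTop (𝓝 c)) :
    Tendsto (ofProfile p q N σ v) atTop (𝓝 (aStar p q N σ (-1) * c)) := by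
  refine ((hc.comp Real.tendsto_log_atTop).const_mul _).congr' ?_
  filter_upwards [eventually_gt_atTop 0] with r hr
  rw [ofProfile, rpow_eq_exp_mul_log hr, mul_assoc]
  rfl

theorem tendsto_rpow_mul_ofProfile (h : ParameterRange p q N σ) {k : ℝ}
    (hk : Tendsto (fun t => Real.exp (kap p q N σ * (1 / (p - 1)) * t) * v t) atTop (𝓝 k)) :
    Tendsto (fun r => r ^ ((N - p) / (p - 1)) * ofProfile p q N σ v r) atTop
      (𝓝 (aStar p q N σ (-1) * k)) := by
  have hp1 : p - 1 ≠ 0 := by linarith [h.hp]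
  refine ((hk.comp Real.tendsto_log_atTop).const_mul _).congr' ?_
  filter_upwards [eventually_gt_atTop 0] with r hr
  have h1 : kap p q N σ * (1 / (p - 1)) = (N - p) / (p - 1) + bet p q σ := by
    rw [kap]; field_simp
  simp only [Function.comp]
  rw [ofProfile, h1, ← rpow_eq_exp_mul_log hr, Real.rpow_add hr]
  ring

/-- As w' = a*β r^{β-1} Z^m, the relation `he` makes the power r^{β-1+e} equal to the m-th power of
e^{δt}. -/
theorem tendsto_rpow_mul_deriv_ofProfile (h : ParameterRange p q N σ) {r₀ δ e z κ : ℝ} (hr₀ : 0 ≤ r₀)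
    (hv : IsOrbit (bet p q σ) κ (1 / (p - 1)) q ε (Real.exp ⁻¹' Ioi r₀) v Z)
    (he : bet p q σ - 1 + e = δ * (1 / (p - 1)))
    (hz : Tendsto (fun t => Real.exp (δ * t) * Z t) atTop (𝓝 z)) :
    Tendsto (fun r => r ^ e * deriv (ofProfile p q N σ v) r) atTop
      (𝓝 (aStar p q N σ (-1) * bet p q σ * spow (1 / (p - 1)) z)) := by
  have hm := (admissible h).m_pos
  refine ((((continuous_spow hm).tendsto z).comp (hz.comp Real.tendsto_log_atTop)).const_mul
    _).congr' ?_
  filter_upwards [eventually_gt_atTop r₀] with r hr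
  have hr' := hr₀.trans_lt hr
  rw [(deriv_ofProfile (fun x hx => hr₀.trans_lt hx) hv hr).deriv]
  simp only [Function.comp]
  rw [spow_mul hm (Real.exp_pos _).le, ← Real.exp_mul, mul_right_comm δ, ← he,
    ← rpow_eq_exp_mul_log hr', Real.rpow_add hr']
  ring

theorem IsOrbit.tendsto_solution (h : ParameterRange p q N σ) (hε : ε = 1 ∨ ε = -1) {r₀ c : ℝ}
    (hr₀ : 0 ≤ r₀)
    (hv : IsOrbit (bet p q σ) (kap p q N σ) (1 / (p - 1)) q ε (Real.exp ⁻¹' Ioi r₀) v Z)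
    (hc0 : 0 < c) (hc : Tendsto (fun t => Real.exp (bet p q σ * t) * v t) atTop (𝓝 c)) :
    Tendsto (ofProfile p q N σ v) atTop (𝓝 (aStar p q N σ (-1) * c)) ∧
    Tendsto (fun r => r ^ (-((σ + 1) / (p - 1))) * deriv (ofProfile p q N σ v) r) atTop
      (𝓝 (-ε * (aStar p q N σ (-1) * bet p q σ *
        (kap p q N σ * c ^ q / (kap p q N σ - bet p q σ * q)) ^ (1 / (p - 1))))) := by
  have ha := admissible h
  have hm := ha.m_pos
  have hp1 : p - 1 ≠ 0 := by linarith [h.hp]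
  have hl : 0 < kap p q N σ - bet p q σ * q := by linarith [ha.mul_lt]
  have hX : 0 < kap p q N σ * c ^ q / (kap p q N σ - bet p q σ * q) := by
    have := ha.κ_pos
    positivity
  refine ⟨tendsto_ofProfile_atTop hc, ?_⟩
  have h1 : Ici (Real.log (r₀ + 1)) ⊆ Real.exp ⁻¹' Ioi r₀ := fun t ht => by
    have := (Real.log_le_iff_le_exp (by linarith)).1 (mem_Ici.1 ht)
    simp only [mem_preimage, mem_Ioi]
    linarith
  have h2 := tendsto_rpow_mul_deriv_ofProfile (N := N) (e := -((σ + 1) / (p - 1))) h hr₀ hv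
    (by
      have := bet_mul h
      field_simp
      linarith) ((hv.mono h1).tendsto_exp_mul_snd ha hc)
  convert h2 using 2
  rcases hε with rfl | rfl
  · rw [neg_one_mul, neg_one_mul, spow_neg, spow_of_nonneg hm hX.le]
    ring
  · rw [neg_neg, one_mul, one_mul, spow_of_nonneg hm hX.le]

theorem isEquivalent_ofProfile {l : Filter ℝ} (hv : Tendsto (fun r => v (Real.log r)) l (𝓝 1)) :
    Asymptotics.IsEquivalent l (ofProfile p q N σ v) (wStar p q N σ (-1)) := by
  refine Asymptotics.isEquivalent_iff_exists_eq_mul.2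
    ⟨_, hv, Eventually.of_forall fun r => ?_⟩
  simp only [Pi.mul_apply, ofProfile, wStar, bet]
  ring

theorem ofProfile_one : ofProfile p q N σ (fun _ => 1) = wStar p q N σ (-1) := by
  ext r
  rw [ofProfile, wStar, bet, mul_one]

/-! ### Time shifts of orbits -/

theorem tendsto_exp_mul_shift {f : ℝ → ℝ} {δ c : ℝ}
    (hf : Tendsto (fun t => Real.exp (δ * t) * f t) atTop (𝓝 c)) (s : ℝ) :
    Tendsto (fun t => Real.exp (δ * t) * f (t + s)) atTop (𝓝 (Real.exp (-δ * s) * c)) := by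
  refine ((hf.comp (tendsto_atTop_add_const_right _ s tendsto_id)).const_mul _).congr fun t => ?_
  simp only [Function.comp, id]
  rw [← mul_assoc, ← Real.exp_add]
  congr 2; ring

theorem exists_exp_neg_mul_eq {δ c C : ℝ} (hδ : 0 < δ) (hc : 0 < c) (hC : 0 < C) :
    ∃ s, Real.exp (-δ * s) * c = C := by
  refine ⟨-Real.log (C / c) / δ, ?_⟩
  rw [show -δ * (-Real.log (C / c) / δ) = Real.log (C / c) by field_simp,
    Real.exp_log (by positivity)]
  field_simp

theorem not_eq_global_shift {β κ m : ℝ} {J : Set ℝ}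
    (hng : ∀ v' Z' : ℝ → ℝ, IsOrbit β κ m q ε univ v' Z' →
      ¬ ∀ t ∈ J, v' t = v t ∧ Z' t = Z t) (s : ℝ) (v' Z' : ℝ → ℝ)
    (hvZ : IsOrbit β κ m q ε univ v' Z') :
    ¬ ∀ t ∈ (fun t => t + s) ⁻¹' J, v' t = v (t + s) ∧ Z' t = Z (t + s) := fun heq =>
  hng _ _ (hvZ.shift (-s)) fun t ht => by
    have := heq (t + -s) (by simpa using ht)
    simpa using this

theorem IsOrbit.shift_Ioi {β κ m t₀ : ℝ} (hv : IsOrbit β κ m q ε (Ioi t₀) v Z) (s : ℝ) :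
    IsOrbit β κ m q ε (Real.exp ⁻¹' Ioi (Real.exp (t₀ - s))) (fun t => v (t + s))
      (fun t => Z (t + s)) := by
  refine (hv.shift s).mono fun t ht => ?_
  rw [exp_preimage_Ioi (Real.exp_pos _), Real.log_exp] at ht
  simp only [mem_preimage, mem_Ioi] at ht ⊢
  linarith

theorem preimage_add_Ioi_subset (t₀ s : ℝ) :
    (fun t => t + s) ⁻¹' Ioi t₀ ⊆ Real.exp ⁻¹' Ioi (Real.exp (t₀ - s)) := by
  rw [exp_preimage_Ioi (Real.exp_pos _), Real.log_exp]
  intro t ht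
  simp only [mem_preimage, mem_Ioi] at ht ⊢
  linarith

/-! ### The solutions -/

theorem not_tendsto_pos_near_zero (h : ParameterRange p q N σ) (hε : ε = 1 ∨ ε = -1) {ρ c : ℝ}
    (hρ : 0 < ρ) (hc : 0 < c) {w : ℝ → ℝ} (hw : IsPosSolution p q N σ ε (Ioo 0 ρ) w) :
    ¬ Tendsto w (𝓝[>] 0) (𝓝 c) := by
  intro hlim
  have ha := aStar_pos h
  have ho := isOrbit_profile h hw
  rw [exp_preimage_Ioo_zero hρ] at ho
  rcases hε with rfl | rfl
  · exact not_isOrbit_one_near_neg_infty (admissible h) ho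
  · refine ho.not_tendsto_near_neg_infty (admissible h)
      (c := (aStar p q N σ (-1))⁻¹ * c) (by positivity) ?_
    have h1 : Tendsto Real.exp atBot (𝓝[>] 0) := Real.tendsto_exp_atBot_nhdsGT
    refine ((hlim.comp h1).const_mul _).congr fun t => ?_
    simp only [Function.comp, profile]
    have h2 : Real.exp (bet p q σ * t) * Real.exp (-bet p q σ * t) = 1 := by
      rw [← Real.exp_add]; simp
    linear_combination -(aStar p q N σ (-1))⁻¹ * w (Real.exp t) * h2

theorem exists_slow_solution (h : ParameterRange p q N σ) (hε : ε = 1 ∨ ε = -1) {C : ℝ}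
    (hC : 0 < C) : ∃ D : ℝ, 0 < D ∧ ∃ (r₀ : ℝ) (w : ℝ → ℝ), 0 < r₀ ∧
      IsPosSolution p q N σ ε (Ioi r₀) w ∧ ContDiffOn ℝ 2 w (Ioi r₀) ∧
      IsNonglobal p q N σ ε (Ioi r₀) w ∧ Tendsto w atTop (𝓝 C) ∧
      Tendsto (fun r => r ^ (-((σ + 1) / (p - 1))) * deriv w r) atTop (𝓝 (-ε * D)) := by
  have ha := admissible h
  have hA := aStar_pos h
  have hβ := bet_pos h
  have hl : 0 < kap p q N σ - bet p q σ * q := by linarith [ha.mul_lt]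
  have hκ := kap_pos h
  obtain ⟨t₀, c, v, Z, ho, hZ, hc0, hc, hng⟩ := exists_slow_orbit ha hε
  obtain ⟨s, hs⟩ := exists_exp_neg_mul_eq hβ hc0 (div_pos hC hA)
  have hc' := tendsto_exp_mul_shift hc s
  rw [hs] at hc'
  have ho' := ho.shift_Ioi s
  have hsub : Ioi (Real.exp (t₀ - s)) ⊆ Ioi 0 := Ioi_subset_Ioi (Real.exp_pos _).le
  obtain ⟨h1, h2⟩ := ho'.tendsto_solution h hε (Real.exp_pos _).le (by positivity) hc'
  rw [mul_div_cancel₀ _ hA.ne'] at h1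
  exact ⟨_, by positivity, Real.exp (t₀ - s), _, Real.exp_pos _,
    isPosSolution_ofProfile h isOpen_Ioi hsub ho',
    contDiffOn_ofProfile h isOpen_Ioi hsub ho' fun t _ => hZ _,
    isNonglobal_ofProfile h isOpen_Ioi ho' fun v' Z' hvZ heq =>
      not_eq_global_shift hng s v' Z' hvZ fun t ht => heq t (preimage_add_Ioi_subset t₀ s ht),
    h1, h2⟩

theorem exists_fast_solution (h : ParameterRange p q N σ) (hε : ε = 1 ∨ ε = -1) {k : ℝ}
    (hk : 0 < k) : ∃ c : ℝ, 0 < c ∧ ∃ (r₀ : ℝ) (w : ℝ → ℝ), 0 < r₀ ∧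
      IsPosSolution p q N σ ε (Ioi r₀) w ∧ ContDiffOn ℝ 2 w (Ioi r₀) ∧
      IsNonglobal p q N σ ε (Ioi r₀) w ∧ Tendsto w atTop (𝓝 0) ∧
      Tendsto (fun r => r ^ ((N - p) / (p - 1)) * w r) atTop (𝓝 k) ∧
      Tendsto (fun r => r ^ ((N - 1) / (p - 1)) * deriv w r) atTop (𝓝 (-c)) := by
  have ha := admissible h
  have hA := aStar_pos h
  have hβ := bet_pos h
  have hm := ha.m_pos
  have hκ := kap_pos h
  have hp1 : p - 1 ≠ 0 := by linarith [h.hp]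
  obtain ⟨t₀, k₀, c, v, Z, ho, hZ, hk0, hc0, hv0, hvk, hZc, hng⟩ := exists_fast_orbit ha hε
  obtain ⟨s, hs⟩ := exists_exp_neg_mul_eq (mul_pos hκ hm) hk0 (div_pos hk hA)
  have hvk' := tendsto_exp_mul_shift hvk s
  have hv0' := tendsto_exp_mul_shift hv0 s
  have hZc' := tendsto_exp_mul_shift hZc s
  rw [hs] at hvk'
  rw [mul_zero] at hv0'
  have ho' := ho.shift_Ioi s
  have hsub : Ioi (Real.exp (t₀ - s)) ⊆ Ioi 0 := Ioi_subset_Ioi (Real.exp_pos _).le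
  have h1 := tendsto_ofProfile_atTop (N := N) hv0'
  have h2 := tendsto_rpow_mul_ofProfile h hvk'
  have h3 := tendsto_rpow_mul_deriv_ofProfile (N := N) (e := (N - 1) / (p - 1)) h
    (Real.exp_pos (t₀ - s)).le ho' (by rw [kap]; field_simp; ring) hZc'
  rw [mul_zero] at h1
  rw [mul_div_cancel₀ _ hA.ne'] at h2
  have h4 : 0 < Real.exp (-kap p q N σ * s) * c := by positivity
  rw [mul_neg, spow_neg, spow_of_nonneg hm h4.le, mul_neg] at h3
  exact ⟨_, by positivity, Real.exp (t₀ - s), _, Real.exp_pos _,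
    isPosSolution_ofProfile h isOpen_Ioi hsub ho',
    contDiffOn_ofProfile h isOpen_Ioi hsub ho' fun t _ => hZ _,
    isNonglobal_ofProfile h isOpen_Ioi ho' fun v' Z' hvZ heq =>
      not_eq_global_shift hng s v' Z' hvZ fun t ht => heq t (preimage_add_Ioi_subset t₀ s ht),
    h1, h2, h3⟩

/-! ### The power solution w* -/

theorem isOrbit_one {β κ m : ℝ} (hm : 0 < m) (J : Set ℝ) :
    IsOrbit β κ m q (-1) J (fun _ => 1) (fun _ => 1) :=
  ⟨fun _ _ => one_pos,
    fun t _ => (hasDerivAt_const t (1 : ℝ)).congr_deriv (by rw [spow_one hm]; ring),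
    fun t _ => (hasDerivAt_const t (1 : ℝ)).congr_deriv (by rw [Real.one_rpow]; ring)⟩

theorem isPosSolution_wStar (h : ParameterRange p q N σ) :
    IsPosSolution p q N σ (-1) (Ioi 0) (wStar p q N σ (-1)) :=
  ofProfile_one (N := N) ▸ isPosSolution_ofProfile h isOpen_Ioi subset_rfl
    (isOrbit_one (admissible h).m_pos _)

theorem contDiffOn_wStar (h : ParameterRange p q N σ) :
    ContDiffOn ℝ 2 (wStar p q N σ (-1)) (Ioi 0) :=
  ofProfile_one (N := N) ▸ contDiffOn_ofProfile h isOpen_Ioi subset_rfl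
    (isOrbit_one (admissible h).m_pos _) fun _ _ => one_ne_zero

theorem tendsto_wStar_zero (h : ParameterRange p q N σ) :
    Tendsto (wStar p q N σ (-1)) (𝓝[>] 0) (𝓝 0) := by
  have hβ := bet_pos h
  have h1 := ((Real.continuousAt_rpow_const 0 (bet p q σ) (Or.inr hβ.le)).tendsto.const_mul
    (aStar p q N σ (-1)))
  rw [Real.zero_rpow hβ.ne', mul_zero] at h1
  exact h1.mono_left nhdsWithin_le_nhds

/-- |w*'| is a positive multiple of r^{β-1}, and β < 1 is equivalent to -σ < q + 1 by `bet_mul`. -/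
theorem tendsto_abs_deriv_wStar_iff (h : ParameterRange p q N σ) :
    Tendsto (fun r => |deriv (wStar p q N σ (-1)) r|) (𝓝[>] 0) atTop ↔ -σ < q + 1 := by
  have hA := aStar_pos h
  have hβ := bet_pos h
  have hiff : bet p q σ < 1 ↔ -σ < q + 1 := by
    have h1 := bet_mul h
    have h2 : 0 < q + 1 - p := by linarith [h.hq]
    constructor <;> intro h3 <;> nlinarith
  rw [← hiff]
  have hd : (fun r => |deriv (wStar p q N σ (-1)) r|) =ᶠ[𝓝[>] 0]
      fun r => aStar p q N σ (-1) * bet p q σ * r ^ (bet p q σ - 1) := by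
    filter_upwards [self_mem_nhdsWithin] with r hr
    have hr0 : (0 : ℝ) < r := hr
    rw [← ofProfile_one, (deriv_ofProfile (I := Ioi 0) (κ := kap p q N σ) subset_rfl
      (isOrbit_one (admissible h).m_pos _) hr).deriv, spow_one (admissible h).m_pos, mul_one,
      abs_of_pos (by positivity)]
  rw [tendsto_congr' hd]
  refine ⟨fun h1 => ?_, fun h1 => ?_⟩
  · by_contra! h2
    obtain ⟨r, h3, h4⟩ := ((h1.eventually (eventually_gt_atTop (aStar p q N σ (-1) *
      bet p q σ))).and (Ioo_mem_nhdsGT (show (0 : ℝ) < 1 by norm_num))).exists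
    have h5 := Real.rpow_le_one h4.1.le h4.2.le (show 0 ≤ bet p q σ - 1 by linarith)
    have h6 := mul_le_mul_of_nonneg_left h5 (mul_pos hA hβ).le
    linarith
  · exact (tendsto_rpow_neg_nhdsGT_zero (by linarith)).const_mul_atTop (mul_pos hA hβ)

/-! ### Global solutions for ε = -1 -/

theorem exists_global_solution (h : ParameterRange p q N σ) {C : ℝ} (hC : 0 < C) :
    ∃ D : ℝ, 0 < D ∧ ∃ w : ℝ → ℝ,
      IsPosSolution p q N σ (-1) (Ioi 0) w ∧ ContDiffOn ℝ 2 w (Ioi 0) ∧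
      Asymptotics.IsEquivalent (𝓝[>] 0) w (wStar p q N σ (-1)) ∧
      Tendsto w atTop (𝓝 C) ∧
      Tendsto (fun r => r ^ (-((σ + 1) / (p - 1))) * deriv w r) atTop (𝓝 D) := by
  have ha := admissible h
  have hA := aStar_pos h
  have hβ := bet_pos h
  have hl : 0 < kap p q N σ - bet p q σ * q := by linarith [ha.mul_lt]
  have hκ := kap_pos h
  obtain ⟨v, Z, ho, hv⟩ := exists_global_orbit ha
  rcases ho.global_classification ha with h1 | ⟨-, hZ, -, hbot, c, hc0, hc⟩
  · exact absurd (h1 0).1 (hv 0).ne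
  obtain ⟨s, hs⟩ := exists_exp_neg_mul_eq hβ hc0 (div_pos hC hA)
  have hc' := tendsto_exp_mul_shift hc s
  rw [hs] at hc'
  have ho' := (ho.shift s).mono (subset_univ (Real.exp ⁻¹' Ioi 0))
  obtain ⟨h1, h2⟩ := ho'.tendsto_solution h (Or.inr rfl) le_rfl (by positivity) hc'
  rw [mul_div_cancel₀ _ hA.ne'] at h1
  rw [neg_neg, one_mul] at h2
  refine ⟨_, by positivity, _, isPosSolution_ofProfile h isOpen_Ioi subset_rfl ho',
    contDiffOn_ofProfile h isOpen_Ioi subset_rfl ho' fun t _ => (hZ _).ne',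
    isEquivalent_ofProfile ?_, h1, h2⟩
  exact hbot.comp (tendsto_atBot_add_const_right _ s Real.tendsto_log_nhdsGT_zero)

theorem IsPosSolution.eq_wStar_or (h : ParameterRange p q N σ) {w : ℝ → ℝ}
    (hw : IsPosSolution p q N σ (-1) (Ioi 0) w) :
    EqOn w (wStar p q N σ (-1)) (Ioi 0) ∨
      (Asymptotics.IsEquivalent (𝓝[>] 0) w (wStar p q N σ (-1)) ∧
        ∃ C D : ℝ, 0 < C ∧ 0 < D ∧ Tendsto w atTop (𝓝 C) ∧
          Tendsto (fun r => r ^ (-((σ + 1) / (p - 1))) * deriv w r) atTop (𝓝 D)) := by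
  have ha := admissible h
  have hA := aStar_pos h
  have hβ := bet_pos h
  have hl : 0 < kap p q N σ - bet p q σ * q := by linarith [ha.mul_lt]
  have hκ := kap_pos h
  have ho := isOrbit_profile h hw
  have hEq : EqOn (ofProfile p q N σ (profile p q N σ w)) w (Ioi 0) := fun r hr =>
    ofProfile_profile h hr
  have ho' := ho
  rw [exp_preimage_Ioi_zero] at ho'
  rcases ho'.global_classification ha with h1 | ⟨-, -, -, hbot, c, hc0, hc⟩
  · refine Or.inl fun r hr => ?_
    rw [← hEq hr, ← ofProfile_one, ofProfile, ofProfile, (h1 _).1]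
  · obtain ⟨h1, h2⟩ := ho.tendsto_solution h (Or.inr rfl) le_rfl hc0 hc
    rw [neg_neg, one_mul] at h2
    refine Or.inr ⟨(isEquivalent_ofProfile (hbot.comp Real.tendsto_log_nhdsGT_zero)).congr_left
      hEq.eventuallyEq_nhdsWithin, _, _, mul_pos hA hc0, by positivity,
      h1.congr' (hEq.eventuallyEq_of_mem (Ioi_mem_atTop 0)), h2.congr' ?_⟩
    filter_upwards [Ioi_mem_atTop 0] with r hr
    rw [(hEq.eventuallyEq_of_mem (Ioi_mem_nhds hr)).deriv_eq]

/-! ### Solutions with a zero or a blow-up at r₀ -/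

theorem tendsto_log_add_nhdsGT {r₀ T : ℝ} (hr₀ : 0 < r₀) :
    Tendsto (fun r => Real.log r + (T - Real.log r₀)) (𝓝[>] r₀) (𝓝[>] T) := by
  refine tendsto_nhdsWithin_iff.2 ⟨?_, ?_⟩
  · have h1 := ((Real.continuousAt_log hr₀.ne').tendsto.add_const (T - Real.log r₀))
    rw [add_sub_cancel] at h1
    exact h1.mono_left nhdsWithin_le_nhds
  · filter_upwards [self_mem_nhdsWithin] with r hr
    have := Real.log_lt_log hr₀ hr
    simp only [mem_Ioi]; linarith

theorem tendsto_log_add_nhdsLT {r₀ T : ℝ} (hr₀ : 0 < r₀) :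
    Tendsto (fun r => Real.log r + (T - Real.log r₀)) (𝓝[<] r₀) (𝓝[<] T) := by
  refine tendsto_nhdsWithin_iff.2 ⟨?_, ?_⟩
  · have h1 := ((Real.continuousAt_log hr₀.ne').tendsto.add_const (T - Real.log r₀))
    rw [add_sub_cancel] at h1
    exact h1.mono_left nhdsWithin_le_nhds
  · filter_upwards [Ioo_mem_nhdsLT hr₀] with r hr
    have := Real.log_lt_log hr.1 hr.2
    simp only [mem_Iio]; linarith

theorem tendsto_aStar_mul_rpow {r₀ : ℝ} (hr₀ : 0 < r₀) (S : Set ℝ) :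
    Tendsto (fun r => aStar p q N σ (-1) * r ^ bet p q σ) (𝓝[S] r₀)
      (𝓝 (aStar p q N σ (-1) * r₀ ^ bet p q σ)) :=
  ((Real.continuousAt_rpow_const r₀ _ (Or.inl hr₀.ne')).tendsto.const_mul _).mono_left
    nhdsWithin_le_nhds

theorem exists_exterior_zero_solution (h : ParameterRange p q N σ) {r₀ : ℝ} (hr₀ : 0 < r₀) :
    ∃ w : ℝ → ℝ, IsPosSolution p q N σ (-1) (Ioi r₀) w ∧ ContDiffOn ℝ 2 w (Ioi r₀) ∧
      Tendsto w (𝓝[>] r₀) (𝓝 0) ∧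
      Asymptotics.IsEquivalent atTop w (wStar p q N σ (-1)) := by
  obtain ⟨T, v, Z, ho, hZ, htop, hT⟩ := exists_exterior_zero_orbit (admissible h)
  have ho' := ho.shift_Ioi (T - Real.log r₀)
  rw [sub_sub_cancel, Real.exp_log hr₀] at ho'
  have hsub : Ioi r₀ ⊆ Ioi 0 := Ioi_subset_Ioi hr₀.le
  refine ⟨_, isPosSolution_ofProfile h isOpen_Ioi hsub ho',
    contDiffOn_ofProfile h isOpen_Ioi hsub ho' fun t ht => (hZ _ ?_).ne', ?_,
    isEquivalent_ofProfile ?_⟩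
  · rw [exp_preimage_Ioi hr₀] at ht
    simp only [mem_Ioi] at ht ⊢
    linarith
  · have := (tendsto_aStar_mul_rpow (p := p) (q := q) (N := N) (σ := σ) hr₀ (Ioi r₀)).mul
      (hT.comp (tendsto_log_add_nhdsGT hr₀))
    rwa [mul_zero] at this
  · exact htop.comp (tendsto_atTop_add_const_right _ _ Real.tendsto_log_atTop)

theorem exists_exterior_blowup_solution (h : ParameterRange p q N σ) {r₀ : ℝ} (hr₀ : 0 < r₀) :
    ∃ w : ℝ → ℝ, IsPosSolution p q N σ (-1) (Ioi r₀) w ∧ Tendsto w (𝓝[>] r₀) atTop ∧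
      Asymptotics.IsEquivalent atTop w (wStar p q N σ (-1)) := by
  have hA := aStar_pos h
  obtain ⟨T, v, Z, ho, htop, hT⟩ := exists_exterior_blowup_orbit (admissible h)
  have ho' := ho.shift_Ioi (T - Real.log r₀)
  rw [sub_sub_cancel, Real.exp_log hr₀] at ho'
  refine ⟨_, isPosSolution_ofProfile h isOpen_Ioi (Ioi_subset_Ioi hr₀.le) ho', ?_,
    isEquivalent_ofProfile ?_⟩
  · exact (tendsto_aStar_mul_rpow hr₀ (Ioi r₀)).pos_mul_atTop (by positivity)
      (hT.comp (tendsto_log_add_nhdsGT hr₀))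
  · exact htop.comp (tendsto_atTop_add_const_right _ _ Real.tendsto_log_atTop)

/-- Nonglobality needs no classification here: a global extension would be continuous at r₀, where
this solution blows up. -/
theorem exists_interior_blowup_solution (h : ParameterRange p q N σ) {r₀ : ℝ} (hr₀ : 0 < r₀) :
    ∃ w : ℝ → ℝ, IsPosSolution p q N σ (-1) (Ioo 0 r₀) w ∧ ContDiffOn ℝ 2 w (Ioo 0 r₀) ∧
      IsNonglobal p q N σ (-1) (Ioo 0 r₀) w ∧
      Asymptotics.IsEquivalent (𝓝[>] 0) w (wStar p q N σ (-1)) ∧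
      Tendsto w (𝓝[<] r₀) atTop := by
  have hA := aStar_pos h
  obtain ⟨T, v, Z, ho, hZ, hbot, hT⟩ := exists_interior_blowup_orbit (admissible h)
  have ho' := (ho.shift (T - Real.log r₀)).mono (J' := Real.exp ⁻¹' Ioo 0 r₀) (fun t ht => by
    rw [exp_preimage_Ioo_zero hr₀] at ht
    simp only [mem_preimage, mem_Iio] at ht ⊢
    linarith)
  have hsub : Ioo 0 r₀ ⊆ Ioi 0 := Ioo_subset_Ioi_self
  have htop : Tendsto (ofProfile p q N σ fun t => v (t + (T - Real.log r₀))) (𝓝[<] r₀) atTop :=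
    (tendsto_aStar_mul_rpow hr₀ (Iio r₀)).pos_mul_atTop (by positivity)
      (hT.comp (tendsto_log_add_nhdsLT hr₀))
  refine ⟨_, isPosSolution_ofProfile h isOpen_Ioo hsub ho',
    contDiffOn_ofProfile h isOpen_Ioo hsub ho' fun t _ => (hZ _).ne', fun W hW hEq => ?_,
    isEquivalent_ofProfile ?_, htop⟩
  · have h1 : Tendsto W (𝓝[<] r₀) (𝓝 (W r₀)) :=
      (hW.differentiable r₀ hr₀).continuousAt.tendsto.mono_left nhdsWithin_le_nhds
    refine not_tendsto_nhds_of_tendsto_atTop htop _ (h1.congr' ?_)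
    exact hEq.eventuallyEq_of_mem (Ioo_mem_nhdsLT hr₀)
  · exact hbot.comp (tendsto_atBot_add_const_right _ _ Real.tendsto_log_nhdsGT_zero)

theorem not_isPosSolution_one_near_zero (h : ParameterRange p q N σ) {r₀ : ℝ} (hr₀ : 0 < r₀)
    {w : ℝ → ℝ} : ¬ IsPosSolution p q N σ 1 (Ioo 0 r₀) w := fun hw => by
  have ho := isOrbit_profile h hw
  rw [exp_preimage_Ioo_zero hr₀] at ho
  exact not_isOrbit_one_near_neg_infty (admissible h) ho

end HardyHenon

theorem theorem4 (p q N σ : ℝ) (hp : 1 < p) (hq : p - 1 < q) (hσ : p < -σ) (hN : -σ < N) :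
    -- no solution near `0` with a positive limit at `0`
    (∀ ε : ℝ, (ε = 1 ∨ ε = -1) → ∀ ρ : ℝ, 0 < ρ →
      ¬ ∃ (w : ℝ → ℝ) (c : ℝ), 0 < c ∧ IsPosSolution p q N σ ε (Ioo 0 ρ) w ∧
        Tendsto w (𝓝[>] 0) (𝓝 c)) ∧
    -- nonglobal local solutions near infinity, of two types
    (∀ ε : ℝ, (ε = 1 ∨ ε = -1) →
      (∀ C : ℝ, 0 < C → ∃ D : ℝ, 0 < D ∧ ∃ (r₀ : ℝ) (w : ℝ → ℝ), 0 < r₀ ∧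
        IsPosSolution p q N σ ε (Ioi r₀) w ∧ ContDiffOn ℝ 2 w (Ioi r₀) ∧
        IsNonglobal p q N σ ε (Ioi r₀) w ∧
        Tendsto w atTop (𝓝 C) ∧
        Tendsto (fun r => r ^ (-((σ + 1) / (p - 1))) * deriv w r) atTop (𝓝 (-ε * D))) ∧
      (∀ k : ℝ, 0 < k → ∃ c : ℝ, 0 < c ∧ ∃ (r₀ : ℝ) (w : ℝ → ℝ), 0 < r₀ ∧
        IsPosSolution p q N σ ε (Ioi r₀) w ∧ ContDiffOn ℝ 2 w (Ioi r₀) ∧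
        IsNonglobal p q N σ ε (Ioi r₀) w ∧
        Tendsto w atTop (𝓝 0) ∧
        Tendsto (fun r => r ^ ((N - p) / (p - 1)) * w r) atTop (𝓝 k) ∧
        Tendsto (fun r => r ^ ((N - 1) / (p - 1)) * deriv w r) atTop (𝓝 (-c)))) ∧
    -- `ε = -1`: the global solution `w*`
    (0 < aStar p q N σ (-1) ∧
      IsPosSolution p q N σ (-1) (Ioi 0) (wStar p q N σ (-1)) ∧
      ContDiffOn ℝ 2 (wStar p q N σ (-1)) (Ioi 0) ∧
      Tendsto (wStar p q N σ (-1)) (𝓝[>] 0) (𝓝 0) ∧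
      (Tendsto (fun r => |deriv (wStar p q N σ (-1)) r|) (𝓝[>] 0) atTop ↔ -σ < q + 1)) ∧
    -- `ε = -1`: the other global solutions
    (∀ C : ℝ, 0 < C → ∃ D : ℝ, 0 < D ∧ ∃ w : ℝ → ℝ,
      IsPosSolution p q N σ (-1) (Ioi 0) w ∧ ContDiffOn ℝ 2 w (Ioi 0) ∧
      Asymptotics.IsEquivalent (𝓝[>] 0) w (wStar p q N σ (-1)) ∧
      Tendsto w atTop (𝓝 C) ∧
      Tendsto (fun r => r ^ (-((σ + 1) / (p - 1))) * deriv w r) atTop (𝓝 D)) ∧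
    -- `ε = -1`: there are no further global solutions
    (∀ w : ℝ → ℝ, IsPosSolution p q N σ (-1) (Ioi 0) w →
      EqOn w (wStar p q N σ (-1)) (Ioi 0) ∨
      (Asymptotics.IsEquivalent (𝓝[>] 0) w (wStar p q N σ (-1)) ∧
        ∃ C D : ℝ, 0 < C ∧ 0 < D ∧ Tendsto w atTop (𝓝 C) ∧
          Tendsto (fun r => r ^ (-((σ + 1) / (p - 1))) * deriv w r) atTop (𝓝 D))) ∧
    -- `ε = -1`: exterior and interior solutions with a zero or a blow-up at `r₀`
    (∀ r₀ : ℝ, 0 < r₀ →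
      (∃ w : ℝ → ℝ, IsPosSolution p q N σ (-1) (Ioi r₀) w ∧ ContDiffOn ℝ 2 w (Ioi r₀) ∧
        Tendsto w (𝓝[>] r₀) (𝓝 0) ∧
        Asymptotics.IsEquivalent atTop w (wStar p q N σ (-1))) ∧
      (∃ w : ℝ → ℝ, IsPosSolution p q N σ (-1) (Ioi r₀) w ∧
        Tendsto w (𝓝[>] r₀) atTop ∧
        Asymptotics.IsEquivalent atTop w (wStar p q N σ (-1))) ∧
      (∃ w : ℝ → ℝ, IsPosSolution p q N σ (-1) (Ioo 0 r₀) w ∧ ContDiffOn ℝ 2 w (Ioo 0 r₀) ∧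
        IsNonglobal p q N σ (-1) (Ioo 0 r₀) w ∧
        Asymptotics.IsEquivalent (𝓝[>] 0) w (wStar p q N σ (-1)) ∧
        Tendsto w (𝓝[<] r₀) atTop)) ∧
    -- `ε = 1`: no solution near `0`
    (∀ r₀ : ℝ, 0 < r₀ → ¬ ∃ w : ℝ → ℝ, IsPosSolution p q N σ 1 (Ioo 0 r₀) w) := by
  have h : ParameterRange p q N σ := ⟨hp, hq, hσ, hN⟩
  refine ⟨fun ε hε ρ hρ => ?_, fun ε hε => ⟨fun C hC => exists_slow_solution h hε hC,
    fun k hk => exists_fast_solution h hε hk⟩,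
    ⟨aStar_pos h, isPosSolution_wStar h, contDiffOn_wStar h, tendsto_wStar_zero h,
      tendsto_abs_deriv_wStar_iff h⟩, fun C hC => exists_global_solution h hC,
    fun w hw => hw.eq_wStar_or h, fun r₀ hr₀ => ⟨exists_exterior_zero_solution h hr₀,
      exists_exterior_blowup_solution h hr₀, exists_interior_blowup_solution h hr₀⟩,
    fun r₀ hr₀ ⟨w, hw⟩ => not_isPosSolution_one_near_zero h hr₀ hw⟩
  rintro ⟨w, c, hc, hw, hlim⟩
  exact not_tendsto_pos_near_zero h hε hρ hc hw hlim
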